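/- **Theorem (Genus 0 topological recursion, transcendental form).** *Double Hurwitz numbers.* For partitions $\alpha,\beta\vdash d$ with $d\ge 1$ and $g\ge 0$, put $r=r^g_{\alpha,\beta}=-2+2g+l(\alpha)+l(\beta)$, where $l(\cdot)$ is the number of parts. If $\alpha$ has $a_i$ parts equal to $i$, put $|\operatorname{Aut}\alpha|=\prod_i a_i!$. Let $H^g_{\alpha,\beta}$ be $|\operatorname{Aut}\alpha|\,|\operatorname{Aut}\beta|/d!$ times the number of tuples $(\sigma,\tau_1,\dots,\tau_r,\gamma)$ of permutations in $\mathfrak S_d$ such that $\sigma$ has cycle type $\beta$, $\gamma$ has cycle type $\alpha$, the $\tau_i$ are transpositions, $\tau_r\cdots\tau_1\sigma=\gamma$, and $\sigma,\tau_1,\dots,\tau_r$ generate a group acting transitively on $\{1,\dots,d\}$. *Generating series.* Let $u,q_1,q_2,\dots$ be indeterminates, $q_\beta=\prod_i q_{\beta_i}$, and let $m_\alpha$ be the monomial symmetric function. For $m\ge 1$ let $$\mathbf H^0_m(x_1,\dots,x_m)=\sum_{d\ge 1}\ \sum_{\alpha,\beta\vdash d,\ l(\alpha)=m} m_\alpha(x_1,\dots,x_m)\,q_\beta\,u^{l(\beta)}\,\frac{H^0_{\alpha,\beta}}{r^0_{\alpha,\beta}!\,|\operatorname{Aut}\beta|}.$$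 *Change of variables.* Let $Q(t)=\sum_{j\ge1}q_jt^j$ and, for indeterminates $w_1,\dots,w_m$, let $Q_i=Q(w_i)$, $x_i=w_ie^{-uQ_i}$ and $\mu_i=\dfrac{1}{1-u\,w_iQ'(w_i)}$. For $m\ge1$ let $$\mathbf h^0_m(u,w_1,\dots,w_m)=\mathbf H^0_m(w_1e^{-uQ_1},\dots,w_me^{-uQ_m}),\qquad \mathbf h^0_{m,i}=w_i\frac{\partial \mathbf h^0_m}{\partial w_i},$$ which are formal power series in $u,w_1,\dots,w_m$ with coefficients in $\mathbb Q[q_1,q_2,\dots]$. For $\alpha=\{\alpha_1<\dots<\alpha_j\}\subseteq\{1,\dots,m\}$ write $w_\alpha=(w_{\alpha_1},\dots,w_{\alpha_j})$, and for $i\in\alpha$ let $\mathbf h^0_{|\alpha|,i}(u,w_\alpha)=w_i\frac{\partial}{\partial w_i}\mathbf h^0_{j}(u,w_{\alpha_1},\dots,w_{\alpha_j})$. Let $\overline{\{l\}}=\{1,\dots,m\}\setminus\{l\}$, and let $\Omega_{m,i}$ be the set of unordered pairs $\{\alpha,\zeta\}$ of subsets of $\{1,\dots,m\}$ with $\alpha\cup\zeta=\{1,\dots,m\}$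 and $\alpha\cap\zeta=\{i\}$. *Statement.* For every $m\ge 2$, $$\mathbf h^0_m=u^{2-m}\int_0^u\Bigg(\sum_{i=1}^m\ \sum_{\substack{\{\alpha,\zeta\}\in\Omega_{m,i}\\ |\alpha|,|\zeta|\ge2}}\mu_i^2\,\mathbf h^0_{|\alpha|,i}(u,w_\alpha)\,\mathbf h^0_{|\zeta|,i}(u,w_\zeta)+\sum_{\substack{1\le k,l\le m\\ k\ne l}}\frac{w_le^{-uQ_l}\,\mu_k\,\mathbf h^0_{m-1,k}(u,w_{\overline{\{l\}}})}{w_ke^{-uQ_k}-w_le^{-uQ_l}}\Bigg)u^{m-3}\,du .$$ Here the whole integrand (including the factor $u^{m-3}$), which is formed in the field of fractions, is a power series in $u,w_1,\dots,w_m$, and the integral is the formal one, with $w_1,\dots,w_m$ regarded as constants. -/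

import Mathlib

open scoped Nat

noncomputable section

namespace DoubleHurwitz

/-- The order of the group of permutations of the positions of a partition that fix its sequence
of parts: `∏ aᵢ!`, where `aᵢ` is the number of parts equal to `i`. -/
def autCard {d : ℕ} (α : d.Partition) : ℕ :=
  ∏ i ∈ α.parts.toFinset, (α.parts.count i)!

/-- The number `r = -2 + 2g + m + n` of simple branch points, where `m`, `n` are the numbers of
parts of `α`, `β`.  For partitions of `d ≥ 1` one has `m, n ≥ 1`, so nothing is truncated. -/
def simpleCount (g : ℕ) {d : ℕ} (α β : d.Partition) : ℕ :=
  2 * g + α.parts.card + β.parts.card - 2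

/-- `(σ, τ₁, …, τ_r, γ)` is a transitive ordered factorization: `σ` has cycle type `β`, `γ` has
cycle type `α` (fixed points are counted as cycles of length one), the `τᵢ` are transpositions,
`τ_r ⋯ τ₁ σ = γ`, and `σ, τ₁, …, τ_r` generate a transitive subgroup. -/
structure IsTransitiveFactorization {d r : ℕ} (α β : d.Partition)
    (σ : Equiv.Perm (Fin d)) (τ : Fin r → Equiv.Perm (Fin d)) (γ : Equiv.Perm (Fin d)) :
    Prop where
  cycles_left : σ.partition.parts = β.parts
  cycles_right : γ.partition.parts = α.parts
  swaps : ∀ j, (τ j).IsSwap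
  factors : (List.ofFn τ).reverse.prod * σ = γ
  transitive : MulAction.IsPretransitive
    (Subgroup.closure ({σ} ∪ Set.range τ)) (Fin d)

/-- The genus `g` double Hurwitz number `H^g_{α,β}`: the number of transitive ordered
factorizations with `r = -2 + 2g + l(α) + l(β)` transpositions, times `|Aut α| |Aut β| / d!`. -/
def hurwitz (g : ℕ) {d : ℕ} (α β : d.Partition) : ℚ :=
  (autCard α * autCard β : ℚ) / (d ! : ℚ) *
    Nat.card {t : Equiv.Perm (Fin d) × (Fin (simpleCount g α β) → Equiv.Perm (Fin d)) ×
        Equiv.Perm (Fin d) // IsTransitiveFactorization α β t.1 t.2.1 t.2.2}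

/-- The coefficient ring `ℚ[q₁, q₂, …]`. -/
abbrev Coeffs : Type := MvPolynomial ℕ+ ℚ

/-- The indeterminate `q_j` for `j ≥ 1` (and `0` for `j = 0`). -/
def q (j : ℕ) : Coeffs := if hj : 0 < j then MvPolynomial.X ⟨j, hj⟩ else 0

/-- Formal power series over `ℚ[q₁, q₂, …]` in `u` (the variable `none`) and in `m` further
variables (the variables `some i`), which are called `x₁, …, x_m` or `w₁, …, w_m`. -/
abbrev Ser (m : ℕ) : Type := MvPowerSeries (Option (Fin m)) Coeffs

/-- The variable `u`. -/
def u {m : ℕ} : Ser m := MvPowerSeries.X none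

/-- The variable `w_i`. -/
def w {m : ℕ} (i : Fin m) : Ser m := MvPowerSeries.X (some i)

/-- The symmetrized genus `g` series `𝐇^g_m(x₁, …, x_m)`, the sum over `d ≥ 1` and over partitions
`α, β` of `d` with `l(α) = m` of
`m_α(x₁, …, x_m) q_β u^{l(β)} H^g_{α,β} / (r! |Aut β|)`, for `m ≥ 1`.
The coefficient of `x^a` in the monomial symmetric function `m_α` is `1` if the sequence `a` is a
rearrangement of the parts of `α`, and `0` otherwise. -/
def bigH (g m : ℕ) : Ser m := fun n =>
  ∑ α : (∑ i, n (some i)).Partition, ∑ β : (∑ i, n (some i)).Partition,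
    if Finset.univ.val.map (fun i : Fin m => n (some i)) = α.parts ∧ β.parts.card = n none then
      MvPolynomial.C (hurwitz g α β / ((simpleCount g α β)! * autCard β : ℚ)) *
        (β.parts.map q).prod
    else 0

/-- The series `Q(t) = ∑_{j ≥ 1} q_j t^j`. -/
def Q : PowerSeries Coeffs := PowerSeries.mk q

/-- `Q_i = Q(w_i)`. -/
def Qw {m : ℕ} (i : Fin m) : Ser m := Q.subst (w i)

/-- `x_i = w_i e^{-u Q_i}`. -/
def x {m : ℕ} (i : Fin m) : Ser m :=
  w i * (PowerSeries.exp Coeffs).subst (-(u * Qw i))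

/-- `μ_i = 1 / (1 - u w_i Q'(w_i))`. -/
def mu {m : ℕ} (i : Fin m) : Ser m :=
  MvPowerSeries.invOfUnit (1 - u * w i * (PowerSeries.derivative Coeffs Q).subst (w i)) 1

/-- The substitution `u ↦ u`, `x_i ↦ w_i e^{-u Q_i}`. -/
def changeVars {m : ℕ} : Option (Fin m) → Ser m
  | none => u
  | some i => x i

/-- `𝐡^g_m(u, w₁, …, w_m) = 𝐇^g_m(w₁ e^{-u Q₁}, …, w_m e^{-u Q_m})`. -/
def h (g m : ℕ) : Ser m := (bigH g m).subst changeVars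

/-- For `α = {α₁ < … < α_j} ⊆ {1, …, m}`, the series `𝐡^g_j(u, w_{α₁}, …, w_{α_j})`. -/
def hAt {m : ℕ} (g : ℕ) (α : Finset (Fin m)) : Ser m :=
  MvPowerSeries.rename (Option.map (α.orderEmbOfFin rfl)) (h g α.card)

/-- `𝐡^g_{|α|,i}(u, w_α)`, the series `w_i ∂/∂w_i` of `𝐡^g_{|α|}(u, w_α)`. -/
def hDer {m : ℕ} (g : ℕ) (α : Finset (Fin m)) (i : Fin m) : Ser m :=
  w i * MvPowerSeries.pderiv Coeffs (some i) (hAt g α)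

/-- The set of unordered pairs `{α, ζ}` of subsets of `{1, …, m}` with `α ∪ ζ = {1, …, m}` and
`α ∩ ζ = {i}`. -/
def Omega {m : ℕ} (i : Fin m) : Finset (Sym2 (Finset (Fin m))) :=
  (Finset.univ.filter fun p : Finset (Fin m) × Finset (Fin m) =>
    p.1 ∪ p.2 = Finset.univ ∧ p.1 ∩ p.2 = {i}).image fun p => s(p.1, p.2)

/-- The pairs `{α, ζ}` in `Ω_{m,i}` with `l(α), l(ζ) ≥ 2`. -/
def OmegaTwo {m : ℕ} (i : Fin m) : Finset (Sym2 (Finset (Fin m))) :=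
  (Omega i).filter fun p => ∀ α ∈ p.toFinset, 2 ≤ α.card

/-- The formal integral `∫₀ᵘ F du` with `w₁, …, w_m` constant: `u^k w^a ↦ u^{k+1} w^a / (k+1)`. -/
def integral {m : ℕ} (F : Ser m) : Ser m := fun n =>
  if n none = 0 then 0
  else MvPolynomial.C (1 / (n none : ℚ)) *
    MvPowerSeries.coeff (n - Finsupp.single none 1) F

/-- The embedding of power series into their field of fractions. -/
def frac {m : ℕ} : Ser m →+* FractionRing (Ser m) := algebraMap (Ser m) (FractionRing (Ser m))

/-- The sum over `i` and over `{α, ζ} ∈ Ω_{m,i}` with `l(α), l(ζ) ≥ 2` of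
`μ_i² 𝐡^0_{|α|,i}(u, w_α) 𝐡^0_{|ζ|,i}(u, w_ζ)`. -/
def quadraticPart (m : ℕ) : Ser m :=
  ∑ i : Fin m, ∑ p ∈ OmegaTwo i, mu i ^ 2 * (p.map fun α => hDer 0 α i).mul

/-- The sum over `k ≠ l` of
`w_l e^{-u Q_l} μ_k 𝐡^0_{m-1,k}(u, w_{{1, …, m} ∖ {l}}) / (w_k e^{-u Q_k} - w_l e^{-u Q_l})`,
formed in the field of fractions. -/
def joinPart (m : ℕ) : FractionRing (Ser m) :=
  ∑ k : Fin m, ∑ l ∈ Finset.univ.erase k,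
    frac (x l * mu k * hDer 0 ({l}ᶜ : Finset (Fin m)) k) / frac (x k - x l)

/-! The substitutions and inverses above are the genuine ones. -/

theorem constantCoeff_Qw {m : ℕ} (i : Fin m) : MvPowerSeries.constantCoeff (Qw i) = 0 := by
  have hw : PowerSeries.HasSubst (w i) := PowerSeries.HasSubst.X (some i)
  have hQ : PowerSeries.constantCoeff Q = 0 := by
    simp [Q, ← PowerSeries.coeff_zero_eq_constantCoeff_apply, q]
  rw [Qw]
  exact PowerSeries.constantCoeff_subst_eq_zero (by simp [w]) _ hQ

theorem hasSubst_w {m : ℕ} (i : Fin m) : PowerSeries.HasSubst (w i) :=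
  PowerSeries.HasSubst.X (some i)

theorem hasSubst_exp {m : ℕ} (i : Fin m) : PowerSeries.HasSubst (-(u * Qw i)) :=
  PowerSeries.HasSubst.of_constantCoeff_zero (by simp [u])

theorem hasSubst_changeVars {m : ℕ} :
    MvPowerSeries.HasSubst (changeVars : Option (Fin m) → Ser m) := by
  refine MvPowerSeries.hasSubst_of_constantCoeff_zero fun s => ?_
  cases s with
  | none => simp [changeVars, u]
  | some i => simp [changeVars, x, w]

theorem mu_spec {m : ℕ} (i : Fin m) :
    (1 - u * w i * (PowerSeries.derivative Coeffs Q).subst (w i)) * mu i = 1 :=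
  MvPowerSeries.mul_invOfUnit _ 1 (by simp [u])

theorem coeff_x {m : ℕ} (k i : Fin m) :
    MvPowerSeries.coeff (Finsupp.single (some k) 1) (x i) = if i = k then 1 else 0 := by
  classical
  have hE : MvPowerSeries.constantCoeff
      ((PowerSeries.exp Coeffs).subst (-(u * Qw i)) : Ser m) = 1 := by
    have h1 : (PowerSeries.exp Coeffs) = 1 + (PowerSeries.exp Coeffs - 1) := by ring
    rw [h1, PowerSeries.subst_add (hasSubst_exp i), map_add,
      PowerSeries.constantCoeff_subst_eq_zero (by simp [u]) (PowerSeries.exp Coeffs - 1)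
        (by simp)]
    rw [← PowerSeries.coe_substAlgHom (hasSubst_exp i)]
    simp
  rw [x, w, MvPowerSeries.X, MvPowerSeries.coeff_monomial_mul]
  by_cases hik : i = k
  · subst hik
    simpa using hE
  · simp [hik]

theorem x_sub_x_ne_zero {m : ℕ} {k l : Fin m} (hkl : k ≠ l) : x k - x l ≠ 0 := by
  intro h0
  have := congrArg (MvPowerSeries.coeff (Finsupp.single (some k) 1)) h0
  simp [coeff_x, hkl.symm] at this

end DoubleHurwitz

end

/-!
The coefficients of the genus zero series count walks in a symmetric group. A walk consists of a
permutation `σ`, with its orbits, and of transpositions that multiply it one after the other;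
`walkSum` sums over walks, with each transposition given by an ordered pair of points. Instead of
dividing by automorphisms of `α`, the cycles of the final permutation `γ` are labelled by the
indices of `x₁, …, x_m`, so that a coefficient at `u^n x^a` counts walks from a permutation with `n`
cycles to one whose cycle with label `i` has length `a_i` (`weight`, `hurwitzCoeff`); that this is
the series `bigH 0 m` is `coeff_bigH_zero`. Labels make the statements about subsets of variables
immediate: `𝐡_{|J|}(u, w_J)` comes from the part `hurwitzSeries J` of walks whose labels are exactly
the elements of `J` (`hAt_zero`).

The recursion in the variables `x_i` removes the last transposition of a walk. Along a walk the
Riemann–Hurwitz inequality holds (`walkSum_congr`), and genus zero is the case of equality, so the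
last transposition cannot join two cycles of one orbit. It either cuts a cycle, and then it is
determined by the labels and lengths of the two pieces and by one of the points that it moves
(`card_cut`), or it joins two orbits, and then the walk is a shuffle of two shorter walks, both of
genus zero (`walkSum_sum_type`, `sum_walkCount_mul`). This is the join-cut equation,
`hurwitzCoeff_join_cut` for coefficients and `join_cut` for series: twice the number
`u ∂/∂u + m - 2` of transpositions, applied to the series, is a sum of cut terms plus a
quadratic expression in the `x_i ∂/∂x_i` of series in fewer or equally many variables. Cutting a
cycle of length `s` replaces `x_k^s` by `∑_{a + b = s} x_k^a x_l^b`, a geometric sum, which accounts for the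
fractions `x_l / (x_k - x_l)` (`X_sub_X_mul_cutSeries`).

The substitution `x_i = w_i e^{-u Q_i}` turns `x_i ∂/∂x_i` into `μ_i w_i ∂/∂w_i`
(`changeHom_euler_some`), and the operators `u ∂/∂u` with `w` constant and with `x` constant differ
by `∑_i u Q_i x_i ∂/∂x_i` (`euler_none_changeHom`). In the quadratic expression the unknown
`m`-variable series itself occurs, in the terms where one of the two sets is `{i}`. But the one-part
series is known: `x_i ∂/∂x_i` of it becomes `u Q_i` (`changeHom_euler_singleton`), because with one
part the join-cut equation is a differential equation in `u` whose solution is determined by its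
term linear in `u`. Hence these terms cancel exactly the difference of the two operators `u ∂/∂u`,
and what remains is that `(u ∂/∂u + m - 2) 𝐡_m` equals the sum in the theorem (`frac_euler_h`).
As the left side times `u^{m-3}` is `∂/∂u (u^{m-2} 𝐡_m)`, integration gives the result.
-/

noncomputable section

namespace DoubleHurwitz

open Equiv Equiv.Perm
open scoped Classical
open Finset.HasAntidiagonal (antidiagonal mem_antidiagonal)

/-! ### Orbits, cycles and the effect of a transposition -/

section Cycles

variable {X : Type}

/-- The partition of `X` into the cycles of `σ`, fixed points included. -/
def cyc (σ : Perm X) : Setoid X := SameCycle.setoid σ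

/-- The finest coarsening of `π` that puts `x` and `y` into one class. -/
def merge (π : Setoid X) (x y : X) : Setoid X where
  r z w := π z w ∨ (π z x ∧ π w y) ∨ (π z y ∧ π w x)
  iseqv :=
    { refl := fun z => Or.inl (π.refl' z)
      symm := by
        rintro z w (h | h | h)
        · exact Or.inl (π.symm' h)
        · exact Or.inr (Or.inr ⟨h.2, h.1⟩)
        · exact Or.inr (Or.inl ⟨h.2, h.1⟩)
      trans := by
        have hs : ∀ {a b}, π a b → π b a := fun h => π.symm' h
        have ht : ∀ {a b c}, π a b → π b c → π a c := fun h h' => π.trans' h h'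
        rintro z w v (h | ⟨h1, h2⟩ | ⟨h1, h2⟩) (k | ⟨k1, k2⟩ | ⟨k1, k2⟩)
        · exact Or.inl (ht h k)
        · exact Or.inr (Or.inl ⟨ht h k1, k2⟩)
        · exact Or.inr (Or.inr ⟨ht h k1, k2⟩)
        · exact Or.inr (Or.inl ⟨h1, ht (hs k) h2⟩)
        · exact Or.inl (ht h1 (ht (hs k1) (ht h2 (hs k2))))
        · exact Or.inl (ht h1 (hs k2))
        · exact Or.inr (Or.inr ⟨h1, ht (hs k) h2⟩)
        · exact Or.inl (ht h1 (hs k2))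
        · exact Or.inl (ht h1 (ht (hs k1) (ht h2 (hs k2)))) }

/-- The number of classes of a partition. -/
def numClasses (π : Setoid X) : ℕ := Nat.card (Quotient π)

theorem merge_apply (π : Setoid X) (x y z w : X) :
    merge π x y z w ↔ π z w ∨ (π z x ∧ π w y) ∨ (π z y ∧ π w x) := Iff.rfl

theorem le_merge (π : Setoid X) (x y : X) : π ≤ merge π x y := fun {_ _} h => Or.inl h

theorem merge_self (π : Setoid X) (x y : X) : merge π x y x y :=
  Or.inr (Or.inl ⟨π.refl' x, π.refl' y⟩)

theorem merge_le {π ρ : Setoid X} {x y : X} (h : π ≤ ρ) (hxy : ρ x y) : merge π x y ≤ ρ := by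
  rintro z w (k | ⟨k1, k2⟩ | ⟨k1, k2⟩)
  · exact h k
  · exact ρ.trans' (h k1) (ρ.trans' hxy (ρ.symm' (h k2)))
  · exact ρ.trans' (h k1) (ρ.trans' (ρ.symm' hxy) (ρ.symm' (h k2)))

theorem merge_eq_self {π : Setoid X} {x y : X} (h : π x y) : merge π x y = π :=
  le_antisymm (merge_le le_rfl h) (le_merge π x y)

theorem cyc_apply_self (γ : Perm X) (z : X) : cyc γ z (γ z) := ⟨1, by simp⟩

variable [Fintype X]

theorem numClasses_merge {π : Setoid X} {x y : X} (h : ¬ π x y) :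
    numClasses (merge π x y) + 1 = numClasses π := by
  have hb : Function.Bijective
      (fun q : {q : Quotient π // q ≠ Quotient.mk π y} =>
        Setoid.map_of_le (le_merge π x y) q.1) := by
    constructor
    · rintro ⟨p, hp⟩ ⟨q, hq⟩ hpq
      induction p using Quotient.inductionOn with | _ a
      induction q using Quotient.inductionOn with | _ b
      have hab : merge π x y a b := Quotient.exact hpq
      have ha : ¬ π a y := fun h => hp (Quotient.sound h)
      have hb : ¬ π b y := fun h => hq (Quotient.sound h)
      refine Subtype.ext (Quotient.sound (s := π) ?_)
      rcases hab with h | h | h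
      · exact h
      · exact absurd h.2 hb
      · exact absurd h.1 ha
    · intro q
      induction q using Quotient.inductionOn with | _ a
      by_cases ha : π a y
      · exact ⟨⟨Quotient.mk π x, fun h' => h (Quotient.exact h')⟩,
          Quotient.sound (s := merge π x y) (Or.inr (Or.inl ⟨π.refl' x, ha⟩))⟩
      · exact ⟨⟨Quotient.mk π a, fun h' => ha (Quotient.exact h')⟩, rfl⟩
  rw [numClasses, ← Nat.card_eq_of_bijective _ hb, numClasses, Nat.card_eq_fintype_card,
    Nat.card_eq_fintype_card, Fintype.card_subtype_compl, Fintype.card_subtype_eq]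
  have : 0 < Fintype.card (Quotient π) := Fintype.card_pos_iff.2 ⟨Quotient.mk π y⟩
  omega

theorem cyc_iff_iterate {γ : Perm X} {y z : X} :
    cyc γ y z ↔ ∃ i < Function.minimalPeriod γ y, γ^[i] y = z := by
  constructor
  · intro h
    obtain ⟨i, -, hi⟩ := SameCycle.exists_pow_eq' (show SameCycle γ y z from h)
    have hp : 0 < Function.minimalPeriod γ y :=
      Function.minimalPeriod_pos_of_mem_periodicPts (γ.injective.mem_periodicPts y)
    refine ⟨i % Function.minimalPeriod γ y, Nat.mod_lt _ hp, ?_⟩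
    rw [Function.iterate_mod_minimalPeriod_eq, ← hi, ← Equiv.Perm.iterate_eq_pow]
  · rintro ⟨i, -, rfl⟩
    exact ⟨i, by simp [Equiv.Perm.iterate_eq_pow]⟩

theorem cyc_le_iff {γ : Perm X} {π : Setoid X} : cyc γ ≤ π ↔ ∀ z, π z (γ z) := by
  constructor
  · intro h z
    exact h (show SameCycle γ z (γ z) from ⟨1, by simp⟩)
  · intro h z w hzw
    obtain ⟨i, -, rfl⟩ := cyc_iff_iterate.1 hzw
    induction i with
    | zero => exact π.refl' z
    | succ i ih =>
      rw [Function.iterate_succ_apply']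
      exact π.trans' (ih ⟨i, by simp [Equiv.Perm.iterate_eq_pow]⟩) (h _)

theorem card_cyc_class (γ : Perm X) (y : X) :
    (Finset.univ.filter fun z => cyc γ y z).card = Function.minimalPeriod γ y := by
  rw [← Finset.card_range (Function.minimalPeriod γ y)]
  symm
  refine Finset.card_bij (fun i _ => γ^[i] y) ?_ ?_ ?_
  · intro i hi
    exact Finset.mem_filter.2 ⟨Finset.mem_univ _, cyc_iff_iterate.2 ⟨i, Finset.mem_range.1 hi, rfl⟩⟩
  · intro i hi j hj h
    exact Function.iterate_injOn_Iio_minimalPeriod (Finset.mem_range.1 hi) (Finset.mem_range.1 hj) h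
  · intro z hz
    obtain ⟨i, hi, h⟩ := cyc_iff_iterate.1 (Finset.mem_filter.1 hz).2
    exact ⟨i, Finset.mem_range.2 hi, h⟩

theorem exists_iterate_of_cyc {γ : Perm X} {x y : X} (h : cyc γ x y) (hxy : x ≠ y) :
    ∃ j, γ^[j] y = x ∧ 0 < j ∧ j < Function.minimalPeriod γ y := by
  obtain ⟨j, hj, h⟩ := cyc_iff_iterate.1 ((cyc γ).symm' h)
  refine ⟨j, h, Nat.pos_of_ne_zero ?_, hj⟩
  rintro rfl
  exact hxy h.symm

variable [DecidableEq X]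

/-- Multiplying by a transposition of points in different cycles joins the two cycles. -/
theorem cyc_swap_mul_of_not {γ : Perm X} {x y : X} (h : ¬ cyc γ x y) :
    cyc (swap x y * γ) = merge (cyc γ) x y := by
  have hle : cyc (swap x y * γ) ≤ merge (cyc γ) x y := by
    rw [cyc_le_iff]
    intro z
    rw [Perm.mul_apply]
    have hz := cyc_apply_self γ z
    by_cases h1 : γ z = x
    · rw [h1, swap_apply_left]
      exact Or.inr (Or.inl ⟨h1 ▸ hz, (cyc γ).refl' y⟩)
    by_cases h2 : γ z = y
    · rw [h2, swap_apply_right]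
      exact Or.inr (Or.inr ⟨h2 ▸ hz, (cyc γ).refl' x⟩)
    rw [swap_apply_of_ne_of_ne h1 h2]
    exact Or.inl hz
  -- The part of the new cycle of `x` in the old cycle of `x` would be closed under `γ` if it
  -- did not lead to `y`.
  have hxy : cyc (swap x y * γ) x y := by
    by_contra hn
    have step : ∀ z, cyc γ x z → cyc (swap x y * γ) x z →
        γ z ≠ x ∧ cyc (swap x y * γ) x (γ z) := by
      intro z hz hz'
      have h2 : γ z ≠ y := fun h2 => h ((cyc γ).trans' hz (h2 ▸ cyc_apply_self γ z))
      have hz2 := (cyc (swap x y * γ)).trans' hz' (cyc_apply_self _ z)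
      rw [Perm.mul_apply] at hz2
      have h1 : γ z ≠ x := by
        intro h1
        rw [h1, swap_apply_left] at hz2
        exact hn hz2
      rw [swap_apply_of_ne_of_ne h1 h2] at hz2
      exact ⟨h1, hz2⟩
    have all : ∀ i, cyc (swap x y * γ) x (γ^[i] x) ∧ cyc γ x (γ^[i] x) := by
      intro i
      induction i with
      | zero => exact ⟨(cyc _).refl' x, (cyc _).refl' x⟩
      | succ i ih =>
        rw [Function.iterate_succ_apply']
        exact ⟨(step _ ih.2 ih.1).2, (cyc γ).trans' ih.2 (cyc_apply_self γ _)⟩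
    have hp : 0 < Function.minimalPeriod γ x :=
      Function.minimalPeriod_pos_of_mem_periodicPts (γ.injective.mem_periodicPts x)
    obtain ⟨n, hn'⟩ := Nat.exists_eq_succ_of_ne_zero hp.ne'
    refine (step _ (all n).2 (all n).1).1 ?_
    rw [← Function.iterate_succ_apply' γ, ← hn',
      Function.iterate_minimalPeriod]
  refine le_antisymm hle (merge_le (cyc_le_iff.2 fun z => ?_) hxy)
  have hz := cyc_apply_self (swap x y * γ) z
  rw [Perm.mul_apply] at hz
  by_cases h1 : γ z = x
  · rw [h1, swap_apply_left] at hz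
    rw [h1]
    exact (cyc _).trans' hz ((cyc _).symm' hxy)
  by_cases h2 : γ z = y
  · rw [h2, swap_apply_right] at hz
    rw [h2]
    exact (cyc _).trans' hz hxy
  rwa [swap_apply_of_ne_of_ne h1 h2] at hz

/-- A transposition of two points `y` and `x = γ ^ j y` of one cycle splits off the `j` points
`y, γ y, …, γ ^ (j - 1) y`. -/
theorem split_cycle {γ : Perm X} {x y : X} {j : ℕ} (hj : γ^[j] y = x) (h0 : 0 < j)
    (hlt : j < Function.minimalPeriod γ y) :
    Function.minimalPeriod (swap x y * γ) y = j ∧ ¬ cyc (swap x y * γ) x y := by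
  have hne : ∀ i, 0 < i → i < j → γ^[i] y ≠ y ∧ γ^[i] y ≠ x := by
    intro i hi hij
    refine ⟨fun h => ?_, fun h => ?_⟩
    · have := Function.iterate_injOn_Iio_minimalPeriod (f := γ) (x := y)
        (show i < _ by omega) (show 0 < Function.minimalPeriod γ y by omega) (by simpa using h)
      omega
    · have := Function.iterate_injOn_Iio_minimalPeriod (f := γ) (x := y)
        (show i < _ by omega) (show j < _ from hlt) (h.trans hj.symm)
      omega
  have hxy : x ≠ y := by
    intro h
    have := Function.iterate_injOn_Iio_minimalPeriod (f := γ) (x := y)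
        (show j < _ from hlt) (show 0 < Function.minimalPeriod γ y by omega)
        (by simpa [h] using hj)
    omega
  have hit : ∀ i < j, (swap x y * γ)^[i] y = γ^[i] y := by
    intro i
    induction i with
    | zero => intro _; rfl
    | succ i ih =>
      intro hi
      rw [Function.iterate_succ_apply', ih (by omega), Perm.mul_apply,
        ← Function.iterate_succ_apply' γ]
      exact swap_apply_of_ne_of_ne (hne _ (by omega) hi).2 (hne _ (by omega) hi).1
  have hper : Function.IsPeriodicPt (swap x y * γ) j y := by
    obtain ⟨n, rfl⟩ := Nat.exists_eq_succ_of_ne_zero h0.ne'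
    show (swap x y * γ)^[n + 1] y = y
    rw [Function.iterate_succ_apply', hit n (by omega), Perm.mul_apply,
      ← Function.iterate_succ_apply' γ, hj, swap_apply_left]
  have hmin : Function.minimalPeriod (swap x y * γ) y = j := by
    refine le_antisymm (hper.minimalPeriod_le h0) ?_
    by_contra hlt'
    push Not at hlt'
    have hpos := hper.minimalPeriod_pos h0
    refine (hne _ hpos hlt').1 ?_
    rw [← hit _ hlt']
    exact Function.iterate_minimalPeriod
  refine ⟨hmin, fun h => ?_⟩
  obtain ⟨i, hi, h⟩ := cyc_iff_iterate.1 ((cyc _).symm' h)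
  rw [hmin] at hi
  rw [hit i hi] at h
  rcases Nat.eq_zero_or_pos i with rfl | hi0
  · exact hxy h.symm
  · exact (hne i hi0 hi).2 h

theorem not_cyc_swap_mul {γ : Perm X} {x y : X} (h : cyc γ x y) (hxy : x ≠ y) :
    ¬ cyc (swap x y * γ) x y := by
  obtain ⟨j, h1, h2, h3⟩ := exists_iterate_of_cyc h hxy
  exact (split_cycle h1 h2 h3).2

theorem cyc_eq_merge_of_not {γ : Perm X} {x y : X} (h : ¬ cyc (swap x y * γ) x y) :
    cyc γ = merge (cyc (swap x y * γ)) x y := by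
  rw [← cyc_swap_mul_of_not h, ← mul_assoc, swap_mul_self, one_mul]

end Cycles

/-! ### Sums over sequences of transpositions -/

section WalkSum

variable {X Y R : Type}

/-- The partition of `X ⊕ Y` into the classes of a partition of `X` and of one of `Y`. -/
def sumSetoid (π : Setoid X) (ρ : Setoid Y) : Setoid (X ⊕ Y) :=
  Setoid.ker (Sum.map (Quotient.mk π) (Quotient.mk ρ))

@[simp] theorem sumSetoid_inl_inl {π : Setoid X} {ρ : Setoid Y} {x y : X} :
    sumSetoid π ρ (Sum.inl x) (Sum.inl y) ↔ π x y := by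
  rw [sumSetoid, Setoid.ker_def, Sum.map_inl, Sum.map_inl, Sum.inl_injective.eq_iff]
  exact Quotient.eq

@[simp] theorem sumSetoid_inr_inr {π : Setoid X} {ρ : Setoid Y} {x y : Y} :
    sumSetoid π ρ (Sum.inr x) (Sum.inr y) ↔ ρ x y := by
  rw [sumSetoid, Setoid.ker_def, Sum.map_inr, Sum.map_inr, Sum.inr_injective.eq_iff]
  exact Quotient.eq

@[simp] theorem not_sumSetoid_inl_inr {π : Setoid X} {ρ : Setoid Y} {x : X} {y : Y} :
    ¬ sumSetoid π ρ (Sum.inl x) (Sum.inr y) :=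
  fun h => Sum.inl_ne_inr h

@[simp] theorem not_sumSetoid_inr_inl {π : Setoid X} {ρ : Setoid Y} {x : X} {y : Y} :
    ¬ sumSetoid π ρ (Sum.inr y) (Sum.inl x) :=
  fun h => Sum.inr_ne_inl h

theorem setoid_sum_ext {π ρ : Setoid (X ⊕ Y)}
    (h1 : ∀ x y, π (Sum.inl x) (Sum.inl y) ↔ ρ (Sum.inl x) (Sum.inl y))
    (h2 : ∀ x y, π (Sum.inr x) (Sum.inr y) ↔ ρ (Sum.inr x) (Sum.inr y))
    (h3 : ∀ x y, π (Sum.inl x) (Sum.inr y) ↔ ρ (Sum.inl x) (Sum.inr y)) : π = ρ := by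
  ext z w
  rcases z with z | z <;> rcases w with w | w
  · exact h1 z w
  · exact h3 z w
  · rw [π.comm', ρ.comm']
    exact h3 w z
  · exact h2 z w

theorem merge_sumSetoid_inl (π : Setoid X) (ρ : Setoid Y) (x y : X) :
    merge (sumSetoid π ρ) (Sum.inl x) (Sum.inl y) = sumSetoid (merge π x y) ρ := by
  apply setoid_sum_ext <;> simp [merge_apply]

theorem merge_sumSetoid_inr (π : Setoid X) (ρ : Setoid Y) (x y : Y) :
    merge (sumSetoid π ρ) (Sum.inr x) (Sum.inr y) = sumSetoid π (merge ρ x y) := by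
  apply setoid_sum_ext <;> simp [merge_apply]

theorem swap_inl_mul_sumCongr [DecidableEq X] [DecidableEq Y] (x y : X) (γ : Perm X) (δ : Perm Y) :
    (swap (Sum.inl x) (Sum.inl y) * Equiv.sumCongr γ δ : Perm (X ⊕ Y)) =
      Equiv.sumCongr (swap x y * γ) δ := by
  ext z
  rcases z with z | z
  · simp [Sum.inl_injective.swap_apply]
  · simp [swap_apply_of_ne_of_ne]

theorem swap_inr_mul_sumCongr [DecidableEq X] [DecidableEq Y] (x y : Y) (γ : Perm X) (δ : Perm Y) :
    (swap (Sum.inr x) (Sum.inr y) * Equiv.sumCongr γ δ : Perm (X ⊕ Y)) =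
      Equiv.sumCongr γ (swap x y * δ) := by
  ext z
  rcases z with z | z
  · simp [swap_apply_of_ne_of_ne]
  · simp [Sum.inr_injective.swap_apply]

variable [Fintype X] [Fintype Y]

theorem numClasses_sumSetoid (π : Setoid X) (ρ : Setoid Y) :
    numClasses (sumSetoid π ρ) = numClasses π + numClasses ρ := by
  have hs : Function.Surjective (Sum.map (Quotient.mk π) (Quotient.mk ρ)) :=
    Function.Surjective.sumMap Quotient.mk_surjective Quotient.mk_surjective
  rw [numClasses, numClasses, numClasses, ← Nat.card_sum]
  exact Nat.card_congr (Setoid.quotientKerEquivOfSurjective _ hs)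

theorem cyc_permCongr (e : X ≃ Y) (σ : Perm X) :
    cyc (e.permCongr σ) = (cyc σ).comap e.symm := by
  have key : ∀ (i : ℕ) (z : X), (e.permCongr σ)^[i] (e z) = e (σ^[i] z) := by
    intro i z
    induction i with
    | zero => rfl
    | succ i ih => simp [Function.iterate_succ_apply', ih]
  refine le_antisymm (cyc_le_iff.2 fun z => ?_) ?_
  · rw [Setoid.comap_rel]
    simpa using cyc_apply_self σ (e.symm z)
  · intro z w h
    rw [Setoid.comap_rel] at h
    obtain ⟨i, -, hi⟩ := cyc_iff_iterate.1 h
    refine ⟨i, ?_⟩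
    rw [zpow_natCast, ← Equiv.Perm.iterate_eq_pow]
    have := key i (e.symm z)
    rw [hi] at this
    simpa using this

theorem cyc_sumCongr (σ : Perm X) (τ : Perm Y) :
    cyc (Equiv.sumCongr σ τ) = sumSetoid (cyc σ) (cyc τ) := by
  refine le_antisymm (cyc_le_iff.2 ?_) ?_
  · rintro (z | z)
    · simpa using cyc_apply_self σ z
    · simpa using cyc_apply_self τ z
  · have k1 : cyc σ ≤ (cyc (Equiv.sumCongr σ τ)).comap Sum.inl :=
      cyc_le_iff.2 fun z => cyc_apply_self (Equiv.sumCongr σ τ) (Sum.inl z)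
    have k2 : cyc τ ≤ (cyc (Equiv.sumCongr σ τ)).comap Sum.inr :=
      cyc_le_iff.2 fun z => cyc_apply_self (Equiv.sumCongr σ τ) (Sum.inr z)
    rintro (z | z) (w | w) h
    · exact k1 (sumSetoid_inl_inl.1 h)
    · exact absurd h not_sumSetoid_inl_inr
    · exact absurd h not_sumSetoid_inr_inl
    · exact k2 (sumSetoid_inr_inr.1 h)

variable [DecidableEq X] [DecidableEq Y]

/-- The sum of `F σ γ π` over all permutations `σ` and all sequences `(x₁, y₁), …, (x_r, y_r)` of
ordered pairs of distinct points, where `γ = (x_r y_r) ⋯ (x₁ y₁) σ` and `π` is the partition into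
the orbits of the group generated by `σ` and the transpositions `(xᵢ yᵢ)`.  Each sequence of
transpositions is counted `2 ^ r` times. -/
def walkSum [AddCommMonoid R] : ℕ → (Perm X → Perm X → Setoid X → R) → R
  | 0, F => ∑ σ, F σ σ (cyc σ)
  | r + 1, F => walkSum r fun σ γ π =>
      ∑ x, ∑ y, if x = y then 0 else F σ (swap x y * γ) (merge π x y)

theorem walkSum_zero [AddCommMonoid R] (F : Perm X → Perm X → Setoid X → R) :
    walkSum 0 F = ∑ σ, F σ σ (cyc σ) := rfl

theorem walkSum_succ [AddCommMonoid R] (r : ℕ) (F : Perm X → Perm X → Setoid X → R) :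
    walkSum (r + 1) F = walkSum r fun σ γ π =>
      ∑ x, ∑ y, if x = y then 0 else F σ (swap x y * γ) (merge π x y) := rfl

/-- Two summands need to agree only on the triples that satisfy the Riemann–Hurwitz inequality: a
product of `σ` with `r` transpositions has at most `r + 2 c - l` cycles, if `σ` has `l` cycles and
there are `c` orbits. -/
theorem walkSum_congr [AddCommMonoid R] {r : ℕ} {F G : Perm X → Perm X → Setoid X → R}
    (h : ∀ σ γ π, cyc γ ≤ π →
      numClasses (cyc σ) + numClasses (cyc γ) ≤ r + 2 * numClasses π → F σ γ π = G σ γ π) :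
    walkSum r F = walkSum r G := by
  induction r generalizing F G with
  | zero =>
    exact Finset.sum_congr rfl fun σ _ => h σ σ _ le_rfl (by omega)
  | succ r ih =>
    refine ih fun σ γ π hγ hle => Finset.sum_congr rfl fun x _ => Finset.sum_congr rfl fun y _ => ?_
    split_ifs with hxy
    · rfl
    refine h _ _ _ ?_ ?_
    · refine cyc_le_iff.2 fun z => ?_
      rw [Perm.mul_apply]
      have hz : π z (γ z) := hγ (cyc_apply_self γ z)
      by_cases h1 : γ z = x
      · rw [h1, swap_apply_left]
        exact Or.inr (Or.inl ⟨h1 ▸ hz, π.refl' y⟩)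
      by_cases h2 : γ z = y
      · rw [h2, swap_apply_right]
        exact Or.inr (Or.inr ⟨h2 ▸ hz, π.refl' x⟩)
      rw [swap_apply_of_ne_of_ne h1 h2]
      exact Or.inl hz
    · by_cases hc : cyc γ x y
      · rw [merge_eq_self (hγ hc)]
        have := numClasses_merge (not_cyc_swap_mul hc hxy)
        rw [← cyc_eq_merge_of_not (not_cyc_swap_mul hc hxy)] at this
        omega
      · have h1 := numClasses_merge hc
        rw [← cyc_swap_mul_of_not hc] at h1
        by_cases hp : π x y
        · rw [merge_eq_self hp]
          omega
        · have h2 := numClasses_merge hp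
          omega

theorem walkSum_add [AddCommMonoid R] (r : ℕ) (F G : Perm X → Perm X → Setoid X → R) :
    walkSum r (fun σ γ π => F σ γ π + G σ γ π) = walkSum r F + walkSum r G := by
  induction r generalizing F G with
  | zero => exact Finset.sum_add_distrib
  | succ r ih =>
    rw [walkSum_succ, walkSum_succ, walkSum_succ, ← ih]
    congr 1
    funext σ γ π
    rw [← Finset.sum_add_distrib]
    refine Finset.sum_congr rfl fun x _ => ?_
    rw [← Finset.sum_add_distrib]
    refine Finset.sum_congr rfl fun y _ => ?_
    split_ifs <;> simp

theorem walkSum_fun_zero [AddCommMonoid R] (r : ℕ) :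
    walkSum r (fun (_ : Perm X) (_ : Perm X) (_ : Setoid X) => (0 : R)) = 0 := by
  induction r with
  | zero => exact Finset.sum_const_zero
  | succ r ih => simpa [walkSum_succ] using ih

theorem walkSum_map {R' : Type} [AddCommMonoid R] [AddCommMonoid R'] (f : R →+ R') (r : ℕ)
    (F : Perm X → Perm X → Setoid X → R) :
    walkSum r (fun σ γ π => f (F σ γ π)) = f (walkSum r F) := by
  induction r generalizing F with
  | zero => simp [walkSum_zero, map_sum]
  | succ r ih => simp only [walkSum_succ, ← ih, map_sum, apply_ite f, map_zero]

theorem walkSum_sum [AddCommMonoid R] {κ : Type*} (s : Finset κ) (r : ℕ)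
    (F : κ → Perm X → Perm X → Setoid X → R) :
    walkSum r (fun σ γ π => ∑ k ∈ s, F k σ γ π) = ∑ k ∈ s, walkSum r (F k) := by
  induction s using Finset.induction_on with
  | empty => simpa using walkSum_fun_zero r
  | insert a s ha ih => simp only [Finset.sum_insert ha, walkSum_add, ih]

theorem walkSum_mul_left [Semiring R] (r : ℕ) (a : R) (F : Perm X → Perm X → Setoid X → R) :
    walkSum r (fun σ γ π => a * F σ γ π) = a * walkSum r F :=
  walkSum_map (AddMonoidHom.mulLeft a) r F

theorem walkSum_mul_right [Semiring R] (r : ℕ) (a : R) (F : Perm X → Perm X → Setoid X → R) :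
    walkSum r (fun σ γ π => F σ γ π * a) = walkSum r F * a :=
  walkSum_map (AddMonoidHom.mulRight a) r F

theorem walkSum_equiv [AddCommMonoid R] (e : X ≃ Y) (r : ℕ)
    (F : Perm Y → Perm Y → Setoid Y → R) :
    walkSum r (fun σ γ π => F (e.permCongr σ) (e.permCongr γ) (π.comap e.symm)) =
      walkSum r F := by
  induction r generalizing F with
  | zero =>
    simp only [walkSum_zero, ← cyc_permCongr]
    exact e.permCongr.sum_comp fun σ => F σ σ (cyc σ)
  | succ r ih =>
    rw [walkSum_succ, walkSum_succ, ← ih]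
    congr 1
    funext σ γ π
    rw [← e.sum_comp]
    refine Finset.sum_congr rfl fun x _ => ?_
    rw [← e.sum_comp]
    refine Finset.sum_congr rfl fun y _ => ?_
    have h1 : e.permCongr (swap x y * γ) = swap (e x) (e y) * e.permCongr γ := by
      ext z
      simp [Equiv.permCongr_apply, e.injective.swap_apply]
    have h2 : (merge π x y).comap e.symm = merge (π.comap e.symm) (e x) (e y) := by
      ext z w
      simp [Setoid.comap_rel, merge_apply]
    simp only [h1, h2, e.injective.eq_iff]

/-- Walks whose orbits do not mix `X` and `Y` are shuffles of a walk on `X` and a walk on `Y`. -/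
theorem walkSum_sum_type [AddCommMonoid R] (r : ℕ)
    (F : Perm (X ⊕ Y) → Perm (X ⊕ Y) → Setoid (X ⊕ Y) → R)
    (hF : ∀ σ γ π, ¬ π ≤ sumSetoid ⊤ ⊤ → F σ γ π = 0) :
    walkSum r F = ∑ p ∈ antidiagonal r, r.choose p.1 •
      walkSum p.1 (fun σ γ π => walkSum p.2 fun σ' γ' π' =>
        F (Equiv.sumCongr σ σ') (Equiv.sumCongr γ γ') (sumSetoid π π')) := by
  induction r generalizing F with
  | zero =>
    simp only [Finset.Nat.antidiagonal_zero, Finset.sum_singleton, Nat.choose_self, one_smul,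
      walkSum_zero, ← cyc_sumCongr]
    rw [← Fintype.sum_prod_type']
    symm
    refine Finset.sum_of_injOn (fun p : Perm X × Perm Y => Equiv.sumCongr p.1 p.2) ?_ ?_ ?_ ?_
    · exact fun p _ p' _ h => sumCongrHom_injective h
    · exact fun p _ => Finset.mem_coe.2 (Finset.mem_univ _)
    · intro σ _ hσ
      refine hF _ _ _ fun hle => hσ ?_
      have : σ ∈ (sumCongrHom X Y).range := by
        refine mem_sumCongrHom_range_of_perm_mapsTo_inl ?_
        rintro _ ⟨x, rfl⟩
        have := hle (cyc_apply_self σ (Sum.inl x))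
        rcases hx : σ (Sum.inl x) with y | y
        · exact ⟨y, rfl⟩
        · rw [hx] at this
          exact absurd this not_sumSetoid_inl_inr
      obtain ⟨p, rfl⟩ := this
      exact ⟨p, Finset.mem_coe.2 (Finset.mem_univ _), rfl⟩
    · exact fun p _ => rfl
  | succ r ih =>
    rw [walkSum_succ, ih]
    swap
    · intro σ γ π hπ
      refine Finset.sum_eq_zero fun x _ => Finset.sum_eq_zero fun y _ => ?_
      split_ifs
      · rfl
      · exact hF _ _ _ fun h => hπ ((le_merge π x y).trans h)
    rw [Finset.sum_antidiagonal_choose_succ_nsmul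
      (fun s t => walkSum s (fun σ γ π => walkSum t fun σ' γ' π' =>
        F (Equiv.sumCongr σ σ') (Equiv.sumCongr γ γ') (sumSetoid π π'))) r,
      ← Finset.sum_add_distrib]
    refine Finset.sum_congr rfl fun p hp => ?_
    have hch : r.choose p.2 = r.choose p.1 := by
      rw [← mem_antidiagonal.1 hp, Nat.choose_symm_add]
    rw [hch, ← smul_add]
    congr 1
    have cross1 : ∀ (π : Setoid X) (ρ : Setoid Y) (x : X) (y : Y),
        ¬ merge (sumSetoid π ρ) (Sum.inl x) (Sum.inr y) ≤ sumSetoid ⊤ ⊤ := fun π ρ x y h =>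
      not_sumSetoid_inl_inr (h (merge_self _ _ _))
    have cross2 : ∀ (π : Setoid X) (ρ : Setoid Y) (x : X) (y : Y),
        ¬ merge (sumSetoid π ρ) (Sum.inr y) (Sum.inl x) ≤ sumSetoid ⊤ ⊤ := fun π ρ x y h =>
      not_sumSetoid_inr_inl (h (merge_self _ _ _))
    simp only [Fintype.sum_sum_type, Sum.inl_injective.eq_iff, Sum.inr_injective.eq_iff,
      reduceCtorEq, if_false, swap_inl_mul_sumCongr, swap_inr_mul_sumCongr, merge_sumSetoid_inl,
      merge_sumSetoid_inr, hF _ _ _ (cross1 _ _ _ _), hF _ _ _ (cross2 _ _ _ _),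
      Finset.sum_const_zero, add_zero, zero_add]
    simp only [walkSum_add]
    rw [add_comm, walkSum_succ]
    congr 1
    congr 1
    funext σ γ π
    rw [walkSum_sum]
    refine Finset.sum_congr rfl fun x _ => ?_
    rw [walkSum_sum]
    refine Finset.sum_congr rfl fun y _ => ?_
    by_cases hxy : x = y
    · simp only [hxy, if_true]
      exact walkSum_fun_zero _
    · simp only [hxy, if_false]

end WalkSum

/-! ### Labellings of cycles -/

section Labellings

variable {X Y ι : Type}

/-- The exponent `e` with the label `l` replaced by `k`. -/
def mergeLabels (e : Option ι →₀ ℕ) (k l : ι) : Option ι →₀ ℕ :=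
  e.erase (some l) + Finsupp.single (some k) (e (some l))

/-- The labelling `c` with the label `l` replaced by `k`. -/
def relabel (c : X → ι) (k l : ι) : X → ι := fun z => if c z = l then k else c z

theorem mergeLabels_none (e : Option ι →₀ ℕ) (k l : ι) : mergeLabels e k l none = e none := by
  simp [mergeLabels]

theorem mergeLabels_left (e : Option ι →₀ ℕ) {k l : ι} (h : k ≠ l) :
    mergeLabels e k l (some k) = e (some k) + e (some l) := by
  simp [mergeLabels, Finsupp.erase_ne, h]

theorem mergeLabels_right (e : Option ι →₀ ℕ) {k l : ι} (h : k ≠ l) :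
    mergeLabels e k l (some l) = 0 := by
  simp [mergeLabels, h]

theorem mergeLabels_of_ne (e : Option ι →₀ ℕ) {k l i : ι} (hk : i ≠ k) (hl : i ≠ l) :
    mergeLabels e k l (some i) = e (some i) := by
  simp [mergeLabels, Finsupp.erase_ne, hk.symm, hl]

theorem mergeLabels_inj {e f : Option ι →₀ ℕ} {k l : ι} (hkl : k ≠ l)
    (h : mergeLabels e k l = mergeLabels f k l) (hl : e (some l) = f (some l)) : e = f := by
  ext o
  have ho := DFunLike.congr_fun h o
  rcases o with _ | i
  · rwa [mergeLabels_none, mergeLabels_none] at ho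
  · by_cases hil : i = l
    · rw [hil, hl]
    by_cases hik : i = k
    · subst hik
      rw [mergeLabels_left _ hkl, mergeLabels_left _ hkl, hl] at ho
      omega
    rwa [mergeLabels_of_ne _ hik hil, mergeLabels_of_ne _ hik hil] at ho

theorem numClasses_comap (e : X ≃ Y) (π : Setoid X) :
    numClasses (π.comap e.symm) = numClasses π := by
  have hs : Function.Surjective (Quotient.mk π ∘ e.symm) :=
    Quotient.mk_surjective.comp e.symm.surjective
  have h : π.comap e.symm = Setoid.ker (Quotient.mk π ∘ e.symm) := Setoid.comap_eq
  rw [h, numClasses, Nat.card_congr (Setoid.quotientKerEquivOfSurjective _ hs), numClasses]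

theorem ker_relabel (c : X → ι) {k l : ι} {x y : X} (hx : c x = k) (hy : c y = l) :
    Setoid.ker (relabel c k l) = merge (Setoid.ker c) x y := by
  subst hx hy
  ext z w
  simp only [Setoid.ker_def, merge_apply, relabel]
  split_ifs with h1 h2 h2
  · simp [h1, h2]
  · simp only [h1, h2, eq_comm (a := c y) (b := c w), eq_comm (a := c x) (b := c w), and_false,
      false_or, true_and]
  · simp [h1, h2]
  · simp [h1, h2]

variable [Fintype X] [Fintype Y] [Fintype ι]

/-- The monomial `∏ q_j` over the classes of `π`, where `j` is the size of the class. -/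
def qWeight (π : Setoid X) : Coeffs :=
  ∏ a : Quotient π, q (Finset.univ.filter fun x => Quotient.mk π x = a).card

/-- The exponent of `u` and of `x₁, x₂, …` that records the number of classes of `π` and the
number of points with each label. -/
def stat (π : Setoid X) (c : X → ι) : Option ι →₀ ℕ :=
  Finsupp.equivFunOnFinite.symm fun o =>
    o.elim (numClasses π) fun i => (Finset.univ.filter fun x => c x = i).card

@[simp] theorem stat_none (π : Setoid X) (c : X → ι) : stat π c none = numClasses π := rfl

@[simp] theorem stat_some (π : Setoid X) (c : X → ι) (i : ι) :
    stat π c (some i) = (Finset.univ.filter fun x => c x = i).card := rfl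

theorem stat_some_ne_zero {π : Setoid X} {c : X → ι} {i : ι} :
    stat π c (some i) ≠ 0 ↔ ∃ x, c x = i := by
  rw [stat_some, Finset.card_ne_zero]
  simp [Finset.Nonempty]

/-- The labels that occur in an exponent. -/
def labels (e : Option ι →₀ ℕ) : Finset ι := Finset.univ.filter fun i => e (some i) ≠ 0

/-- The total degree of an exponent in `x₁, x₂, …`. -/
def size (e : Option ι →₀ ℕ) : ℕ := ∑ i, e (some i)

theorem mem_labels {e : Option ι →₀ ℕ} {i : ι} : i ∈ labels e ↔ e (some i) ≠ 0 := by
  simp [labels]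

theorem size_stat (π : Setoid X) (c : X → ι) : size (stat π c) = Fintype.card X := by
  simp only [size, stat_some]
  rw [← Finset.card_univ]
  exact (Finset.card_eq_sum_card_fiberwise fun x _ => Finset.mem_coe.2 (Finset.mem_univ (c x))).symm

theorem numClasses_ker (π : Setoid X) (c : X → ι) :
    numClasses (Setoid.ker c) = (labels (stat π c)).card := by
  rw [numClasses, Nat.card_congr (Setoid.quotientKerEquivRange c), Nat.card_eq_fintype_card,
    ← Set.toFinset_card]
  congr 1
  ext i
  rw [mem_labels, stat_some_ne_zero]
  simp

theorem qWeight_ker {κ : Type} [Fintype κ] {f : X → κ} (hf : Function.Surjective f) :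
    qWeight (Setoid.ker f) = ∏ k, q (Finset.univ.filter fun x => f x = k).card := by
  refine Fintype.prod_equiv (Setoid.quotientKerEquivOfSurjective f hf) _ _ fun a => ?_
  induction a using Quotient.inductionOn with | _ x
  congr 2
  ext z
  simp only [Finset.mem_filter, Finset.mem_univ, true_and]
  exact Quotient.eq

theorem card_filter_sum (p : X ⊕ Y → Prop) :
    (Finset.univ.filter p).card = (Finset.univ.filter fun x => p (Sum.inl x)).card +
      (Finset.univ.filter fun y => p (Sum.inr y)).card := by
  rw [Finset.card_filter, Fintype.sum_sum_type, Finset.card_filter, Finset.card_filter]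

theorem qWeight_sumSetoid (π : Setoid X) (ρ : Setoid Y) :
    qWeight (sumSetoid π ρ) = qWeight π * qWeight ρ := by
  have hs : Function.Surjective (Sum.map (Quotient.mk π) (Quotient.mk ρ)) :=
    Function.Surjective.sumMap Quotient.mk_surjective Quotient.mk_surjective
  rw [sumSetoid, qWeight_ker hs, Fintype.prod_sum_type, qWeight, qWeight]
  congr 1
  · refine Finset.prod_congr rfl fun a _ => ?_
    rw [card_filter_sum]
    simp
  · refine Finset.prod_congr rfl fun a _ => ?_
    rw [card_filter_sum]
    simp

theorem qWeight_comap (e : X ≃ Y) (π : Setoid X) : qWeight (π.comap e.symm) = qWeight π := by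
  have hs : Function.Surjective (Quotient.mk π ∘ e.symm) :=
    Quotient.mk_surjective.comp e.symm.surjective
  have h : π.comap e.symm = Setoid.ker (Quotient.mk π ∘ e.symm) := Setoid.comap_eq
  rw [h, qWeight_ker hs, qWeight]
  refine Finset.prod_congr rfl fun a _ => ?_
  congr 1
  refine Finset.card_bij (fun y _ => e.symm y) ?_ ?_ ?_
  · simp
  · simp
  · intro x hx
    exact ⟨e x, by simpa using hx, by simp⟩

theorem stat_comap (e : X ≃ Y) (π : Setoid X) (c : X → ι) :
    stat (π.comap e.symm) (c ∘ e.symm) = stat π c := by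
  ext o
  rcases o with _ | i
  · simp [numClasses_comap]
  · rw [stat_some, stat_some]
    refine Finset.card_bij (fun y _ => e.symm y) ?_ ?_ ?_
    · simp
    · simp
    · intro x hx
      exact ⟨e x, by simpa using hx, by simp⟩

theorem stat_sumSetoid (π : Setoid X) (ρ : Setoid Y) (c : X → ι) (c' : Y → ι) :
    stat (sumSetoid π ρ) (Sum.elim c c') = stat π c + stat ρ c' := by
  ext o
  rcases o with _ | i
  · simp [numClasses_sumSetoid]
  · rw [Finsupp.add_apply, stat_some, stat_some, stat_some, card_filter_sum]
    rfl

theorem stat_relabel (π : Setoid X) (c : X → ι) {k l : ι} (h : k ≠ l) :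
    stat π (relabel c k l) = mergeLabels (stat π c) k l := by
  ext o
  rcases o with _ | i
  · rw [mergeLabels_none]
    rfl
  · by_cases hil : i = l
    · subst hil
      rw [mergeLabels_right _ h, stat_some, Finset.card_eq_zero, Finset.filter_eq_empty_iff]
      intro z _
      simp only [relabel]
      split_ifs with hz
      · exact h
      · exact hz
    by_cases hik : i = k
    · subst hik
      rw [mergeLabels_left _ h, stat_some, stat_some, stat_some, ← Finset.card_union_of_disjoint]
      · congr 1
        ext z
        simp only [Finset.mem_union, Finset.mem_filter, Finset.mem_univ, true_and]
        simp only [relabel]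
        split_ifs with hz <;> simp [hz]
      · rw [Finset.disjoint_filter]
        exact fun z _ hz hz' => h (hz.symm.trans hz')
    · rw [mergeLabels_of_ne _ hik hil, stat_some, stat_some]
      congr 1
      ext z
      simp only [Finset.mem_filter, Finset.mem_univ, true_and]
      simp only [relabel]
      split_ifs with hz
      · exact ⟨fun h' => absurd h'.symm hik, fun h' => absurd (h'.symm.trans hz) hil⟩
      · rfl

/-- The number of labellings of the cycles of `γ` with statistics `e`. -/
def numLabellings (γ : Perm X) (π : Setoid X) (e : Option ι →₀ ℕ) : ℕ :=
  (Finset.univ.filter fun c : X → ι => Setoid.ker c = cyc γ ∧ stat π c = e).card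

/-- A cycle with label `k` and length `a_k + a_l` can be cut into a cycle with label `k` and length
`a_k` that contains `x` and one with label `l` and length `a_l` that contains `y` in
`a_k + a_l` ways, one for each choice of `x`. -/
theorem card_cut (γ : Perm X) (π : Setoid X) {k l : ι} (hkl : k ≠ l)
    {e : Option ι →₀ ℕ} (hk : e (some k) ≠ 0) (hl : e (some l) ≠ 0) :
    (Finset.univ.filter fun t : X × X × (X → ι) => t.2.2 t.1 = k ∧ t.2.2 t.2.1 = l ∧
      Setoid.ker t.2.2 = cyc (swap t.1 t.2.1 * γ) ∧ stat π t.2.2 = e).card =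
    numLabellings γ π (mergeLabels e k l) * (e (some k) + e (some l)) := by
  have hR : numLabellings γ π (mergeLabels e k l) * (e (some k) + e (some l)) =
      ((Finset.univ.filter fun c : X → ι => Setoid.ker c = cyc γ ∧
        stat π c = mergeLabels e k l).sigma fun c => Finset.univ.filter fun x => c x = k).card := by
    rw [numLabellings, Finset.card_sigma, ← smul_eq_mul, ← Finset.sum_const]
    refine Finset.sum_congr rfl fun c hc => ?_
    have := (Finset.mem_filter.1 hc).2.2
    rw [← stat_some π, this, mergeLabels_left _ hkl]
  rw [hR]
  -- The length of the cycle of `y` after the cut determines `y`.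
  have key : ∀ (x y : X) (c : X → ι), c x = k → c y = l →
      Setoid.ker c = cyc (swap x y * γ) → stat π c = e → cyc γ = Setoid.ker (relabel c k l) ∧
        γ^[e (some l)] y = x := by
    intro x y c hx hy hc hs
    have hxy : x ≠ y := fun h => hkl (by rw [← hx, ← hy, h])
    have hn : ¬ cyc (swap x y * γ) x y := by
      rw [← hc, Setoid.ker_def, hx, hy]
      exact hkl
    have h1 := cyc_eq_merge_of_not hn
    refine ⟨by rw [ker_relabel c hx hy, hc, ← h1], ?_⟩
    obtain ⟨j, hj, h0, hlt⟩ := exists_iterate_of_cyc (γ := γ) (x := x) (y := y)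
      (by rw [h1]; exact merge_self _ _ _) hxy
    have hmin := (split_cycle hj h0 hlt).1
    rw [← card_cyc_class, ← hc] at hmin
    have : j = e (some l) := by
      rw [← hs, stat_some, ← hmin]
      congr 1
      ext z
      simp [Setoid.ker_def, hy, eq_comm]
    rwa [← this]
  refine Finset.card_bij (fun t _ => ⟨relabel t.2.2 k l, t.1⟩) ?_ ?_ ?_
  · rintro ⟨x, y, c⟩ ht
    obtain ⟨hx, hy, hc, hs⟩ := (Finset.mem_filter.1 ht).2
    dsimp only at hx hy hc hs
    simp only [Finset.mem_sigma, Finset.mem_filter, Finset.mem_univ, true_and]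
    refine ⟨⟨(key x y c hx hy hc hs).1.symm, by rw [stat_relabel _ _ hkl, hs]⟩, ?_⟩
    simp [relabel, hx]
  · rintro ⟨x, y, c⟩ ht ⟨x', y', c'⟩ ht' h
    obtain ⟨hx, hy, hc, hs⟩ := (Finset.mem_filter.1 ht).2
    obtain ⟨hx', hy', hc', hs'⟩ := (Finset.mem_filter.1 ht').2
    dsimp only at hx hy hc hs hx' hy' hc' hs'
    simp only [Sigma.mk.injEq, heq_eq_eq] at h
    obtain ⟨hr, rfl⟩ := h
    have hyy : y = y' := by
      refine (γ.injective.iterate (e (some l))) ?_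
      rw [(key x y c hx hy hc hs).2, (key x y' c' hx' hy' hc' hs').2]
    subst hyy
    have hcc : c = c' := by
      funext z
      have hz : c z = l ↔ c' z = l := by
        rw [← hy, ← Setoid.ker_def (f := c), hc, ← hc', Setoid.ker_def, hy', hy]
      have hrz := congrFun hr z
      simp only [relabel] at hrz
      by_cases hzl : c z = l
      · rw [hzl, hz.1 hzl]
      · rwa [if_neg hzl, if_neg (fun h => hzl (hz.2 h))] at hrz
    rw [hcc]
  · rintro ⟨c', x⟩ ht
    simp only [Finset.mem_sigma, Finset.mem_filter, Finset.mem_univ, true_and] at ht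
    obtain ⟨⟨hc, hs⟩, hx⟩ := ht
    set y := (γ ^ (e (some l))).symm x with hy
    have hj : γ^[e (some l)] y = x := by
      rw [Equiv.Perm.iterate_eq_pow, hy, Equiv.apply_symm_apply]
    have hyx : cyc γ y x := ⟨e (some l), by rw [zpow_natCast, ← Equiv.Perm.iterate_eq_pow, hj]⟩
    have hyk : c' y = k := by
      rw [← hc, Setoid.ker_def] at hyx
      rw [hyx, hx]
    have hper : Function.minimalPeriod γ y = e (some k) + e (some l) := by
      rw [← card_cyc_class, ← mergeLabels_left e hkl, ← hs, stat_some, ← hc]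
      congr 1
      ext z
      simp [Setoid.ker_def, hyk, eq_comm]
    obtain ⟨hmin, hn⟩ := split_cycle hj (Nat.pos_of_ne_zero hl) (by omega)
    have h1 := cyc_eq_merge_of_not hn
    have hl' : ∀ z, c' z ≠ l := by
      intro z hz
      have := (stat_some_ne_zero (π := π)).2 ⟨z, hz⟩
      rw [hs, mergeLabels_right _ hkl] at this
      exact this rfl
    set c : X → ι := fun z => if cyc (swap x y * γ) y z then l else c' z with hcdef
    have hcl : ∀ z, c z = l ↔ cyc (swap x y * γ) y z := by
      intro z
      simp only [hcdef]
      split_ifs with h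
      · simp [h]
      · simp [h, hl' z]
    have hrel : relabel c k l = c' := by
      funext z
      simp only [relabel, hcl]
      split_ifs with h
      · have : cyc γ y z := by
          rw [h1]
          exact le_merge _ _ _ h
        rw [← hc, Setoid.ker_def, hyk] at this
        exact this
      · simp only [hcdef, if_neg h]
    have hcx : c x = k := by
      have : ¬ c x = l := by
        rw [hcl]
        exact fun h => hn ((cyc _).symm' h)
      have h2 := congrFun hrel x
      rw [relabel, if_neg this, hx] at h2
      exact h2
    have hcy : c y = l := (hcl y).2 ((cyc _).refl' y)
    have hker : Setoid.ker c = cyc (swap x y * γ) := by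
      ext z w
      rw [Setoid.ker_def]
      by_cases hz : cyc (swap x y * γ) y z
      · rw [(hcl z).2 hz, eq_comm, hcl]
        exact ⟨fun h => (cyc _).trans' ((cyc _).symm' hz) h, fun h => (cyc _).trans' hz h⟩
      by_cases hw : cyc (swap x y * γ) y w
      · rw [(hcl w).2 hw, hcl]
        exact ⟨fun h => absurd h hz, fun h => absurd ((cyc _).trans' hw ((cyc _).symm' h)) hz⟩
      have hz' : c z = c' z := if_neg hz
      have hw' : c w = c' w := if_neg hw
      rw [hz', hw', ← Setoid.ker_def (f := c'), hc, h1, merge_apply]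
      refine ⟨?_, Or.inl⟩
      rintro (h | h | h)
      · exact h
      · exact absurd ((cyc _).symm' h.2) hw
      · exact absurd ((cyc _).symm' h.1) hz
    have hstat : stat π c = e := by
      refine mergeLabels_inj hkl ?_ ?_
      · rw [← stat_relabel _ _ hkl, hrel, hs]
      · rw [stat_some, ← hmin, ← card_cyc_class]
        simp only [hcl]
    exact ⟨(x, y, c), Finset.mem_filter.2 ⟨Finset.mem_univ _, hcx, hcy, hker, hstat⟩,
      by simp [hrel]⟩

end Labellings

/-! ### The last transposition: cuts and joins -/

section JoinCut

variable {X Y ι : Type}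

theorem ker_sumElim_eq_merge (c : X → ι) (c' : Y → ι) (π : Setoid X) (ρ : Setoid Y) (x : X)
    (y : Y) :
    Setoid.ker (Sum.elim c c') = merge (sumSetoid π ρ) (Sum.inl x) (Sum.inr y) ↔
      (Setoid.ker c = π ∧ Setoid.ker c' = ρ) ∧
        c x = c' y ∧ ∀ x' y', c x' = c' y' → c x' = c x := by
  constructor
  · intro h
    have h1 : ∀ z w, c z = c w ↔ π z w := by
      intro z w
      have := Setoid.ext_iff.1 h (Sum.inl z) (Sum.inl w)
      simpa [Setoid.ker_def, merge_apply] using this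
    have h2 : ∀ z w, c' z = c' w ↔ ρ z w := by
      intro z w
      have := Setoid.ext_iff.1 h (Sum.inr z) (Sum.inr w)
      simpa [Setoid.ker_def, merge_apply] using this
    have h3 : ∀ z w, c z = c' w ↔ π z x ∧ ρ w y := by
      intro z w
      have := Setoid.ext_iff.1 h (Sum.inl z) (Sum.inr w)
      simpa [Setoid.ker_def, merge_apply] using this
    refine ⟨⟨Setoid.ext h1, Setoid.ext h2⟩, (h3 x y).2 ⟨π.refl' x, ρ.refl' y⟩, ?_⟩
    exact fun x' y' h' => (h1 _ _).2 ((h3 _ _).1 h').1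
  · rintro ⟨⟨rfl, rfl⟩, hxy, h⟩
    apply setoid_sum_ext
    · intro z w
      simp [Setoid.ker_def, merge_apply]
    · intro z w
      simp [Setoid.ker_def, merge_apply]
    · intro z w
      simp only [Setoid.ker_def, merge_apply, Sum.elim_inl, Sum.elim_inr, not_sumSetoid_inl_inr,
        sumSetoid_inl_inl, sumSetoid_inr_inr, false_or, false_and, or_false]
      refine ⟨fun h' => ?_, fun h' => by rw [h'.1, h'.2, hxy]⟩
      have hz := h _ _ h'
      exact ⟨hz, by rw [← h', hz, hxy]⟩

theorem ker_eq_sumSetoid_top {p : X ⊕ Y → Prop} (hl : ∀ x, p (Sum.inl x))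
    (hr : ∀ y, ¬ p (Sum.inr y)) : Setoid.ker p = sumSetoid ⊤ ⊤ := by
  apply setoid_sum_ext <;> intro x y <;> simp [Setoid.ker_def, hl, hr]

variable [Fintype X] [Fintype Y] [Fintype ι]

/-- The weight of a walk from `σ` to `γ` with orbit partition `π`: if there is only one orbit, the
monomial `q_σ`, once for each labelling of the cycles of `γ` such that the number of cycles of `σ`
and the lengths of the cycles of `γ` are given by `e`. -/
def weight (e : Option ι →₀ ℕ) (σ γ : Perm X) (π : Setoid X) : Coeffs :=
  ∑ c : X → ι, if π = ⊤ ∧ Setoid.ker c = cyc γ ∧ stat (cyc σ) c = e then qWeight (cyc σ) else 0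

theorem weight_eq_card (e : Option ι →₀ ℕ) (σ γ : Perm X) (π : Setoid X) :
    weight e σ γ π = if π = ⊤ then
      (numLabellings γ (cyc σ) e : Coeffs) * qWeight (cyc σ) else 0 := by
  by_cases h : π = ⊤
  · simp [weight, h, numLabellings, ← Finset.sum_filter]
  · simp [weight, h]

/-- The walks with last step `(x, y)` that join two orbits, namely `p` and its complement. -/
def joinTerm (p : X → Prop) (e : Option ι →₀ ℕ) (σ γ : Perm X) (π : Setoid X) : Coeffs :=
  ∑ x, ∑ y, if p x ∧ ¬ p y ∧ π = Setoid.ker p then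
    ∑ c : X → ι, if Setoid.ker c = merge (cyc γ) x y ∧ stat (cyc σ) c = e then
      qWeight (cyc σ) else 0
  else 0

/-- The walks whose last step cuts a cycle into cycles with different labels. -/
def cutTerm (e : Option ι →₀ ℕ) (σ γ : Perm X) (π : Setoid X) : Coeffs :=
  ∑ k, ∑ l, if k ≠ l ∧ e (some k) ≠ 0 ∧ e (some l) ≠ 0 then
    ((e (some k) + e (some l) : ℕ) : Coeffs) * weight (mergeLabels e k l) σ γ π else 0

theorem sum_cut (e : Option ι →₀ ℕ) (σ γ : Perm X) (π : Setoid X) :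
    (∑ x, ∑ y, ∑ c : X → ι, if π = ⊤ ∧ c x ≠ c y ∧ Setoid.ker c = cyc (swap x y * γ) ∧
      stat (cyc σ) c = e then qWeight (cyc σ) else 0) = cutTerm e σ γ π := by
  have h1 : ∀ (x y : X) (c : X → ι),
      (if π = ⊤ ∧ c x ≠ c y ∧ Setoid.ker c = cyc (swap x y * γ) ∧ stat (cyc σ) c = e then
        qWeight (cyc σ) else 0) =
      ∑ k, ∑ l, if k ≠ l ∧ π = ⊤ then (if c x = k ∧ c y = l ∧
        Setoid.ker c = cyc (swap x y * γ) ∧ stat (cyc σ) c = e then qWeight (cyc σ) else 0)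
        else 0 := by
    intro x y c
    rw [Finset.sum_eq_single (c x), Finset.sum_eq_single (c y)]
    · simp only [← ite_and]
      refine if_congr ?_ rfl rfl
      tauto
    · intro l _ hl
      simp [hl.symm]
    · simp
    · intro k _ hk
      simp [hk.symm]
    · simp
  simp only [h1]
  have h2 : ∀ f : X → X → (X → ι) → ι → ι → Coeffs,
      (∑ x, ∑ y, ∑ c, ∑ k, ∑ l, f x y c k l) =
        ∑ k, ∑ l, ∑ t : X × X × (X → ι), f t.1 t.2.1 t.2.2 k l := by
    intro f
    have : ∀ x y, (∑ c, ∑ k, ∑ l, f x y c k l) = ∑ k, ∑ l, ∑ c, f x y c k l := by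
      intro x y
      rw [Finset.sum_comm]
      exact Finset.sum_congr rfl fun k _ => Finset.sum_comm
    simp only [this, Fintype.sum_prod_type]
    have h3 : ∀ g : X → X → ι → ι → Coeffs, (∑ x, ∑ y, ∑ k, ∑ l, g x y k l) =
        ∑ k, ∑ l, ∑ x, ∑ y, g x y k l := by
      intro g
      have : ∀ x, (∑ y, ∑ k, ∑ l, g x y k l) = ∑ k, ∑ l, ∑ y, g x y k l := by
        intro x
        rw [Finset.sum_comm]
        exact Finset.sum_congr rfl fun k _ => Finset.sum_comm
      simp only [this]
      rw [Finset.sum_comm]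
      exact Finset.sum_congr rfl fun k _ => Finset.sum_comm
    exact h3 _
  rw [h2, cutTerm]
  refine Finset.sum_congr rfl fun k _ => Finset.sum_congr rfl fun l _ => ?_
  by_cases hkl : k = l
  · simp [hkl]
  by_cases hπ : π = ⊤
  swap
  · simp only [hπ, and_false, if_false, weight_eq_card, mul_zero, ite_self,
      Finset.sum_const_zero]
  simp only [hπ, ne_eq, hkl, not_false_eq_true, and_self, if_true, true_and]
  rw [← Finset.sum_filter, Finset.sum_const, nsmul_eq_mul]
  split_ifs with he
  · rw [card_cut γ (cyc σ) hkl he.1 he.2, weight_eq_card, if_pos rfl]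
    push_cast
    ring
  · rw [Finset.filter_eq_empty_iff.2]
    · simp
    · rintro ⟨x, y, c⟩ _ ⟨hx, hy, -, hs⟩
      refine he ⟨?_, ?_⟩
      · rw [← hs]
        exact stat_some_ne_zero.2 ⟨x, hx⟩
      · rw [← hs]
        exact stat_some_ne_zero.2 ⟨y, hy⟩

/-- In genus zero, the last transposition either cuts a cycle of a transitive factorization, or it
joins two orbits: to join two cycles of one orbit would violate the Riemann–Hurwitz inequality. The
orbit of `x` before the join is the set `A`. -/
theorem weight_step {r : ℕ} {e : Option ι →₀ ℕ}
    (hg : r + 3 = e none + (labels e).card) (σ γ : Perm X) (π : Setoid X) (hγ : cyc γ ≤ π)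
    (hle : numClasses (cyc σ) + numClasses (cyc γ) ≤ r + 2 * numClasses π) :
    (∑ x, ∑ y, if x = y then 0 else weight e σ (swap x y * γ) (merge π x y)) =
      cutTerm e σ γ π + ∑ A : Finset X, joinTerm (· ∈ A) e σ γ π := by
  rw [← sum_cut]
  simp only [joinTerm]
  rw [Finset.sum_comm (s := (Finset.univ : Finset (Finset X))), ← Finset.sum_add_distrib]
  refine Finset.sum_congr rfl fun x _ => ?_
  rw [Finset.sum_comm (s := (Finset.univ : Finset (Finset X))), ← Finset.sum_add_distrib]
  refine Finset.sum_congr rfl fun y _ => ?_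
  by_cases hxy : x = y
  · subst hxy
    rw [if_pos rfl, Finset.sum_eq_zero, Finset.sum_eq_zero, add_zero]
    · intro A _
      exact if_neg fun h => h.2.1 h.1
    · intro c _
      exact if_neg fun h => h.2.1 rfl
  rw [if_neg hxy]
  by_cases hπ : π = ⊤
  · rw [Finset.sum_eq_zero (s := (Finset.univ : Finset (Finset X))), add_zero, weight]
    · refine Finset.sum_congr rfl fun c _ => if_congr ?_ rfl rfl
      have hm : merge π x y = ⊤ := top_le_iff.1 (hπ ▸ le_merge π x y)
      refine ⟨fun h => ⟨hπ, fun hc => ?_, h.2.1, h.2.2⟩, fun h => ⟨hm, h.2.2.1, h.2.2.2⟩⟩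
      replace h := h.2
      -- Otherwise `γ` would have one cycle more than the Riemann–Hurwitz inequality allows.
      have h1 : cyc (swap x y * γ) x y := by
        rw [← h.1]
        exact hc
      have h2 := not_cyc_swap_mul h1 hxy
      rw [← mul_assoc, swap_mul_self, one_mul] at h2
      have h3 := numClasses_merge h2
      rw [← cyc_swap_mul_of_not h2, ← h.1, numClasses_ker (cyc σ) c, h.2] at h3
      have h4 : numClasses (cyc σ) = e none := by rw [← h.2, stat_none]
      have h5 : numClasses π ≤ 1 := by
        rw [hπ, numClasses, Nat.card_eq_fintype_card, Fintype.card_le_one_iff_subsingleton]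
        exact Quotient.subsingleton_iff.2 rfl
      omega
    · intro A _
      refine if_neg fun h => h.2.1 ?_
      have : π x y := by rw [hπ]; trivial
      rw [h.2.2, Setoid.ker_def] at this
      exact this ▸ h.1
  · rw [Finset.sum_eq_zero (s := (Finset.univ : Finset (X → ι))), zero_add]
    swap
    · intro c _
      exact if_neg fun h => hπ h.1
    by_cases hm : merge π x y = ⊤
    · have hn : ¬ π x y := fun h => hπ (by rwa [merge_eq_self h] at hm)
      have hn' : ¬ cyc γ x y := fun h => hn (hγ h)
      have hA : π = Setoid.ker (· ∈ Finset.univ.filter fun z => π z x) := by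
        ext z w
        simp only [Setoid.ker_def, Finset.mem_filter, Finset.mem_univ, true_and, eq_iff_iff]
        have cover : ∀ v, π v x ∨ π v y := by
          intro v
          have : merge π x y v x := by rw [hm]; trivial
          rcases this with h | h | h
          · exact Or.inl h
          · exact Or.inl h.1
          · exact Or.inr h.1
        refine ⟨fun h => ⟨fun h' => π.trans' (π.symm' h) h', fun h' => π.trans' h h'⟩,
          fun h => ?_⟩
        rcases cover z with hz | hz
        · exact π.trans' hz (π.symm' (h.1 hz))
        · rcases cover w with hw | hw
          · exact π.trans' (h.2 hw) (π.symm' hw)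
          · exact π.trans' hz (π.symm' hw)
      rw [Finset.sum_eq_single (Finset.univ.filter fun z => π z x)]
      · rw [if_pos ⟨by simp, by simpa using fun h => hn (π.symm' h), hA⟩, weight]
        simp only [hm, true_and, cyc_swap_mul_of_not hn']
      · intro A _ hAne
        refine if_neg fun h => hAne ?_
        ext z
        simp only [Finset.mem_filter, Finset.mem_univ, true_and]
        rw [h.2.2, Setoid.ker_def]
        exact ⟨fun hz => by simp [hz, h.1], fun hz => hz.symm ▸ h.1⟩
      · simp
    · rw [weight, Finset.sum_eq_zero, Finset.sum_eq_zero]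
      · intro A _
        refine if_neg fun h => hm ?_
        rw [Setoid.eq_top_iff]
        intro z w
        rw [merge_apply, h.2.2]
        simp only [Setoid.ker_def, h.1, h.2.1, eq_iff_iff]
        tauto
      · intro c _
        exact if_neg fun h => hm h.1

theorem weight_permCongr (f : X ≃ Y) (e : Option ι →₀ ℕ) (σ γ : Perm X) (π : Setoid X) :
    weight e (f.permCongr σ) (f.permCongr γ) (π.comap f.symm) = weight e σ γ π := by
  rw [weight, weight, ← (Equiv.arrowCongr f (Equiv.refl ι)).sum_comp]
  refine Finset.sum_congr rfl fun c _ => ?_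
  have h1 : (Equiv.arrowCongr f (Equiv.refl ι)) c = c ∘ f.symm := rfl
  have h2 : π.comap f.symm = ⊤ ↔ π = ⊤ := by
    rw [Setoid.eq_top_iff, Setoid.eq_top_iff]
    exact ⟨fun h x y => by
    have := h (f x) (f y)
    simpa [Setoid.comap_rel] using this, fun h x y => h _ _⟩
  have h3 : Setoid.ker (c ∘ f.symm) = (cyc γ).comap f.symm ↔ Setoid.ker c = cyc γ := by
    rw [← (Setoid.comap_injective f.symm f.symm.surjective).eq_iff]
    rfl
  rw [h1, cyc_permCongr, cyc_permCongr, stat_comap, qWeight_comap, h2, h3]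

theorem joinTerm_permCongr (f : X ≃ Y) (p : Y → Prop) (e : Option ι →₀ ℕ) (σ γ : Perm X)
    (π : Setoid X) :
    joinTerm p e (f.permCongr σ) (f.permCongr γ) (π.comap f.symm) =
      joinTerm (fun x => p (f x)) e σ γ π := by
  rw [joinTerm, joinTerm, ← f.sum_comp]
  refine Finset.sum_congr rfl fun x _ => ?_
  rw [← f.sum_comp]
  refine Finset.sum_congr rfl fun y _ => ?_
  have hk : π.comap f.symm = Setoid.ker p ↔ π = Setoid.ker (fun x => p (f x)) := by
    rw [← (Setoid.comap_injective f.symm f.symm.surjective).eq_iff (a := π)]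
    refine Eq.congr_right ?_
    ext z w
    simp [Setoid.ker_def]
  rw [hk]
  refine if_congr Iff.rfl ?_ rfl
  rw [← (Equiv.arrowCongr f (Equiv.refl ι)).sum_comp]
  refine Finset.sum_congr rfl fun c _ => ?_
  have h1 : (Equiv.arrowCongr f (Equiv.refl ι)) c = c ∘ f.symm := rfl
  have h3 : Setoid.ker (c ∘ f.symm) = merge ((cyc γ).comap f.symm) (f x) (f y) ↔
      Setoid.ker c = merge (cyc γ) x y := by
    rw [← (Setoid.comap_injective f.symm f.symm.surjective).eq_iff (a := Setoid.ker c)]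
    refine Eq.congr_right ?_
    ext z w
    simp [Setoid.comap_rel, merge_apply]
  rw [h1, cyc_permCongr, cyc_permCongr, stat_comap, qWeight_comap, h3]

/-- The number of ways to choose a point of each of two labelled cycles with the same label `i`,
if `i` is the only label common to `e₁` and `e₂`. -/
def joinWeight (e₁ e₂ : Option ι →₀ ℕ) : ℕ :=
  ∑ i, if ∀ j, (e₁ (some j) ≠ 0 ∧ e₂ (some j) ≠ 0) ↔ j = i then
    e₁ (some i) * e₂ (some i) else 0

theorem joinWeight_stat (π : Setoid X) (ρ : Setoid Y) (c : X → ι) (c' : Y → ι) :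
    joinWeight (stat π c) (stat ρ c') =
      ∑ x, ∑ y, if c x = c' y ∧ ∀ x' y', c x' = c' y' → c x' = c x then 1 else 0 := by
  have h1 : ∀ x y, (if c x = c' y ∧ ∀ x' y', c x' = c' y' → c x' = c x then 1 else 0) =
      ∑ i, if ∀ j, (stat π c (some j) ≠ 0 ∧ stat ρ c' (some j) ≠ 0) ↔ j = i then
        (if c x = i then 1 else 0) * (if c' y = i then 1 else 0) else 0 := by
    intro x y
    rw [Finset.sum_eq_single (c x)]
    · simp only [if_true, one_mul, ← ite_and]
      refine if_congr ?_ rfl rfl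
      simp only [stat_some_ne_zero]
      constructor
      · rintro ⟨hxy, h⟩
        refine ⟨fun j => ⟨?_, ?_⟩, hxy.symm⟩
        · rintro ⟨⟨x', rfl⟩, ⟨y', hy'⟩⟩
          exact h x' y' hy'.symm
        · rintro rfl
          exact ⟨⟨x, rfl⟩, ⟨y, hxy.symm⟩⟩
      · rintro ⟨h, hxy⟩
        exact ⟨hxy.symm, fun x' y' h' => (h _).1 ⟨⟨x', rfl⟩, ⟨y', h'.symm⟩⟩⟩
    · intro i _ hi
      simp [hi.symm]
    · simp
  simp only [h1]
  have h2 : ∀ f : X → Y → ι → ℕ, (∑ x, ∑ y, ∑ i, f x y i) = ∑ i, ∑ x, ∑ y, f x y i := by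
    intro f
    rw [Finset.sum_comm]
    simp only [Finset.sum_comm (s := (Finset.univ : Finset X)) (t := (Finset.univ : Finset ι))]
    rw [Finset.sum_comm]
    exact Finset.sum_congr rfl fun i _ => Finset.sum_comm
  rw [h2, joinWeight]
  refine Finset.sum_congr rfl fun i _ => ?_
  split_ifs with h
  · rw [stat_some, stat_some, Finset.card_filter, Finset.card_filter, Finset.sum_mul_sum]
  · simp

/-- If the transposition joins a transitive walk on `X` to one on `Y`, then the two cycles that are
joined carry the same label, and no other label occurs on both sides. -/
theorem joinTerm_sum_type {p : X ⊕ Y → Prop} (hl : ∀ x, p (Sum.inl x))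
    (hr : ∀ y, ¬ p (Sum.inr y)) (e : Option ι →₀ ℕ) (σ γ : Perm X) (π : Setoid X)
    (σ' γ' : Perm Y) (π' : Setoid Y) :
    joinTerm p e (Equiv.sumCongr σ σ') (Equiv.sumCongr γ γ')
        (sumSetoid π π') =
      ∑ p ∈ antidiagonal e, (joinWeight p.1 p.2 : Coeffs) *
        (weight p.1 σ γ π * weight p.2 σ' γ' π') := by
  have htop : sumSetoid π π' = sumSetoid ⊤ ⊤ ↔ π = ⊤ ∧ π' = ⊤ := by
    constructor
    · intro h
      constructor
      · refine Setoid.eq_top_iff.2 fun x y => ?_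
        rw [← sumSetoid_inl_inl (ρ := π'), h, sumSetoid_inl_inl]
        trivial
      · refine Setoid.eq_top_iff.2 fun x y => ?_
        rw [← sumSetoid_inr_inr (π := π), h, sumSetoid_inr_inr]
        trivial
    · rintro ⟨rfl, rfl⟩
      rfl
  -- Both sides are sums over pairs of labellings.
  have hR : (∑ p ∈ antidiagonal e, (joinWeight p.1 p.2 : Coeffs) *
        (weight p.1 σ γ π * weight p.2 σ' γ' π')) =
      ∑ c : X → ι, ∑ c' : Y → ι, if (π = ⊤ ∧ π' = ⊤) ∧
        (Setoid.ker c = cyc γ ∧ Setoid.ker c' = cyc γ') ∧ stat (cyc σ) c + stat (cyc σ') c' = e then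
        (joinWeight (stat (cyc σ) c) (stat (cyc σ') c') : Coeffs) *
          (qWeight (cyc σ) * qWeight (cyc σ')) else 0 := by
    have hm : ∀ p : (Option ι →₀ ℕ) × (Option ι →₀ ℕ),
        weight p.1 σ γ π * weight p.2 σ' γ' π' = _ := fun p => Finset.sum_mul_sum _ _ _ _
    simp only [hm, Finset.mul_sum]
    rw [Finset.sum_comm]
    refine Finset.sum_congr rfl fun c _ => ?_
    rw [Finset.sum_comm]
    refine Finset.sum_congr rfl fun c' _ => ?_
    by_cases he : stat (cyc σ) c + stat (cyc σ') c' = e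
    · rw [Finset.sum_eq_single (stat (cyc σ) c, stat (cyc σ') c')]
      · by_cases h1 : π = ⊤ ∧ Setoid.ker c = cyc γ
        · by_cases h2 : π' = ⊤ ∧ Setoid.ker c' = cyc γ'
          · rw [if_pos ⟨h1.1, h1.2, rfl⟩, if_pos ⟨h2.1, h2.2, rfl⟩,
              if_pos ⟨⟨h1.1, h2.1⟩, ⟨h1.2, h2.2⟩, he⟩]
          · rw [if_neg (fun h => h2 ⟨h.1, h.2.1⟩ : ¬ (π' = ⊤ ∧ _)),
              if_neg (fun h => h2 ⟨h.1.2, h.2.1.2⟩ : ¬ ((_ ∧ _) ∧ (_ ∧ _) ∧ _)), mul_zero, mul_zero]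
        · rw [if_neg (fun h => h1 ⟨h.1, h.2.1⟩ : ¬ (π = ⊤ ∧ _)),
            if_neg (fun h => h1 ⟨h.1.1, h.2.1.1⟩ : ¬ ((_ ∧ _) ∧ (_ ∧ _) ∧ _)), zero_mul, mul_zero]
      · rintro ⟨e1, e2⟩ _ hne
        by_cases h1 : stat (cyc σ) c = e1
        · have h2 : stat (cyc σ') c' ≠ e2 := fun h2 => hne (by rw [h1, h2])
          simp [h2]
        · simp [h1]
      · intro h
        exact absurd (mem_antidiagonal.2 he) h
    · rw [if_neg fun h => he h.2.2]
      refine Finset.sum_eq_zero ?_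
      rintro ⟨e1, e2⟩ hp
      by_cases h1 : stat (cyc σ) c = e1
      · have h2 : stat (cyc σ') c' ≠ e2 := fun h2 => he (by rw [h1, h2]; exact mem_antidiagonal.1 hp)
        simp [h2]
      · simp [h1]
  have hL : joinTerm p e (Equiv.sumCongr σ σ') (Equiv.sumCongr γ γ') (sumSetoid π π') =
      ∑ x : X, ∑ y : Y, ∑ c : X → ι, ∑ c' : Y → ι, if (π = ⊤ ∧ π' = ⊤) ∧
        (Setoid.ker c = cyc γ ∧ Setoid.ker c' = cyc γ') ∧ stat (cyc σ) c + stat (cyc σ') c' = e then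
        (if c x = c' y ∧ ∀ x' y', c x' = c' y' → c x' = c x then 1 else 0) *
          (qWeight (cyc σ) * qWeight (cyc σ')) else 0 := by
    rw [joinTerm, Fintype.sum_sum_type, Finset.sum_eq_zero (s := (Finset.univ : Finset Y)),
      add_zero]
    swap
    · intro y _
      exact Finset.sum_eq_zero fun w _ => if_neg fun h => hr y h.1
    refine Finset.sum_congr rfl fun x _ => ?_
    rw [Fintype.sum_sum_type, Finset.sum_eq_zero (s := (Finset.univ : Finset X)), zero_add]
    swap
    · intro w _
      exact if_neg fun h => h.2.1 (hl w)
    refine Finset.sum_congr rfl fun y _ => ?_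
    rw [ker_eq_sumSetoid_top hl hr, htop]
    by_cases hπ : π = ⊤ ∧ π' = ⊤
    swap
    · rw [if_neg fun h => hπ h.2.2]
      exact (Finset.sum_eq_zero fun c _ => Finset.sum_eq_zero fun c' _ =>
        if_neg fun h => hπ h.1).symm
    rw [if_pos ⟨hl x, hr y, hπ⟩]
    have key : ∀ (c : X → ι) (c' : Y → ι), (if Setoid.ker (Sum.elim c c') =
        merge (cyc (Equiv.sumCongr γ γ')) (Sum.inl x) (Sum.inr y) ∧
          stat (cyc (Equiv.sumCongr σ σ')) (Sum.elim c c') = e then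
          qWeight (cyc (Equiv.sumCongr σ σ')) else 0) = if (π = ⊤ ∧ π' = ⊤) ∧
        (Setoid.ker c = cyc γ ∧ Setoid.ker c' = cyc γ') ∧ stat (cyc σ) c + stat (cyc σ') c' = e then
        (if c x = c' y ∧ ∀ x' y', c x' = c' y' → c x' = c x then 1 else 0) *
          (qWeight (cyc σ) * qWeight (cyc σ')) else 0 := by
      intro c c'
      rw [cyc_sumCongr, cyc_sumCongr, stat_sumSetoid, ker_sumElim_eq_merge, qWeight_sumSetoid]
      by_cases hb : c x = c' y ∧ ∀ x' y', c x' = c' y' → c x' = c x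
      · rw [if_pos hb, one_mul]
        by_cases hk : (Setoid.ker c = cyc γ ∧ Setoid.ker c' = cyc γ') ∧
            stat (cyc σ) c + stat (cyc σ') c' = e
        · exact (if_pos ⟨⟨hk.1, hb⟩, hk.2⟩).trans (if_pos ⟨hπ, hk⟩).symm
        · exact (if_neg fun h => hk ⟨h.1.1, h.2⟩).trans (if_neg fun h => hk h.2).symm
      · rw [if_neg hb, zero_mul, ite_self]
        exact if_neg (by tauto)
    rw [← Finset.sum_product']
    refine Finset.sum_nbij' (fun c => (c ∘ Sum.inl, c ∘ Sum.inr)) (fun d => Sum.elim d.1 d.2)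
      (fun _ _ => by simp) (fun _ _ => by simp) (fun c _ => Sum.elim_comp_inl_inr c)
      (fun _ _ => by simp) fun c _ => ?_
    have := key (c ∘ Sum.inl) (c ∘ Sum.inr)
    rw [Sum.elim_comp_inl_inr] at this
    exact this
  rw [hR, hL]
  have hswap : ∀ f : X → Y → (X → ι) → (Y → ι) → Coeffs,
      (∑ x, ∑ y, ∑ c, ∑ c', f x y c c') = ∑ c, ∑ c', ∑ x, ∑ y, f x y c c' := by
    intro f
    have : ∀ x, (∑ y, ∑ c, ∑ c', f x y c c') = ∑ c, ∑ c', ∑ y, f x y c c' := by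
      intro x
      rw [Finset.sum_comm]
      exact Finset.sum_congr rfl fun c _ => Finset.sum_comm
    simp only [this]
    rw [Finset.sum_comm]
    exact Finset.sum_congr rfl fun c _ => Finset.sum_comm
  rw [hswap]
  refine Finset.sum_congr rfl fun c _ => Finset.sum_congr rfl fun c' _ => ?_
  split_ifs with h
  · rw [joinWeight_stat]
    push_cast
    simp only [Finset.sum_mul]
  · simp

end JoinCut

/-! ### The join-cut recursion for coefficients -/

section Recursion

variable {ι : Type} [Fintype ι]

/-- The weighted number of transitive walks on `X` with `r` steps and statistics `e`. -/
def labelledSum (X : Type) [Fintype X] [DecidableEq X] (r : ℕ) (e : Option ι →₀ ℕ) : Coeffs :=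
  walkSum r (weight e : Perm X → Perm X → Setoid X → Coeffs)

theorem numClasses_top_le (X : Type) [Fintype X] : numClasses (⊤ : Setoid X) ≤ 1 := by
  rw [numClasses, Nat.card_eq_fintype_card, Fintype.card_le_one_iff_subsingleton]
  exact Quotient.subsingleton_iff.2 rfl

theorem size_add (d e : Option ι →₀ ℕ) : size (d + e) = size d + size e :=
  Finset.sum_add_distrib

variable {X Y : Type} [Fintype X] [DecidableEq X] [Fintype Y] [DecidableEq Y]

theorem labelledSum_equiv (f : X ≃ Y) (r : ℕ) (e : Option ι →₀ ℕ) :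
    labelledSum X r e = labelledSum Y r e := by
  rw [labelledSum, labelledSum, ← walkSum_equiv f]
  simp only [weight_permCongr]

theorem weight_ne_zero {e : Option ι →₀ ℕ} {σ γ : Perm X} {π : Setoid X}
    (h : weight e σ γ π ≠ 0) :
    π = ⊤ ∧ ∃ c : X → ι, Setoid.ker c = cyc γ ∧ stat (cyc σ) c = e := by
  obtain ⟨c, -, hc⟩ := Finset.exists_ne_zero_of_sum_ne_zero h
  by_contra hn
  exact hc (if_neg fun h' => hn ⟨h'.1, c, h'.2⟩)

theorem labelledSum_eq_zero_of_card {r : ℕ} {e : Option ι →₀ ℕ}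
    (h : Fintype.card X ≠ size e) : labelledSum X r e = 0 := by
  rw [← walkSum_fun_zero (X := X) r, labelledSum]
  congr 1
  funext σ γ π
  by_contra hw
  obtain ⟨-, c, -, rfl⟩ := weight_ne_zero hw
  exact h (size_stat _ _).symm

/-- There are no transitive factorizations of negative genus. -/
theorem labelledSum_eq_zero_of_lt {r : ℕ} {e : Option ι →₀ ℕ}
    (h : r + 2 < e none + (labels e).card) : labelledSum X r e = 0 := by
  rw [← walkSum_fun_zero (X := X) r, labelledSum]
  refine walkSum_congr fun σ γ π _ hle => ?_
  by_contra hw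
  obtain ⟨rfl, c, hc, rfl⟩ := weight_ne_zero hw
  rw [← numClasses_ker, hc, stat_none] at h
  have := numClasses_top_le X
  omega

theorem labelledSum_eq_zero_of_none {r : ℕ} {e : Option ι →₀ ℕ}
    (h0 : e none = 0) (h : size e ≠ 0) : labelledSum X r e = 0 := by
  rw [← walkSum_fun_zero (X := X) r, labelledSum]
  congr 1
  funext σ γ π
  by_contra hw
  obtain ⟨-, c, -, rfl⟩ := weight_ne_zero hw
  rw [size_stat] at h
  obtain ⟨x⟩ := Fintype.card_pos_iff.1 (Nat.pos_of_ne_zero h)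
  rw [stat_none, numClasses, Nat.card_eq_zero] at h0
  rcases h0 with h0 | h0
  · exact h0.elim (Quotient.mk _ x)
  · exact h0.not_finite inferInstance

theorem walkSum_joinTerm (r : ℕ) (e : Option ι →₀ ℕ) (A : Finset X) :
    walkSum r (joinTerm (· ∈ A) e) = ∑ p ∈ antidiagonal r, ∑ d ∈ antidiagonal e,
      (r.choose p.1 : Coeffs) * ((joinWeight d.1 d.2 : Coeffs) *
        (labelledSum {x // x ∈ A} p.1 d.1 * labelledSum {x // x ∉ A} p.2 d.2)) := by
  rw [← walkSum_equiv (Equiv.sumCompl (· ∈ A))]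
  simp only [joinTerm_permCongr]
  have hl : ∀ x : {x // x ∈ A}, Equiv.sumCompl (· ∈ A) (Sum.inl x) ∈ A := fun x => x.2
  have hr : ∀ x : {x // x ∉ A}, ¬ Equiv.sumCompl (· ∈ A) (Sum.inr x) ∈ A := fun x => x.2
  rw [walkSum_sum_type]
  · refine Finset.sum_congr rfl fun p _ => ?_
    simp only [joinTerm_sum_type (p := fun z => Equiv.sumCompl (· ∈ A) z ∈ A) hl hr]
    simp only [walkSum_sum, walkSum_mul_left, walkSum_mul_right]
    rw [Finset.smul_sum]
    refine Finset.sum_congr rfl fun d _ => ?_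
    rw [nsmul_eq_mul]
    rfl
  · intro σ γ π hπ
    rw [joinTerm]
    refine Finset.sum_eq_zero fun x _ => Finset.sum_eq_zero fun y _ => if_neg fun h => hπ ?_
    rw [h.2.2, ker_eq_sumSetoid_top hl hr]

/-- Removal of the last transposition in genus zero. The subset `A` is the orbit that contains the
first of the two points moved by a transposition that joins two orbits. -/
theorem labelledSum_succ {r : ℕ} {e : Option ι →₀ ℕ}
    (hg : r + 3 = e none + (labels e).card) :
    labelledSum X (r + 1) e =
      (∑ k, ∑ l, if k ≠ l ∧ e (some k) ≠ 0 ∧ e (some l) ≠ 0 then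
        ((e (some k) + e (some l) : ℕ) : Coeffs) * labelledSum X r (mergeLabels e k l) else 0) +
      ∑ A : Finset X, ∑ p ∈ antidiagonal r, ∑ d ∈ antidiagonal e,
        (r.choose p.1 : Coeffs) * ((joinWeight d.1 d.2 : Coeffs) *
          (labelledSum {x // x ∈ A} p.1 d.1 * labelledSum {x // x ∉ A} p.2 d.2)) := by
  have hstep : labelledSum X (r + 1) e = walkSum r fun σ γ π =>
      cutTerm e σ γ π + ∑ A : Finset X, joinTerm (· ∈ A) e σ γ π := by
    rw [labelledSum, walkSum_succ]
    refine walkSum_congr fun σ γ π hγ hle => ?_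
    rw [← weight_step hg σ γ π hγ hle]
    refine Finset.sum_congr rfl fun x _ => Finset.sum_congr rfl fun y _ => ?_
    congr!
  rw [hstep, walkSum_add, walkSum_sum]
  refine congrArg₂ (· + ·) ?_ (Finset.sum_congr rfl fun A _ => walkSum_joinTerm r e A)
  unfold cutTerm
  rw [walkSum_sum]
  refine Finset.sum_congr rfl fun k _ => ?_
  rw [walkSum_sum]
  refine Finset.sum_congr rfl fun l _ => ?_
  split_ifs
  · exact walkSum_mul_left _ _ _
  · exact walkSum_fun_zero _

/-- The weighted number of transitive walks on `size e` points. -/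
def walkCount (r : ℕ) (e : Option ι →₀ ℕ) : Coeffs := labelledSum (Fin (size e)) r e

theorem labelledSum_eq_walkCount (r : ℕ) {e : Option ι →₀ ℕ} (h : Fintype.card X = size e) :
    labelledSum X r e = walkCount r e :=
  labelledSum_equiv (Fintype.equivFinOfCardEq h) r e

theorem sum_finset_join (r s : ℕ) (d e : Option ι →₀ ℕ) :
    (∑ A : Finset (Fin (size (d + e))),
      labelledSum {x // x ∈ A} r d * labelledSum {x // x ∉ A} s e) =
      ((size (d + e)).choose (size d) : Coeffs) * (walkCount r d * walkCount s e) := by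
  have h1 : ∀ A : Finset (Fin (size (d + e))),
      labelledSum {x // x ∈ A} r d * labelledSum {x // x ∉ A} s e =
        if A.card = size d then walkCount r d * walkCount s e else 0 := by
    intro A
    split_ifs with hA
    · rw [labelledSum_eq_walkCount r (by simpa using hA), labelledSum_eq_walkCount s]
      have := Fintype.card_subtype_compl (fun x => x ∈ A)
      rw [this, Fintype.card_fin, Fintype.card_coe, hA, size_add]
      omega
    · rw [labelledSum_eq_zero_of_card (by simpa using hA), zero_mul]
  simp only [h1]
  rw [← Finset.sum_filter, Finset.sum_const, nsmul_eq_mul]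
  congr 2
  have : (Finset.univ.filter fun A : Finset (Fin (size (d + e))) => A.card = size d) =
      Finset.powersetCard (size d) Finset.univ := by
    ext A
    simp [Finset.mem_powersetCard]
  rw [this, Finset.card_powersetCard, Finset.card_univ, Fintype.card_fin]

theorem size_mergeLabels (e : Option ι →₀ ℕ) (k l : ι) :
    size (mergeLabels e k l) = size e := by
  have h1 : size (e.erase (some l)) + e (some l) = size e := by
    have : e.erase (some l) + Finsupp.single (some l) (e (some l)) = e := by
      rw [add_comm, Finsupp.single_add_erase]
    conv_rhs => rw [← this, size_add]
    congr 1
    rw [size, Finset.sum_eq_single l]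
    · simp
    · intro i _ hi
      simp [hi]
    · simp
  rw [mergeLabels, size_add, ← h1]
  congr 1
  rw [size, Finset.sum_eq_single k]
  · simp
  · intro i _ hi
    simp [hi]
  · simp

theorem labels_mergeLabels {e : Option ι →₀ ℕ} {k l : ι} (h : k ≠ l) (hk : e (some k) ≠ 0) :
    labels (mergeLabels e k l) = (labels e).erase l := by
  ext i
  rw [Finset.mem_erase, mem_labels, mem_labels]
  by_cases hil : i = l
  · subst hil
    simp [mergeLabels_right e h]
  by_cases hik : i = k
  · subst hik
    rw [mergeLabels_left e h]
    simp [hil, hk]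
  · rw [mergeLabels_of_ne e hik hil]
    simp [hil]

theorem labels_add [DecidableEq ι] (d e : Option ι →₀ ℕ) : labels (d + e) = labels d ∪ labels e := by
  ext i
  simp only [mem_labels, Finset.mem_union, Finsupp.add_apply]
  omega

theorem exists_of_joinWeight_ne_zero {d e : Option ι →₀ ℕ} (h : joinWeight d e ≠ 0) :
    ∃ i, labels d ∩ labels e = {i} := by
  obtain ⟨i, -, hi⟩ := Finset.exists_ne_zero_of_sum_ne_zero h
  refine ⟨i, ?_⟩
  ext j
  simp only [Finset.mem_inter, mem_labels, Finset.mem_singleton]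
  by_contra hn
  exact hi (if_neg fun h' => hn (h' j))

theorem size_ne_zero {e : Option ι →₀ ℕ} (h : (labels e).Nonempty) : size e ≠ 0 := by
  obtain ⟨i, hi⟩ := h
  have : e (some i) ≤ size e :=
    Finset.single_le_sum (f := fun i => e (some i)) (fun _ _ => Nat.zero_le _) (Finset.mem_univ i)
  have := mem_labels.1 hi
  omega

/-- The number of transpositions in a genus zero factorization with statistics `e`. -/
def branchCount (e : Option ι →₀ ℕ) : ℕ := e none + (labels e).card - 2

/-- The coefficient of `u^n x^a` in the genus zero series, if `e` consists of `n` and `a`. The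
power of two accounts for the two orderings of the points moved by a transposition. If the
difference in `branchCount` is truncated, that is, if `e none + (labels e).card < 2`, and `labels e`
is not empty, then there are no walks and the value is `0`. -/
def hurwitzCoeff (e : Option ι →₀ ℕ) : Coeffs :=
  MvPolynomial.C (1 / (2 ^ branchCount e * (branchCount e)! * (size e)! : ℚ)) *
    walkCount (branchCount e) e

theorem hurwitzCoeff_eq_zero_of_none {e : Option ι →₀ ℕ} (h0 : e none = 0)
    (h : (labels e).Nonempty) : hurwitzCoeff e = 0 := by
  rw [hurwitzCoeff, walkCount, labelledSum_eq_zero_of_none h0 (size_ne_zero h), mul_zero]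

theorem walkCount_eq {r : ℕ} {e : Option ι →₀ ℕ} (h : branchCount e = r) :
    walkCount r e = MvPolynomial.C (2 ^ r * r ! * (size e)! : ℚ) * hurwitzCoeff e := by
  rw [hurwitzCoeff, h, ← mul_assoc, ← map_mul, mul_one_div_cancel, map_one, one_mul]
  have := Nat.factorial_ne_zero r
  have := Nat.factorial_ne_zero (size e)
  positivity

/-- Only the shuffles of two factorizations of genus zero are of genus zero. -/
theorem sum_walkCount_mul {r : ℕ} {d e : Option ι →₀ ℕ} (hd : d none ≠ 0) (he : e none ≠ 0)
    (hw : joinWeight d e ≠ 0) (hg : r + 3 = (d + e) none + (labels (d + e)).card) :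
    (∑ p ∈ antidiagonal r, (r.choose p.1 : Coeffs) * (walkCount p.1 d * walkCount p.2 e)) =
      MvPolynomial.C (2 ^ r * r ! * (size d)! * (size e)! : ℚ) *
        (hurwitzCoeff d * hurwitzCoeff e) := by
  obtain ⟨i, hi⟩ := exists_of_joinWeight_ne_zero hw
  have hi' : i ∈ labels d ∩ labels e := by simp [hi]
  rw [Finset.mem_inter] at hi'
  have hcard := Finset.card_union_add_card_inter (labels d) (labels e)
  rw [hi, Finset.card_singleton, ← labels_add] at hcard
  have hd1 : 0 < (labels d).card := Finset.card_pos.2 ⟨i, hi'.1⟩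
  have he1 : 0 < (labels e).card := Finset.card_pos.2 ⟨i, hi'.2⟩
  rw [Finsupp.add_apply] at hg
  have hbd : branchCount d + 2 = d none + (labels d).card := by
    rw [branchCount]
    omega
  have hbe : branchCount e + 2 = e none + (labels e).card := by
    rw [branchCount]
    omega
  rw [Finset.sum_eq_single (branchCount d, branchCount e)]
  · rw [walkCount_eq rfl, walkCount_eq rfl]
    have hr : r = branchCount d + branchCount e := by omega
    have hC : MvPolynomial.C (2 ^ r * r ! * (size d)! * (size e)! : ℚ) =
        ((r.choose (branchCount d) : ℕ) : Coeffs) *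
          (MvPolynomial.C (2 ^ branchCount d * (branchCount d)! * (size d)! : ℚ) *
            MvPolynomial.C (2 ^ branchCount e * (branchCount e)! * (size e)! : ℚ)) := by
      rw [← map_natCast (MvPolynomial.C : ℚ →+* Coeffs), ← map_mul, ← map_mul]
      congr 1
      have := Nat.add_choose_mul_factorial_mul_factorial (branchCount d) (branchCount e)
      rw [← Nat.choose_symm_add, ← hr] at this
      rw [← this, hr, pow_add]
      push_cast
      ring
    rw [hC]
    ring
  · rintro ⟨s, t⟩ hp hne
    rw [mem_antidiagonal] at hp
    dsimp only at hp
    by_cases hs : s + 2 < d none + (labels d).card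
    · rw [walkCount, labelledSum_eq_zero_of_lt hs, zero_mul, mul_zero]
    · have ht : t + 2 < e none + (labels e).card := by
        by_contra ht
        refine hne ?_
        ext <;> dsimp only <;> omega
      rw [walkCount, walkCount, labelledSum_eq_zero_of_lt ht, mul_zero, mul_zero]
  · intro h
    exact absurd (mem_antidiagonal.2 (by dsimp only; omega)) h

/-- The genus zero join-cut equation, for coefficients. -/
theorem hurwitzCoeff_join_cut (e : Option ι →₀ ℕ) (hm : (labels e).Nonempty) :
    2 * ((e none : Coeffs) + ((labels e).card : Coeffs) - 2) * hurwitzCoeff e =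
      (∑ k, ∑ l, if k ≠ l ∧ e (some k) ≠ 0 ∧ e (some l) ≠ 0 then
        ((e (some k) + e (some l) : ℕ) : Coeffs) * hurwitzCoeff (mergeLabels e k l) else 0) +
      ∑ d ∈ antidiagonal e, (joinWeight d.1 d.2 : Coeffs) *
        (hurwitzCoeff d.1 * hurwitzCoeff d.2) := by
  have hm1 : 0 < (labels e).card := Finset.card_pos.2 hm
  have hzero : ∀ d ∈ antidiagonal e, d.1 none = 0 ∨ d.2 none = 0 →
      (joinWeight d.1 d.2 : Coeffs) * (hurwitzCoeff d.1 * hurwitzCoeff d.2) = 0 := by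
    intro d _ h
    by_cases hw : joinWeight d.1 d.2 = 0
    · rw [hw, Nat.cast_zero, zero_mul]
    obtain ⟨i, hi⟩ := exists_of_joinWeight_ne_zero hw
    have hi' : i ∈ labels d.1 ∩ labels d.2 := by simp [hi]
    rw [Finset.mem_inter] at hi'
    rcases h with h | h
    · rw [hurwitzCoeff_eq_zero_of_none h ⟨i, hi'.1⟩, zero_mul, mul_zero]
    · rw [hurwitzCoeff_eq_zero_of_none h ⟨i, hi'.2⟩, mul_zero, mul_zero]
  have hnone : ∀ d ∈ antidiagonal e, d.1 none + d.2 none = e none := fun d hd => by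
    rw [← mem_antidiagonal.1 hd, Finsupp.add_apply]
  -- A permutation of a nonempty set has at least one cycle, so all terms vanish if `e none = 0`.
  by_cases hn : e none = 0
  · rw [hurwitzCoeff_eq_zero_of_none hn hm, mul_zero, Finset.sum_eq_zero, Finset.sum_eq_zero,
      add_zero]
    · intro d hd
      exact hzero d hd (Or.inl (by have := hnone d hd; omega))
    · intro k _
      refine Finset.sum_eq_zero fun l _ => ?_
      split_ifs with h
      · rw [hurwitzCoeff_eq_zero_of_none (by rw [mergeLabels_none, hn]), mul_zero]
        rw [labels_mergeLabels h.1 h.2.1]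
        exact ⟨k, Finset.mem_erase.2 ⟨h.1, mem_labels.2 h.2.1⟩⟩
      · rfl
  -- No transposition can be removed if `branchCount e = 0`; then both sides vanish.
  by_cases h2 : e none + (labels e).card = 2
  · have hn1 : e none = 1 := by omega
    have hl1 : (labels e).card = 1 := by omega
    rw [hn1, hl1, Finset.sum_eq_zero, Finset.sum_eq_zero]
    · norm_num
    · intro d hd
      exact hzero d hd (by have := hnone d hd; omega)
    · intro k _
      refine Finset.sum_eq_zero fun l _ => if_neg fun h => h.1 ?_
      exact Finset.card_le_one.1 hl1.le k (mem_labels.2 h.2.1) l (mem_labels.2 h.2.2)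
  obtain ⟨r, hr⟩ : ∃ r, r + 3 = e none + (labels e).card :=
    ⟨e none + (labels e).card - 3, by omega⟩
  have hbe : branchCount e = r + 1 := by
    rw [branchCount]
    omega
  have hs := labelledSum_succ (X := Fin (size e)) hr
  rw [← walkCount, walkCount_eq hbe] at hs
  have hcut : (∑ k, ∑ l, if k ≠ l ∧ e (some k) ≠ 0 ∧ e (some l) ≠ 0 then
        ((e (some k) + e (some l) : ℕ) : Coeffs) *
          labelledSum (Fin (size e)) r (mergeLabels e k l) else 0) =
      MvPolynomial.C (2 ^ r * r ! * (size e)! : ℚ) *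
      ∑ k, ∑ l, if k ≠ l ∧ e (some k) ≠ 0 ∧ e (some l) ≠ 0 then
        ((e (some k) + e (some l) : ℕ) : Coeffs) * hurwitzCoeff (mergeLabels e k l) else 0 := by
    rw [Finset.mul_sum]
    refine Finset.sum_congr rfl fun k _ => ?_
    rw [Finset.mul_sum]
    refine Finset.sum_congr rfl fun l _ => ?_
    split_ifs with h
    · have hb : branchCount (mergeLabels e k l) = r := by
        rw [branchCount, mergeLabels_none, labels_mergeLabels h.1 h.2.1,
          Finset.card_erase_of_mem (mem_labels.2 h.2.2)]
        omega
      rw [labelledSum_eq_walkCount r (by rw [size_mergeLabels, Fintype.card_fin]),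
        walkCount_eq hb, size_mergeLabels]
      ring
    · rw [mul_zero]
  have hjoin : (∑ A : Finset (Fin (size e)), ∑ p ∈ antidiagonal r, ∑ d ∈ antidiagonal e,
        (r.choose p.1 : Coeffs) * ((joinWeight d.1 d.2 : Coeffs) *
          (labelledSum {x // x ∈ A} p.1 d.1 * labelledSum {x // x ∉ A} p.2 d.2))) =
      MvPolynomial.C (2 ^ r * r ! * (size e)! : ℚ) *
        ∑ d ∈ antidiagonal e, (joinWeight d.1 d.2 : Coeffs) *
          (hurwitzCoeff d.1 * hurwitzCoeff d.2) := by
    rw [Finset.sum_comm, Finset.sum_congr rfl fun p _ => Finset.sum_comm, Finset.sum_comm,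
      Finset.mul_sum]
    refine Finset.sum_congr rfl fun d hd => ?_
    have hd' := mem_antidiagonal.1 hd
    obtain ⟨d1, d2⟩ := d
    dsimp only at hd'
    subst hd'
    dsimp only
    simp only [← Finset.mul_sum, sum_finset_join]
    by_cases hw : joinWeight d1 d2 = 0
    · simp [hw]
    by_cases h0 : d1 none = 0 ∨ d2 none = 0
    · rw [hzero _ hd h0, mul_zero]
      refine Finset.sum_eq_zero fun p _ => ?_
      obtain ⟨i, hi⟩ := exists_of_joinWeight_ne_zero hw
      have hi' : i ∈ labels d1 ∩ labels d2 := by simp [hi]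
      rw [Finset.mem_inter] at hi'
      rcases h0 with h0 | h0
      · rw [walkCount, labelledSum_eq_zero_of_none h0 (size_ne_zero ⟨i, hi'.1⟩)]
        ring
      · rw [walkCount, walkCount,
          labelledSum_eq_zero_of_none (e := d2) h0 (size_ne_zero ⟨i, hi'.2⟩)]
        ring
    push Not at h0
    have hsum := sum_walkCount_mul h0.1 h0.2 hw hr
    have hre : ∀ p : ℕ × ℕ, (r.choose p.1 : Coeffs) * ((joinWeight d1 d2 : Coeffs) *
        (((size (d1 + d2)).choose (size d1) : Coeffs) * (walkCount p.1 d1 * walkCount p.2 d2))) =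
        ((joinWeight d1 d2 : Coeffs) * ((size (d1 + d2)).choose (size d1) : Coeffs)) *
          ((r.choose p.1 : Coeffs) * (walkCount p.1 d1 * walkCount p.2 d2)) := fun p => by ring
    simp only [hre]
    rw [← Finset.mul_sum, hsum]
    have hC : MvPolynomial.C (2 ^ r * r ! * (size (d1 + d2))! : ℚ) =
        ((size (d1 + d2)).choose (size d1) : Coeffs) *
          MvPolynomial.C (2 ^ r * r ! * (size d1)! * (size d2)! : ℚ) := by
      rw [← map_natCast (MvPolynomial.C : ℚ →+* Coeffs), ← map_mul]
      congr 1
      rw [size_add, ← Nat.add_choose_mul_factorial_mul_factorial (size d1) (size d2),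
        ← Nat.choose_symm_add]
      push_cast
      ring
    rw [hC]
    ring
  rw [hcut, hjoin, ← mul_add] at hs
  have hC0 : (MvPolynomial.C (2 ^ r * r ! * (size e)! : ℚ) : Coeffs) ≠ 0 := by
    rw [Ne, MvPolynomial.C_eq_zero]
    have := Nat.factorial_ne_zero r
    have := Nat.factorial_ne_zero (size e)
    positivity
  refine mul_left_cancel₀ hC0 (Eq.trans ?_ hs)
  have hre : (e none : Coeffs) + ((labels e).card : Coeffs) - 2 = (r : Coeffs) + 1 := by
    have : ((r + 3 : ℕ) : Coeffs) = ((e none + (labels e).card : ℕ) : Coeffs) := by rw [hr]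
    push_cast at this
    linear_combination -this
  rw [hre]
  have h3 : (MvPolynomial.C (2 ^ (r + 1) * (r + 1)! * (size e)! : ℚ) : Coeffs) =
      2 * ((r : Coeffs) + 1) * MvPolynomial.C (2 ^ r * r ! * (size e)! : ℚ) := by
    have h4 : (2 * ((r : Coeffs) + 1)) = MvPolynomial.C (2 * ((r : ℚ) + 1)) := by
      rw [map_mul, map_add, map_natCast, map_one, map_ofNat]
    rw [h4, ← map_mul]
    congr 1
    rw [Nat.factorial_succ]
    push_cast
    ring
  rw [h3]
  ring

end Recursion

/-! ### Double Hurwitz numbers as sums over walks -/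

section CycleTypes

variable {X ι : Type} [Fintype X] [DecidableEq X] [Fintype ι]

/-- The parts of the partition of a permutation are the sizes of its orbits. -/
theorem parts_partition_eq_map (σ : Perm X) :
    σ.partition.parts = (Finset.univ : Finset (Quotient (cyc σ))).val.map
      fun a => (Finset.univ.filter fun x => Quotient.mk (cyc σ) x = a).card := by
  set f : Quotient (cyc σ) → ℕ :=
    fun a => (Finset.univ.filter fun x => Quotient.mk (cyc σ) x = a).card with hf
  have hmk : ∀ (a : Quotient (cyc σ)) (x : X), Quotient.mk (cyc σ) x = a ↔ SameCycle σ a.out x := by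
    intro a x
    conv_lhs => rw [← a.out_eq]
    rw [Quotient.eq]
    exact ⟨fun h => (cyc σ).symm' h, fun h => (cyc σ).symm' h⟩
  have hcov : (Finset.univ : Finset (Quotient (cyc σ))).val.map f =
      ((Finset.univ : Finset (Quotient (cyc σ))).val.filter fun a => a.out ∈ σ.support).map f +
      ((Finset.univ : Finset (Quotient (cyc σ))).val.filter fun a => a.out ∉ σ.support).map f := by
    rw [← Multiset.map_add, Multiset.filter_add_not]
  have hmoved : ((Finset.univ : Finset (Quotient (cyc σ))).val.filter
      fun a => a.out ∈ σ.support).map f = σ.cycleType := by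
    rw [cycleType_def]
    refine Multiset.map_eq_map_of_bij_of_nodup _ _ (Multiset.Nodup.filter _ Finset.univ.nodup)
      σ.cycleFactorsFinset.nodup (fun a _ => cycleOf σ a.out) ?_ ?_ ?_ ?_
    · intro a ha
      rw [Multiset.mem_filter] at ha
      exact cycleOf_mem_cycleFactorsFinset_iff.2 ha.2
    · intro a ha b hb h
      rw [Multiset.mem_filter] at ha hb
      have h1 : a.out ∈ (cycleOf σ b.out).support := by
        rw [← h, mem_support_cycleOf_iff]
        exact ⟨SameCycle.refl _ _, ha.2⟩
      rw [mem_support_cycleOf_iff] at h1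
      rw [← (hmk b a.out).2 h1.1, Quotient.out_eq]
    · intro c hc
      obtain ⟨hc1, hc2⟩ := mem_cycleFactorsFinset_iff.1 hc
      obtain ⟨x, hx⟩ := hc1.nonempty_support
      have hcx : c = cycleOf σ x := cycle_is_cycleOf hx hc
      have hsame : SameCycle σ (Quotient.mk (cyc σ) x).out x := (hmk _ x).1 rfl
      have hxs : x ∈ σ.support := mem_cycleFactorsFinset_support_le hc hx
      refine ⟨Quotient.mk (cyc σ) x, ?_, ?_⟩
      · rw [Multiset.mem_filter]
        refine ⟨Finset.mem_univ _, ?_⟩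
        rw [mem_support] at hxs ⊢
        exact fun h => hxs ((hsame.apply_eq_self_iff).1 h)
      · rw [hcx, hsame.cycleOf_eq]
    · intro a ha
      rw [Multiset.mem_filter] at ha
      rw [hf, Function.comp_apply]
      dsimp only
      congr 1
      ext x
      rw [Finset.mem_filter, mem_support_cycleOf_iff, hmk]
      exact ⟨fun h => ⟨h.2, ha.2⟩, fun h => ⟨Finset.mem_univ _, h.1⟩⟩
  have hsum : ((Finset.univ : Finset (Quotient (cyc σ))).val.map f).sum = Fintype.card X := by
    rw [← Finset.card_univ (α := X), Finset.card_eq_sum_card_fiberwise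
      (f := Quotient.mk (cyc σ)) (t := Finset.univ) fun x _ => Finset.mem_coe.2 (Finset.mem_univ _)]
    rfl
  have hfixed : ((Finset.univ : Finset (Quotient (cyc σ))).val.filter
      fun a => a.out ∉ σ.support).map f =
        Multiset.replicate (Fintype.card X - σ.support.card) 1 := by
    have h1 : ∀ n ∈ ((Finset.univ : Finset (Quotient (cyc σ))).val.filter
        fun a => a.out ∉ σ.support).map f, n = 1 := by
      intro n hn
      obtain ⟨a, ha, rfl⟩ := Multiset.mem_map.1 hn
      rw [Multiset.mem_filter, notMem_support] at ha
      refine Finset.card_eq_one.2 ⟨a.out, ?_⟩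
      ext x
      rw [Finset.mem_filter, Finset.mem_singleton, hmk]
      refine ⟨fun h => ?_, fun h => ⟨Finset.mem_univ _, h ▸ SameCycle.refl _ _⟩⟩
      obtain ⟨i, hi⟩ := h.2
      rw [← hi, zpow_apply_eq_self_of_apply_eq_self ha.2]
    rw [Multiset.eq_replicate]
    refine ⟨?_, h1⟩
    rw [hcov, Multiset.sum_add, hmoved, sum_cycleType, Multiset.eq_replicate_card.2 h1,
      Multiset.sum_replicate, smul_eq_mul, mul_one] at hsum
    omega
  rw [parts_partition, hcov, hmoved, hfixed]

theorem qWeight_cyc (σ : Perm X) : qWeight (cyc σ) = (σ.partition.parts.map q).prod := by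
  rw [parts_partition_eq_map, Multiset.map_map]
  rfl

theorem numClasses_cyc (σ : Perm X) : numClasses (cyc σ) = σ.partition.parts.card := by
  rw [parts_partition_eq_map, Multiset.card_map, numClasses, Nat.card_eq_fintype_card]
  rfl

/-- Functions with the same multiset of values differ by a bijection of their domains. -/
theorem exists_equiv_of_map_eq {A B : Type} [Fintype A] [Fintype B] {f : A → ℕ} {g : B → ℕ}
    (h : (Finset.univ : Finset A).val.map f = (Finset.univ : Finset B).val.map g) :
    ∃ k : A ≃ B, ∀ a, g (k a) = f a := by
  have hc : ∀ n, Nonempty ({a // f a = n} ≃ {b // g b = n}) := by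
    intro n
    refine ⟨Fintype.equivOfCardEq ?_⟩
    have h2 := congrArg (Multiset.count n) h
    rw [Multiset.count_map, Multiset.count_map] at h2
    rw [Fintype.card_subtype, Fintype.card_subtype, Finset.card_def, Finset.card_def,
      Finset.filter_val, Finset.filter_val]
    simpa only [eq_comm] using h2
  have ψ : ∀ n, {a // f a = n} ≃ {b // g b = n} := fun n => (hc n).some
  refine ⟨((Equiv.sigmaFiberEquiv f).symm.trans (Equiv.sigmaCongrRight ψ)).trans
    (Equiv.sigmaFiberEquiv g), fun a => ?_⟩
  exact (ψ (f a) ⟨a, rfl⟩).2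

/-- If all labels occur, then the labellings of the cycles of `γ` with prescribed lengths differ by
the permutations of the labels that preserve the lengths. -/
theorem numLabellings_eq (γ : Perm X) (ρ : Setoid X) {e : Option ι →₀ ℕ}
    (hl : labels e = Finset.univ) :
    numLabellings γ ρ e =
      if Finset.univ.val.map (fun i => e (some i)) = γ.partition.parts ∧ numClasses ρ = e none
      then ∏ n ∈ γ.partition.parts.toFinset, (γ.partition.parts.count n)! else 0 := by
  have hsurj : ∀ c : X → ι, stat ρ c = e → Function.Surjective c := by
    intro c hc i
    rw [← stat_some_ne_zero (π := ρ), hc, ← mem_labels, hl]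
    exact Finset.mem_univ i
  by_cases hcond : Finset.univ.val.map (fun i => e (some i)) = γ.partition.parts ∧
      numClasses ρ = e none
  · rw [if_pos hcond]
    obtain ⟨hparts, hnone⟩ := hcond
    obtain ⟨f, hf⟩ := exists_equiv_of_map_eq ((parts_partition_eq_map γ).symm.trans hparts.symm)
    set c₀ : X → ι := fun x => f (Quotient.mk (cyc γ) x) with hc₀
    have hc₀s : Function.Surjective c₀ := f.surjective.comp Quotient.mk_surjective
    have hker : Setoid.ker c₀ = cyc γ := by
      ext x y
      rw [Setoid.ker_def, hc₀]
      dsimp only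
      rw [f.apply_eq_iff_eq, Quotient.eq]
    have hstat : ∀ i, (Finset.univ.filter fun x => c₀ x = i).card = e (some i) := by
      intro i
      obtain ⟨a, rfl⟩ := f.surjective i
      rw [hf]
      simp only [hc₀, f.apply_eq_iff_eq]
    have hcount : numLabellings γ ρ e = Fintype.card
        {g : Perm ι // (fun i => e (some i)) ∘ g = fun i => e (some i)} := by
      rw [numLabellings, ← Finset.card_univ]
      symm
      refine Finset.card_bij (fun g _ => fun x => g.1 (c₀ x)) ?_ ?_ ?_
      · rintro ⟨g, hg⟩ -
        refine Finset.mem_filter.2 ⟨@Finset.mem_univ _ (_) _, ?_, ?_⟩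
        · rw [← hker]
          ext x y
          simp [Setoid.ker_def]
        · ext o
          rcases o with _ | i
          · exact hnone
          · have := congrFun hg (g.symm i)
            rw [Function.comp_apply, g.apply_symm_apply] at this
            rw [stat_some, this, ← hstat]
            simp only [← g.eq_symm_apply]
      · rintro ⟨g, hg⟩ - ⟨g', hg'⟩ - h
        refine Subtype.ext (Equiv.ext fun i => ?_)
        obtain ⟨x, rfl⟩ := hc₀s i
        exact congrFun h x
      · intro c hc
        obtain ⟨-, hck, hcs⟩ := Finset.mem_filter.1 hc
        have hiff : ∀ x y, c x = c y ↔ c₀ x = c₀ y := by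
          intro x y
          rw [← Setoid.ker_def, ← Setoid.ker_def, hck, hker]
        have hinj : Function.Injective fun i => c (Function.surjInv hc₀s i) := by
          intro i j hij
          have := (hiff _ _).1 hij
          rwa [Function.surjInv_eq hc₀s, Function.surjInv_eq hc₀s] at this
        have happ : ∀ x, c (Function.surjInv hc₀s (c₀ x)) = c x := fun x =>
          (hiff _ _).2 (Function.surjInv_eq _ _)
        refine ⟨⟨Equiv.ofBijective _ (Finite.injective_iff_bijective.1 hinj), ?_⟩,
          Finset.mem_univ _, funext happ⟩
        funext i
        obtain ⟨x, rfl⟩ := hc₀s i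
        rw [Function.comp_apply, Equiv.ofBijective_apply, happ, ← hcs, stat_some, hcs, ← hstat]
        simp only [hiff]
    rw [hcount, DomMulAct.stabilizer_card', ← hparts]
    refine Finset.prod_congr ?_ fun n _ => ?_
    · ext n
      simp
    · rw [Multiset.count_map, Fintype.card_subtype, Finset.card_def, Finset.filter_val]
      simp only [eq_comm]
  · rw [if_neg hcond, numLabellings, Finset.card_eq_zero, Finset.filter_eq_empty_iff]
    rintro c - ⟨hck, hcs⟩
    refine hcond ⟨?_, by rw [← hcs, stat_none]⟩
    rw [parts_partition_eq_map, ← hck]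
    refine (Multiset.map_eq_map_of_bij_of_nodup _ _ Finset.univ.nodup Finset.univ.nodup
      (fun a _ => Setoid.quotientKerEquivOfSurjective c (hsurj c hcs) a)
      (fun _ _ => Finset.mem_univ _) (fun _ _ _ _ h => Equiv.injective _ h)
      (fun i _ => ?_) fun a _ => ?_).symm
    · obtain ⟨a, ha⟩ := (Setoid.quotientKerEquivOfSurjective c (hsurj c hcs)).surjective i
      exact ⟨a, Finset.mem_univ _, ha⟩
    · induction a using Quotient.inductionOn with | _ x
      rw [← hcs, stat_some]
      congr 1
      ext z
      simp only [Finset.mem_filter, Finset.mem_univ, true_and]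
      exact Quotient.eq

end CycleTypes

section Orbits

variable {X : Type}

/-- The partition into the orbits of the group generated by a set of permutations. -/
def orbits (S : Set (Perm X)) : Setoid X := MulAction.orbitRel (Subgroup.closure S) X

theorem apply_mem_orbits {S : Set (Perm X)} {g : Perm X} (hg : g ∈ S) (z : X) :
    orbits S z (g z) :=
  (orbits S).symm' ⟨⟨g, Subgroup.subset_closure hg⟩, rfl⟩

theorem orbits_le_iff {S : Set (Perm X)} {π : Setoid X} :
    orbits S ≤ π ↔ ∀ g ∈ S, ∀ z, π z (g z) := by
  refine ⟨fun h g hg z => h (apply_mem_orbits hg z), fun h => ?_⟩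
  have key : ∀ g ∈ Subgroup.closure S, ∀ b, π b (g b) := by
    intro g hg
    induction hg using Subgroup.closure_induction with
    | mem g hg => exact h g hg
    | one => exact π.refl'
    | mul g g' _ _ ih ih' => exact fun b => π.trans' (ih' b) (ih (g' b))
    | inv g _ ih =>
      intro b
      have h1 : g (g⁻¹ b) = b := g.apply_symm_apply b
      have h2 := ih (g⁻¹ b)
      rw [h1] at h2
      exact π.symm' h2
  rintro a b ⟨⟨g, hg⟩, rfl⟩
  exact π.symm' (key g hg b)

theorem orbits_eq_top_iff {S : Set (Perm X)} :
    orbits S = ⊤ ↔ MulAction.IsPretransitive (Subgroup.closure S) X := by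
  rw [MulAction.pretransitive_iff_subsingleton_quotient]
  exact Quotient.subsingleton_iff.symm

theorem orbits_singleton [Fintype X] (σ : Perm X) : orbits {σ} = cyc σ := by
  refine le_antisymm (orbits_le_iff.2 ?_)
    (cyc_le_iff.2 fun z => apply_mem_orbits (Set.mem_singleton σ) z)
  rintro g rfl z
  exact cyc_apply_self g z

variable [DecidableEq X]

theorem orbits_insert_swap (S : Set (Perm X)) (x y : X) :
    orbits (insert (swap x y) S) = merge (orbits S) x y := by
  refine le_antisymm (orbits_le_iff.2 ?_) (merge_le (orbits_le_iff.2 fun g hg z =>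
    apply_mem_orbits (Set.mem_insert_of_mem _ hg) z) ?_)
  · rintro g (rfl | hg) z
    · by_cases hzx : z = x
      · rw [hzx, swap_apply_left]
        exact merge_self _ x y
      by_cases hzy : z = y
      · rw [hzy, swap_apply_right]
        exact (merge _ x y).symm' (merge_self _ x y)
      rw [swap_apply_of_ne_of_ne hzx hzy]
    · exact le_merge _ x y (apply_mem_orbits hg z)
  · have := apply_mem_orbits (Set.mem_insert (swap x y) S) x
    rwa [swap_apply_left] at this

variable [Fintype X]

theorem sum_swap {R : Type} [AddCommMonoid R] (K : Perm X → R) :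
    (∑ x, ∑ y, if x = y then 0 else K (swap x y)) = 2 • ∑ t, if t.IsSwap then K t else 0 := by
  have h1 : (∑ x, ∑ y, if x = y then 0 else K (swap x y)) =
      ∑ p ∈ Finset.univ.filter (fun p : X × X => p.1 ≠ p.2), K (swap p.1 p.2) := by
    rw [Finset.sum_filter, Fintype.sum_prod_type]
    simp only [ne_eq, ite_not]
  rw [h1, ← Finset.sum_fiberwise_of_maps_to (g := fun p : X × X => swap p.1 p.2)
    (t := Finset.univ) fun _ _ => Finset.mem_univ _, Finset.smul_sum]
  refine Finset.sum_congr rfl fun t _ => ?_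
  have h2 : ∀ p ∈ (Finset.univ.filter fun p : X × X => p.1 ≠ p.2).filter
      (fun p => swap p.1 p.2 = t), K (swap p.1 p.2) = K t := fun p hp => by
    rw [(Finset.mem_filter.1 hp).2]
  rw [Finset.sum_congr rfl h2, Finset.sum_const]
  split_ifs with ht
  · congr 1
    obtain ⟨a, b, hab, rfl⟩ := ht
    have h3 : (Finset.univ.filter fun p : X × X => p.1 ≠ p.2).filter
        (fun p => swap p.1 p.2 = swap a b) = {(a, b), (b, a)} := by
      ext ⟨x, y⟩
      simp only [Finset.mem_filter, Finset.mem_univ, true_and, Finset.mem_insert,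
        Finset.mem_singleton, Prod.mk.injEq]
      constructor
      · rintro ⟨hxy, h⟩
        have hx : swap a b x = y := by rw [← h, swap_apply_left]
        by_cases hxa : x = a
        · subst hxa
          rw [swap_apply_left] at hx
          exact Or.inl ⟨rfl, hx.symm⟩
        by_cases hxb : x = b
        · subst hxb
          rw [swap_apply_right] at hx
          exact Or.inr ⟨rfl, hx.symm⟩
        rw [swap_apply_of_ne_of_ne hxa hxb] at hx
        exact absurd hx hxy
      · rintro (⟨rfl, rfl⟩ | ⟨rfl, rfl⟩)
        · exact ⟨hab, rfl⟩
        · exact ⟨hab.symm, swap_comm _ _⟩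
    rw [h3, Finset.card_pair]
    exact fun h => hab (Prod.ext_iff.1 h).1
  · rw [smul_zero, Finset.card_eq_zero.2, zero_smul]
    rw [Finset.filter_eq_empty_iff]
    intro p hp h
    exact ht ⟨p.1, p.2, (Finset.mem_filter.1 hp).2, h.symm⟩

/-- A sum over walks is a sum over sequences of transpositions. -/
theorem walkSum_eq_sum {R : Type} [AddCommMonoid R] (r : ℕ) (F : Perm X → Perm X → Setoid X → R) :
    walkSum r F = 2 ^ r • ∑ σ, ∑ τ : Fin r → Perm X, if ∀ j, (τ j).IsSwap then
      F σ ((List.ofFn τ).reverse.prod * σ) (orbits ({σ} ∪ Set.range τ)) else 0 := by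
  induction r generalizing F with
  | zero => simp [walkSum_zero, orbits_singleton]
  | succ r ih =>
    rw [walkSum_succ, ih, pow_succ, mul_smul, Finset.smul_sum (r := 2)]
    congr 1
    refine Finset.sum_congr rfl fun σ _ => ?_
    rw [← (Fin.snocEquiv fun _ : Fin (r + 1) => Perm X).sum_comp, Fintype.sum_prod_type_right,
      Finset.smul_sum]
    refine Finset.sum_congr rfl fun τ _ => ?_
    have hterm : ∀ t : Perm X, (if ∀ j, (Fin.snocEquiv (fun _ => Perm X) (t, τ) j).IsSwap then
        F σ ((List.ofFn (Fin.snocEquiv (fun _ => Perm X) (t, τ))).reverse.prod * σ)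
          (orbits ({σ} ∪ Set.range (Fin.snocEquiv (fun _ => Perm X) (t, τ)))) else 0) =
        if ∀ j, (τ j).IsSwap then if t.IsSwap then
          F σ (t * ((List.ofFn τ).reverse.prod * σ)) (orbits (insert t ({σ} ∪ Set.range τ)))
          else 0 else 0 := by
      intro t
      rw [← ite_and]
      have h1 : (Fin.snocEquiv (fun _ => Perm X) (t, τ) : Fin (r + 1) → Perm X) =
        Fin.snoc (α := fun _ => Perm X) τ t := rfl
      rw [h1]
      refine if_congr ?_ ?_ rfl
      · rw [Fin.forall_fin_succ']
        simp
      · rw [Fin.range_snoc, Set.union_insert, List.ofFn_succ_last]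
        simp [mul_assoc]
    simp only [hterm]
    split_ifs with hτ
    · rw [← sum_swap fun t => F σ (t * ((List.ofFn τ).reverse.prod * σ))
        (orbits (insert t ({σ} ∪ Set.range τ)))]
      simp only [orbits_insert_swap]
    · simp

end Orbits

section Identification

theorem card_factorizations {d r : ℕ} (α β : d.Partition) :
    (Nat.card {t : Perm (Fin d) × (Fin r → Perm (Fin d)) × Perm (Fin d) //
      IsTransitiveFactorization α β t.1 t.2.1 t.2.2} : Coeffs) =
    ∑ σ : Perm (Fin d), ∑ τ : Fin r → Perm (Fin d), if ∀ j, (τ j).IsSwap then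
      (if orbits ({σ} ∪ Set.range τ) = ⊤ ∧ σ.partition.parts = β.parts ∧
        α.parts = ((List.ofFn τ).reverse.prod * σ).partition.parts then 1 else 0) else 0 := by
  have h1 : Nat.card {t : Perm (Fin d) × (Fin r → Perm (Fin d)) × Perm (Fin d) //
      IsTransitiveFactorization α β t.1 t.2.1 t.2.2} =
      (Finset.univ.filter fun t : Perm (Fin d) × (Fin r → Perm (Fin d)) =>
        IsTransitiveFactorization α β t.1 t.2 ((List.ofFn t.2).reverse.prod * t.1)).card := by
    rw [← Fintype.card_subtype, ← Nat.card_eq_fintype_card]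
    refine Nat.card_congr ⟨fun t => ⟨(t.1.1, t.1.2.1), ?_⟩,
      fun t => ⟨(t.1.1, t.1.2, (List.ofFn t.1.2).reverse.prod * t.1.1), t.2⟩, fun t => ?_,
      fun t => rfl⟩
    · have := t.2
      rwa [← this.factors] at this
    · refine Subtype.ext (Prod.ext rfl (Prod.ext rfl ?_))
      exact t.2.factors
  rw [h1, Finset.natCast_card_filter, Fintype.sum_prod_type]
  refine Finset.sum_congr rfl fun σ _ => Finset.sum_congr rfl fun τ _ => ?_
  rw [← ite_and]
  refine if_congr ?_ rfl rfl
  rw [orbits_eq_top_iff]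
  exact ⟨fun h => ⟨h.swaps, h.transitive, h.cycles_left, h.cycles_right.symm⟩,
    fun h => ⟨h.2.2.1, h.2.2.2.symm, h.1, rfl, h.2.1⟩⟩

/-- In the coefficient of `x^a` only the partition `α` with parts `a₁, …, a_m` occurs, and the factor
`|Aut α|` turns factorizations into factorizations with labelled cycles of `γ`. -/
theorem coeff_bigH_zero {m : ℕ} (e : Option (Fin m) →₀ ℕ) :
    MvPowerSeries.coeff e (bigH 0 m) =
      if labels e = Finset.univ then hurwitzCoeff e else 0 := by
  change bigH 0 m e = _
  rw [bigH]
  split_ifs with hl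
  · obtain ⟨α, hα⟩ : ∃ α : (∑ i, e (some i)).Partition,
        Finset.univ.val.map (fun i => e (some i)) = α.parts := by
      refine ⟨⟨Finset.univ.val.map fun i => e (some i), fun {n} hn => ?_, rfl⟩, rfl⟩
      obtain ⟨i, -, rfl⟩ := Multiset.mem_map.1 hn
      exact Nat.pos_of_ne_zero (mem_labels.1 (hl ▸ Finset.mem_univ i))
    have hαu : ∀ α', α' ≠ α → ¬ Finset.univ.val.map (fun i => e (some i)) = α'.parts :=
      fun α' hne h => hne (Nat.Partition.ext (h.symm.trans hα))
    rw [Finset.sum_eq_single α (fun α' _ hne => Finset.sum_eq_zero fun β _ =>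
      if_neg fun h => hαu α' hne h.1) fun h => absurd (Finset.mem_univ _) h]
    have hcard : α.parts.card = (labels e).card := by
      rw [← hα, Multiset.card_map, hl]
      rfl
    have hβ : ∀ β : (∑ i, e (some i)).Partition,
        (if Finset.univ.val.map (fun i => e (some i)) = α.parts ∧ β.parts.card = e none then
          MvPolynomial.C (hurwitz 0 α β / ((simpleCount 0 α β)! * autCard β : ℚ)) *
            (β.parts.map q).prod else 0) =
        MvPolynomial.C (autCard α / ((branchCount e)! * (size e)! : ℚ)) *
          ∑ σ : Perm (Fin (size e)), ∑ τ : Fin (branchCount e) → Perm (Fin (size e)),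
            if ∀ j, (τ j).IsSwap then
              if orbits ({σ} ∪ Set.range τ) = ⊤ ∧
                  α.parts = ((List.ofFn τ).reverse.prod * σ).partition.parts then
                if σ.partition.parts = β.parts ∧ β.parts.card = e none then
                  (β.parts.map q).prod else 0 else 0 else 0 := by
      intro β
      by_cases hn : β.parts.card = e none
      · rw [if_pos ⟨hα, hn⟩]
        have hr : simpleCount 0 α β = branchCount e := by
          rw [simpleCount, branchCount, hn, hcard]
          omega
        have haut : (autCard β : ℚ) ≠ 0 :=
          Nat.cast_ne_zero.2 (Finset.prod_ne_zero_iff.2 fun n _ => Nat.factorial_ne_zero _)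
        have hcoef : ∀ N : ℕ, (autCard α * autCard β : ℚ) / ((size e)! : ℚ) * N /
            ((branchCount e)! * autCard β : ℚ) =
            autCard α / ((branchCount e)! * (size e)! : ℚ) * N := by
          intro N
          have := Nat.factorial_ne_zero (branchCount e)
          have := Nat.factorial_ne_zero (size e)
          field_simp
        rw [hurwitz, hr]
        erw [hcoef]
        rw [map_mul, map_natCast, card_factorizations, mul_assoc]
        congr 1
        rw [Finset.sum_mul]
        refine Finset.sum_congr rfl fun σ _ => ?_
        rw [Finset.sum_mul]
        refine Finset.sum_congr rfl fun τ _ => ?_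
        rw [ite_mul, ite_mul, one_mul, zero_mul]
        refine if_congr Iff.rfl ?_ rfl
        rw [← ite_and]
        refine if_congr ?_ rfl rfl
        tauto
      · rw [if_neg fun h => hn h.2]
        simp [hn]
    simp only [hβ]
    rw [← Finset.mul_sum, Finset.sum_comm, hurwitzCoeff, walkCount, labelledSum, walkSum_eq_sum,
      nsmul_eq_mul, ← mul_assoc]
    have hconst : (MvPolynomial.C (1 / (2 ^ branchCount e * (branchCount e)! * (size e)! : ℚ)) *
        ((2 ^ branchCount e : ℕ) : Coeffs)) =
        MvPolynomial.C (1 / ((branchCount e)! * (size e)! : ℚ)) := by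
      rw [← map_natCast (MvPolynomial.C : ℚ →+* Coeffs), ← map_mul]
      congr 1
      have := Nat.factorial_ne_zero (branchCount e)
      have := Nat.factorial_ne_zero (size e)
      push_cast
      field_simp
    have hconst' : (MvPolynomial.C (autCard α / ((branchCount e)! * (size e)! : ℚ)) : Coeffs) =
        MvPolynomial.C (1 / ((branchCount e)! * (size e)! : ℚ)) * (autCard α : Coeffs) := by
      rw [← map_natCast (MvPolynomial.C : ℚ →+* Coeffs), ← map_mul, div_mul_eq_mul_div, one_mul]
    rw [hconst, hconst', mul_assoc]
    congr 1
    rw [Finset.mul_sum]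
    refine Finset.sum_congr rfl fun σ _ => ?_
    rw [Finset.sum_comm, Finset.mul_sum]
    refine Finset.sum_congr rfl fun τ _ => ?_
    -- The partition `β` is determined by `σ`.
    have hsum : (∑ β : (∑ i, e (some i)).Partition,
        if σ.partition.parts = β.parts ∧ β.parts.card = e none then (β.parts.map q).prod else 0) =
        if numClasses (cyc σ) = e none then qWeight (cyc σ) else 0 := by
      obtain ⟨β, hβσ⟩ : ∃ β : (∑ i, e (some i)).Partition, σ.partition.parts = β.parts :=
        ⟨⟨σ.partition.parts, fun {n} hn => σ.partition.parts_pos hn,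
          σ.partition.parts_sum.trans (Fintype.card_fin _)⟩, rfl⟩
      rw [Finset.sum_eq_single β (fun β' _ hne => if_neg fun h =>
        hne (Nat.Partition.ext (h.1.symm.trans hβσ))) fun h => absurd (Finset.mem_univ _) h]
      rw [numClasses_cyc, qWeight_cyc, hβσ]
      simp
    by_cases hτ : ∀ j, (τ j).IsSwap
    swap
    · simp only [if_neg hτ, Finset.sum_const_zero, mul_zero]
    simp only [if_pos hτ]
    rw [weight_eq_card]
    by_cases htop : orbits ({σ} ∪ Set.range τ) = ⊤
    swap
    · simp only [htop, false_and, if_false, Finset.sum_const_zero, mul_zero]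
    rw [if_pos htop, numLabellings_eq _ _ hl]
    simp only [htop, true_and, hα]
    by_cases hγ : α.parts = ((List.ofFn τ).reverse.prod * σ).partition.parts
    · simp only [if_pos hγ]
      rw [hsum, ← hγ, autCard]
      simp only [true_and]
      split_ifs
      · rfl
      · rw [Nat.cast_zero, mul_zero, zero_mul]
    · simp only [hγ, false_and, if_false, Finset.sum_const_zero, mul_zero,
        Nat.cast_zero, zero_mul]
  · obtain ⟨i, hi⟩ : ∃ i, e (some i) = 0 := by
      by_contra! h
      exact hl (Finset.eq_univ_of_forall fun i => mem_labels.2 (h i))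
    refine Finset.sum_eq_zero fun α _ => Finset.sum_eq_zero fun β _ => if_neg fun h => ?_
    have : e (some i) ∈ α.parts := by
      rw [← h.1]
      exact Multiset.mem_map_of_mem _ (Finset.mem_univ i)
    exact absurd hi (α.parts_pos this).ne'

end Identification

/-! ### Relabelling and the one-part series -/

section Relabelling

variable {ι κ : Type}

theorem embDomain_none (f : ι ↪ κ) (e : Option ι →₀ ℕ) :
    e.embDomain f.optionMap none = e none :=
  Finsupp.embDomain_apply_self f.optionMap e none

theorem embDomain_some (f : ι ↪ κ) (e : Option ι →₀ ℕ) (i : ι) :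
    e.embDomain f.optionMap (some (f i)) = e (some i) :=
  Finsupp.embDomain_apply_self f.optionMap e (some i)

theorem embDomain_of_notMem (f : ι ↪ κ) (e : Option ι →₀ ℕ) {k : κ} (hk : k ∉ Set.range f) :
    e.embDomain f.optionMap (some k) = 0 := by
  refine Finsupp.embDomain_of_notMem_range _ _ _ ?_
  rintro ⟨_ | i, hi⟩
  · cases hi
  · exact hk ⟨i, Option.some.inj hi⟩

variable [Fintype ι] [Fintype κ]

theorem labels_embDomain (f : ι ↪ κ) (e : Option ι →₀ ℕ) :
    labels (e.embDomain f.optionMap) = (labels e).map f := by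
  ext k
  rw [mem_labels]
  by_cases hk : k ∈ Set.range f
  · obtain ⟨i, rfl⟩ := hk
    rw [embDomain_some, Finset.mem_map' f, mem_labels]
  · rw [embDomain_of_notMem f e hk]
    refine iff_of_false (fun h => h rfl) fun h => hk ?_
    obtain ⟨i, -, hi⟩ := Finset.mem_map.1 h
    exact ⟨i, hi⟩

theorem size_embDomain (f : ι ↪ κ) (e : Option ι →₀ ℕ) :
    size (e.embDomain f.optionMap) = size e := by
  rw [size, size, ← Finset.sum_subset (Finset.subset_univ (Finset.univ.map f)), Finset.sum_map]
  · simp only [embDomain_some]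
  · intro k _ hk
    exact embDomain_of_notMem f e fun ⟨i, hi⟩ =>
      hk (Finset.mem_map.2 ⟨i, Finset.mem_univ i, hi⟩)

theorem numLabellings_embDomain {X : Type} [Fintype X] (f : ι ↪ κ) (γ : Perm X) (ρ : Setoid X)
    (e : Option ι →₀ ℕ) :
    numLabellings γ ρ (e.embDomain f.optionMap) = numLabellings γ ρ e := by
  have hker : ∀ c : X → ι, Setoid.ker (fun x => f (c x)) = Setoid.ker c := by
    intro c
    ext x y
    simp [Setoid.ker_def]
  have hstat : ∀ c : X → ι, stat ρ (fun x => f (c x)) = (stat ρ c).embDomain f.optionMap := by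
    intro c
    ext o
    rcases o with _ | k
    · rw [embDomain_none]
      rfl
    by_cases hk : k ∈ Set.range f
    · obtain ⟨i, rfl⟩ := hk
      rw [embDomain_some, stat_some, stat_some]
      simp only [f.injective.eq_iff]
    · rw [embDomain_of_notMem f _ hk, stat_some, Finset.card_eq_zero,
        Finset.filter_eq_empty_iff]
      exact fun x _ hx => hk ⟨c x, hx⟩
  symm
  refine Finset.card_bij (fun c _ => fun x => f (c x)) ?_ ?_ ?_
  · intro c hc
    obtain ⟨-, h1, h2⟩ := Finset.mem_filter.1 hc
    exact Finset.mem_filter.2 ⟨Finset.mem_univ _, by rw [hker, h1], by rw [hstat, h2]⟩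
  · intro c _ c' _ h
    exact funext fun x => f.injective (congrFun h x)
  · intro c hc
    obtain ⟨-, h1, h2⟩ := Finset.mem_filter.1 hc
    have hr : ∀ x, ∃ i, f i = c x := by
      intro x
      by_contra hx
      have h3 := DFunLike.congr_fun h2 (some (c x))
      rw [embDomain_of_notMem f e hx] at h3
      exact stat_some_ne_zero.2 ⟨x, rfl⟩ h3
    choose c' hc' using hr
    obtain rfl : (fun x => f (c' x)) = c := funext hc'
    refine ⟨c', Finset.mem_filter.2 ⟨Finset.mem_univ _, by rw [← hker, h1], ?_⟩, rfl⟩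
    rw [hstat] at h2
    exact Finsupp.embDomain_injective _ h2

/-- Coefficients do not change if the labels are renamed, or if labels that do not occur are added. -/
theorem hurwitzCoeff_embDomain (f : ι ↪ κ) (e : Option ι →₀ ℕ) :
    hurwitzCoeff (e.embDomain f.optionMap) = hurwitzCoeff e := by
  have hb : branchCount (e.embDomain f.optionMap) = branchCount e := by
    rw [branchCount, branchCount, embDomain_none, labels_embDomain, Finset.card_map]
  have hw : walkCount (branchCount e) (e.embDomain f.optionMap) =
      walkCount (branchCount e) e := by
    rw [← labelledSum_eq_walkCount (X := Fin (size e)) _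
      (by rw [size_embDomain, Fintype.card_fin]), walkCount, labelledSum, labelledSum]
    congr 1
    funext σ γ π
    rw [weight_eq_card, weight_eq_card, numLabellings_embDomain]
  rw [hurwitzCoeff, hurwitzCoeff, hb, hw, size_embDomain]

theorem cyc_eq_top_iff {n : ℕ} (hn : 2 ≤ n) (σ : Perm (Fin n)) :
    cyc σ = ⊤ ↔ σ.cycleType = {n} := by
  have hsum : σ.partition.parts.sum = n := σ.partition.parts_sum.trans (Fintype.card_fin n)
  constructor
  · intro h
    have h1 : σ.partition.parts.card ≤ 1 := by
      rw [← numClasses_cyc, h]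
      exact numClasses_top_le _
    have h2 : σ.partition.parts = {n} := by
      have h3 : σ.partition.parts.card = 1 := by
        refine le_antisymm h1 (Nat.one_le_iff_ne_zero.2 fun h0 => ?_)
        rw [Multiset.card_eq_zero.1 h0, Multiset.sum_zero] at hsum
        omega
      obtain ⟨a, ha⟩ := Multiset.card_eq_one.1 h3
      rw [ha, Multiset.sum_singleton] at hsum
      rw [ha, hsum]
    rw [← filter_parts_partition_eq_cycleType, h2, Multiset.filter_singleton, if_pos hn]
  · intro h
    have h1 : numClasses (cyc σ) = 1 := by
      rw [numClasses_cyc, parts_partition, ← sum_cycleType, h]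
      simp
    rw [numClasses, Nat.card_eq_fintype_card] at h1
    exact Quotient.subsingleton_iff.1 (Fintype.card_le_one_iff_subsingleton.1 h1.le)

theorem card_cyc_eq_top {n : ℕ} (hn : 1 ≤ n) :
    (Finset.univ.filter fun σ : Perm (Fin n) => cyc σ = ⊤).card = (n - 1)! := by
  rcases hn.eq_or_lt with rfl | hn
  · rw [Finset.filter_true_of_mem]
    · rfl
    · intro σ _
      exact Quotient.subsingleton_iff.1 ⟨fun a b => Quotient.inductionOn₂ a b fun x y => by
        rw [Subsingleton.elim x y]⟩
  · simp only [cyc_eq_top_iff hn]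
    rw [card_of_cycleType_singleton hn (by simp), Fintype.card_fin, Nat.choose_self, mul_one]

/-- The part of the one-part series that is linear in `u`. -/
theorem hurwitzCoeff_one_part {e : Option ι →₀ ℕ} {i : ι} (h1 : e none = 1)
    (hl : labels e = {i}) : (e (some i) : Coeffs) * hurwitzCoeff e = q (e (some i)) := by
  have hb : branchCount e = 0 := by rw [branchCount, h1, hl, Finset.card_singleton]
  have hi : e (some i) ≠ 0 := mem_labels.1 (by rw [hl]; exact Finset.mem_singleton_self i)
  have hz : ∀ j, j ≠ i → e (some j) = 0 := by
    intro j hj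
    by_contra h
    exact hj (Finset.mem_singleton.1 (hl ▸ mem_labels.2 h))
  have hs : size e = e (some i) := Finset.sum_eq_single i (fun j _ hj => hz j hj) (by simp)
  have hx : Nonempty (Fin (size e)) := ⟨⟨0, by omega⟩⟩
  have hcl : ∀ σ : Perm (Fin (size e)), weight e σ σ (cyc σ) =
      if cyc σ = ⊤ then q (e (some i)) else 0 := by
    intro σ
    rw [weight_eq_card]
    refine if_ctx_congr Iff.rfl (fun h => ?_) fun _ => rfl
    have hsub : Subsingleton (Quotient (cyc σ)) := Quotient.subsingleton_iff.2 h
    have hnum : numClasses (⊤ : Setoid (Fin (size e))) = 1 := by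
      rw [← h, numClasses, Nat.card_eq_one_iff_unique]
      exact ⟨hsub, ⟨Quotient.mk _ hx.some⟩⟩
    have hq : qWeight (cyc σ) = q (e (some i)) := by
      rw [qWeight, Fintype.prod_subsingleton _ (Quotient.mk _ hx.some), Finset.filter_true_of_mem
        fun x _ => Subsingleton.elim _ _, Finset.card_univ, Fintype.card_fin, hs]
    have hone : numLabellings σ (cyc σ) e = 1 := by
      rw [numLabellings, Finset.card_eq_one]
      refine ⟨fun _ => i, ?_⟩
      ext c
      rw [Finset.mem_filter, Finset.mem_singleton]
      constructor
      · rintro ⟨-, -, hc⟩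
        funext x
        by_contra hxi
        have hcx := DFunLike.congr_fun hc (some (c x))
        rw [hz _ hxi] at hcx
        exact stat_some_ne_zero.2 ⟨x, rfl⟩ hcx
      · rintro rfl
        refine ⟨@Finset.mem_univ _ (_) _, ?_, ?_⟩
        · rw [h]
          ext x y
          simp [Setoid.ker_def]
        · ext o
          rcases o with _ | j
          · rw [stat_none, h, hnum, h1]
          · rw [stat_some]
            by_cases hj : i = j
            · subst hj
              simp [hs]
            · simp [hj, hz j fun h' => hj h'.symm]
    rw [hq, hone, Nat.cast_one, one_mul]
  have hwc : walkCount 0 e = ((size e - 1)! : Coeffs) * q (e (some i)) := by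
    rw [walkCount, labelledSum, walkSum_zero]
    simp only [hcl]
    rw [← Finset.sum_filter, Finset.sum_const, card_cyc_eq_top (by omega), nsmul_eq_mul]
  rw [hurwitzCoeff, hb, hwc, hs, ← map_natCast (MvPolynomial.C : ℚ →+* Coeffs) (e (some i) - 1)!,
    ← map_natCast (MvPolynomial.C : ℚ →+* Coeffs) (e (some i)), ← mul_assoc, ← mul_assoc,
    ← map_mul, ← map_mul]
  have h2 : (e (some i) : ℚ) * (1 / (2 ^ 0 * (0 ! : ℕ) * ((e (some i))! : ℕ))) *
      ((e (some i) - 1)! : ℕ) = 1 := by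
    have h3 := Nat.mul_factorial_pred hi
    have h4 : ((e (some i))! : ℚ) = e (some i) * ((e (some i) - 1)! : ℕ) := by
      rw [← h3]
      push_cast
      rfl
    have h5 : ((e (some i) - 1)! : ℚ) ≠ 0 := Nat.cast_ne_zero.2 (Nat.factorial_ne_zero _)
    have h6 : (e (some i) : ℚ) ≠ 0 := Nat.cast_ne_zero.2 hi
    rw [h4, Nat.factorial_zero]
    push_cast
    field_simp
  rw [h2, map_one, one_mul]

end Relabelling

/-! ### The change of variables -/

section ChainRule

variable {σ τ R : Type} [CommRing R]

theorem coeff_eq_of_X_dvd_sub {s : τ} {f g : MvPowerSeries τ R}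
    (h : MvPowerSeries.X s ∣ f - g) {e : τ →₀ ℕ} (he : e s = 0) :
    MvPowerSeries.coeff e f = MvPowerSeries.coeff e g := by
  rw [← sub_eq_zero, ← map_sub]
  exact MvPowerSeries.X_dvd_iff.1 h e he

/-- Substitutions that agree modulo a variable agree on the coefficients without it. -/
theorem coeff_subst_eq_of_X_dvd_sub {a b : σ → MvPowerSeries τ R} (ha : MvPowerSeries.HasSubst a)
    (hb : MvPowerSeries.HasSubst b) {t : τ} (h : ∀ s, MvPowerSeries.X t ∣ a s - b s)
    {e : τ →₀ ℕ} (he : e t = 0) (G : MvPowerSeries σ R) :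
    MvPowerSeries.coeff e (MvPowerSeries.subst a G) =
      MvPowerSeries.coeff e (MvPowerSeries.subst b G) := by
  rw [MvPowerSeries.coeff_subst ha, MvPowerSeries.coeff_subst hb]
  refine finsum_congr fun d => congrArg _ (coeff_eq_of_X_dvd_sub (s := t) ?_ he)
  rw [← Ideal.mem_span_singleton, ← Ideal.Quotient.mk_eq_mk_iff_sub_mem, map_finsuppProd,
    map_finsuppProd]
  refine Finsupp.prod_congr fun s _ => ?_
  rw [map_pow, map_pow]
  congr 1
  rw [Ideal.Quotient.mk_eq_mk_iff_sub_mem, Ideal.mem_span_singleton]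
  exact h s

variable [Fintype σ]

theorem pderiv_aeval (a : σ → MvPowerSeries τ R) (j : τ) (p : MvPolynomial σ R) :
    MvPowerSeries.pderiv R j (MvPolynomial.aeval a p) =
      ∑ s, MvPolynomial.aeval a (MvPolynomial.pderiv s p) * MvPowerSeries.pderiv R j (a s) := by
  induction p using MvPolynomial.induction_on with
  | C r => simp
  | add p q hp hq => simp only [map_add, hp, hq, add_mul, Finset.sum_add_distrib]
  | mul_X p i hp =>
    rw [map_mul, Derivation.leibniz, hp, MvPolynomial.aeval_X, Finset.smul_sum]
    simp only [Derivation.leibniz, MvPolynomial.pderiv_X, map_add, smul_eq_mul, map_mul,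
      MvPolynomial.aeval_X, add_mul, Finset.sum_add_distrib]
    congr 1
    · rw [Finset.sum_eq_single i]
      · simp
      · intro s _ hs
        simp [hs]
      · simp
    · exact Finset.sum_congr rfl fun s _ => by ring

open MvPowerSeries.WithPiTopology in
theorem continuous_pderiv [TopologicalSpace R] [IsTopologicalRing R] (j : τ) :
    Continuous (MvPowerSeries.pderiv R j : MvPowerSeries τ R → MvPowerSeries τ R) :=
  continuous_pi fun d => (MvPowerSeries.WithPiTopology.continuous_coeff R
    (d + Finsupp.single j 1)).mul continuous_const

open MvPowerSeries.WithPiTopology in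
/-- The chain rule for the substitution of formal power series. -/
theorem pderiv_subst {a : σ → MvPowerSeries τ R} (ha : MvPowerSeries.HasSubst a) (j : τ)
    (G : MvPowerSeries σ R) :
    MvPowerSeries.pderiv R j (MvPowerSeries.subst a G) =
      ∑ s, MvPowerSeries.subst a (MvPowerSeries.pderiv R s G) *
        MvPowerSeries.pderiv R j (a s) := by
  let : UniformSpace R := ⊥
  have : DiscreteUniformity R := ⟨rfl⟩
  have hc := MvPowerSeries.continuous_subst (R := R) (S := R) ha
  have h := DenseRange.equalizer
    (MvPowerSeries.WithPiTopology.denseRange_toMvPowerSeries (σ := σ) (R := R))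
    (g := fun G => MvPowerSeries.pderiv R j (MvPowerSeries.subst a G))
    (h := fun G => ∑ s, MvPowerSeries.subst a (MvPowerSeries.pderiv R s G) *
        MvPowerSeries.pderiv R j (a s))
    ((continuous_pderiv j).comp hc)
    (continuous_finsetSum _ fun s _ => (hc.comp (continuous_pderiv s)).mul continuous_const) ?_
  · exact congrFun h G
  · funext p
    simp only [Function.comp_apply, MvPowerSeries.pderiv_coe, MvPowerSeries.subst_coe,
      pderiv_aeval]

theorem pderiv_powerSeries_subst {b : MvPowerSeries τ R} (hb : PowerSeries.HasSubst b) (j : τ)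
    (f : PowerSeries R) :
    MvPowerSeries.pderiv R j (f.subst b) =
      (PowerSeries.derivative R f).subst b * MvPowerSeries.pderiv R j b := by
  have := pderiv_subst hb.const j f
  rw [Fintype.sum_unique] at this
  exact this

end ChainRule

section Euler

variable {m : ℕ}

/-- The Euler operator `X_s ∂/∂X_s`. -/
def euler (s : Option (Fin m)) : Derivation Coeffs (Ser m) (Ser m) :=
  (MvPowerSeries.X s : Ser m) • MvPowerSeries.pderiv Coeffs s

theorem euler_apply (s : Option (Fin m)) (G : Ser m) :
    euler s G = MvPowerSeries.X s * MvPowerSeries.pderiv Coeffs s G := rfl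

theorem coeff_euler (s : Option (Fin m)) (G : Ser m) (e : Option (Fin m) →₀ ℕ) :
    MvPowerSeries.coeff e (euler s G) = (e s : Coeffs) * MvPowerSeries.coeff e G := by
  rw [euler_apply, MvPowerSeries.X, MvPowerSeries.coeff_monomial_mul]
  split_ifs with h
  · have h1 : 1 ≤ e s := by simpa using h s
    rw [one_mul, MvPowerSeries.coeff_pderiv, tsub_add_cancel_of_le h, mul_comm]
    congr 1
    rw [Finsupp.tsub_apply, Finsupp.single_eq_same, Nat.cast_sub h1, Nat.cast_one,
      sub_add_cancel]
  · have h1 : e s = 0 := by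
      by_contra hs
      refine h fun t => ?_
      by_cases ht : t = s
      · subst ht
        simpa using Nat.one_le_iff_ne_zero.2 hs
      · rw [Finsupp.single_apply, if_neg fun h' => ht h'.symm]
        exact Nat.zero_le _
    rw [h1, Nat.cast_zero, zero_mul]

/-- The change of variables `u ↦ u`, `x_i ↦ w_i e^{-u Q_i}`. -/
def changeHom : Ser m →ₐ[Coeffs] Ser m := MvPowerSeries.substAlgHom hasSubst_changeVars

theorem changeHom_apply (G : Ser m) : changeHom G = MvPowerSeries.subst changeVars G := by
  rw [changeHom, MvPowerSeries.coe_substAlgHom]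

theorem changeHom_X (s : Option (Fin m)) :
    changeHom (MvPowerSeries.X s : Ser m) = changeVars s :=
  MvPowerSeries.substAlgHom_X hasSubst_changeVars s

theorem euler_changeHom (s : Option (Fin m)) (G : Ser m) :
    euler s (changeHom G) =
      ∑ t, changeHom (MvPowerSeries.pderiv Coeffs t G) * euler s (changeVars t) := by
  rw [euler_apply, changeHom_apply, pderiv_subst hasSubst_changeVars, Finset.mul_sum]
  refine Finset.sum_congr rfl fun t _ => ?_
  rw [euler_apply, changeHom_apply]
  ring

theorem pderiv_Qw (s : Option (Fin m)) (i : Fin m) :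
    MvPowerSeries.pderiv Coeffs s (Qw i) =
      if s = some i then (PowerSeries.derivative Coeffs Q).subst (w i) else 0 := by
  rw [Qw, pderiv_powerSeries_subst (hasSubst_w i)]
  split_ifs with h
  · rw [h, w, MvPowerSeries.pderiv_X_self, mul_one]
  · rw [w, MvPowerSeries.pderiv_X_of_ne (fun h' => h h'.symm), mul_zero]

theorem pderiv_exp (s : Option (Fin m)) (i : Fin m) :
    MvPowerSeries.pderiv Coeffs s ((PowerSeries.exp Coeffs).subst (-(u * Qw i)) : Ser m) =
      (PowerSeries.exp Coeffs).subst (-(u * Qw i)) *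
        MvPowerSeries.pderiv Coeffs s (-(u * Qw i)) := by
  rw [pderiv_powerSeries_subst (hasSubst_exp i), PowerSeries.derivative_exp]

theorem euler_none_x (i : Fin m) : euler none (x i) = -(u * Qw i * x i) := by
  rw [euler_apply, x, Derivation.leibniz, pderiv_exp, map_neg, Derivation.leibniz, pderiv_Qw,
    if_neg (by simp), w, u, MvPowerSeries.pderiv_X_self,
    MvPowerSeries.pderiv_X_of_ne (i := none) (j := some i) (by simp)]
  simp only [smul_eq_mul]
  ring

theorem euler_some_x_self (i : Fin m) : euler (some i) (x i) =
    x i * (1 - u * w i * (PowerSeries.derivative Coeffs Q).subst (w i)) := by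
  rw [euler_apply, x, Derivation.leibniz, pderiv_exp, map_neg, Derivation.leibniz, pderiv_Qw,
    if_pos rfl, w, u, MvPowerSeries.pderiv_X_self, MvPowerSeries.pderiv_X_of_ne (by simp)]
  simp only [smul_eq_mul]
  ring

theorem euler_some_x_of_ne {i j : Fin m} (h : i ≠ j) : euler (some i) (x j) = 0 := by
  rw [euler_apply, x, Derivation.leibniz, pderiv_exp, map_neg, Derivation.leibniz, pderiv_Qw,
    if_neg (by simpa using h), w, u,
    MvPowerSeries.pderiv_X_of_ne (i := some i) (j := some j) (by simpa using h.symm),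
    MvPowerSeries.pderiv_X_of_ne (i := some i) (j := none) (by simp)]
  simp

/-- With `u` constant, `x_i ∂/∂x_i = μ_i w_i ∂/∂w_i`, since the logarithmic derivative of `x_i` is
`1 - u w_i Q'(w_i) = 1 / μ_i`. -/
theorem changeHom_euler_some (i : Fin m) (G : Ser m) :
    changeHom (euler (some i) G) = mu i * euler (some i) (changeHom G) := by
  rw [euler_changeHom, Finset.sum_eq_single (some i)]
  · change _ = mu i * (_ * euler (some i) (x i))
    rw [euler_some_x_self, euler_apply, map_mul, changeHom_X]
    change x i * _ = _
    linear_combination -(x i * changeHom (MvPowerSeries.pderiv Coeffs (some i) G)) * mu_spec i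
  · intro t _ ht
    rcases t with _ | j
    · change _ * euler (some i) (u : Ser m) = 0
      rw [euler_apply, u, MvPowerSeries.pderiv_X_of_ne (by simp), mul_zero, mul_zero]
    · change _ * euler (some i) (x j) = 0
      rw [euler_some_x_of_ne (fun h => ht (by rw [h])), mul_zero]
  · simp

/-- The operators `u ∂/∂u` for constant `w` and for constant `x` differ because `x_i` depends on
`u`: its derivative is `u ∂x_i/∂u = -u Q_i x_i`. -/
theorem euler_none_changeHom (G : Ser m) :
    euler none (changeHom G) = changeHom (euler none G) -
      ∑ i, u * Qw i * changeHom (euler (some i) G) := by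
  rw [euler_changeHom, Fintype.sum_option, sub_eq_add_neg, ← Finset.sum_neg_distrib]
  congr 1
  · rw [euler_apply none G, map_mul, changeHom_X]
    change _ * euler none (u : Ser m) = u * _
    rw [euler_apply, u, MvPowerSeries.pderiv_X_self, mul_one, mul_comm]
  · refine Finset.sum_congr rfl fun i _ => ?_
    change _ * euler none (x i) = _
    rw [euler_none_x, euler_apply, map_mul, changeHom_X]
    change _ = -(u * Qw i * (x i * _))
    ring

theorem u_dvd_changeVars_sub (s : Option (Fin m)) :
    (MvPowerSeries.X none : Ser m) ∣ changeVars s - MvPowerSeries.X s := by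
  rcases s with _ | i
  · exact ⟨0, by rw [mul_zero]; exact sub_self _⟩
  · obtain ⟨E, hE⟩ : (PowerSeries.X : PowerSeries Coeffs) ∣ PowerSeries.exp Coeffs - 1 :=
      PowerSeries.X_dvd_iff.2 (by simp)
    have h1 : (PowerSeries.exp Coeffs).subst (-(u * Qw i)) - 1 =
        -(u * Qw i) * E.subst (-(u * Qw i)) := by
      have h2 : (PowerSeries.exp Coeffs) = 1 + PowerSeries.X * E := by rw [← hE]; ring
      rw [h2, PowerSeries.subst_add (hasSubst_exp i), PowerSeries.subst_mul (hasSubst_exp i),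
        PowerSeries.subst_X (hasSubst_exp i), ← PowerSeries.coe_substAlgHom (hasSubst_exp i),
        map_one, add_sub_cancel_left]
    refine ⟨-(w i * Qw i * E.subst (-(u * Qw i))), ?_⟩
    change w i * _ - w i = u * _
    linear_combination w i * h1

/-- The change of variables is trivial modulo `u`. -/
theorem coeff_changeHom {e : Option (Fin m) →₀ ℕ} (he : e none = 0) (G : Ser m) :
    MvPowerSeries.coeff e (changeHom G) = MvPowerSeries.coeff e G := by
  rw [changeHom_apply, coeff_subst_eq_of_X_dvd_sub hasSubst_changeVars MvPowerSeries.HasSubst.X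
    u_dvd_changeVars_sub he, MvPowerSeries.subst_self]
  rfl

end Euler

/-! ### The join-cut equation for series -/

section Series

variable {m : ℕ}

/-- The genus zero series in the variables `x_i` for `i ∈ J`. -/
def hurwitzSeries (J : Finset (Fin m)) : Ser m := fun e =>
  if labels e = J then hurwitzCoeff e else 0

theorem coeff_hurwitzSeries (J : Finset (Fin m)) (e : Option (Fin m) →₀ ℕ) :
    MvPowerSeries.coeff e (hurwitzSeries J) = if labels e = J then hurwitzCoeff e else 0 := rfl

theorem bigH_zero : bigH 0 m = hurwitzSeries Finset.univ :=
  MvPowerSeries.ext fun e => coeff_bigH_zero e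

/-- The series in `|J|` variables, written in the variables with indices in `J`. -/
theorem rename_bigH (J : Finset (Fin m)) :
    MvPowerSeries.rename (Option.map (J.orderEmbOfFin rfl)) (bigH 0 J.card) =
      hurwitzSeries J := by
  set f : Fin J.card ↪ Fin m := (J.orderEmbOfFin rfl).toEmbedding with hf
  have hJ : Finset.univ.map f = J := by
    rw [hf]
    exact J.map_orderEmbOfFin_univ rfl
  change MvPowerSeries.rename f.optionMap (bigH 0 J.card) = hurwitzSeries J
  ext1 e
  rw [coeff_hurwitzSeries]
  by_cases he : e ∈ Set.range (Finsupp.mapDomain (M := ℕ) f.optionMap)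
  · obtain ⟨d, rfl⟩ := he
    rw [← Finsupp.embDomain_eq_mapDomain, MvPowerSeries.coeff_embDomain_rename, coeff_bigH_zero,
      labels_embDomain, hurwitzCoeff_embDomain]
    exact if_congr ⟨fun h => (congrArg _ h).trans hJ,
      fun h => Finset.map_injective f (h.trans hJ.symm)⟩ rfl rfl
  · rw [MvPowerSeries.coeff_rename_eq_zero _ _ he, if_neg]
    intro hl
    refine he ⟨_, Finsupp.mapDomain_comapDomain _ f.optionMap.injective e ?_⟩
    rintro (_ | i) hi
    · exact ⟨none, rfl⟩
    · have : i ∈ labels e := mem_labels.2 (Finsupp.mem_support_iff.1 hi)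
      rw [hl, ← hJ, Finset.mem_map] at this
      obtain ⟨j, -, hj⟩ := this
      exact ⟨some j, congrArg some hj⟩

theorem rename_subst {σ τ : Type} [Finite σ] [Finite τ] (g : σ → τ) {ρ : Type}
    {a : ρ → MvPowerSeries σ Coeffs} (ha : MvPowerSeries.HasSubst a)
    (G : MvPowerSeries ρ Coeffs) :
    MvPowerSeries.rename g (MvPowerSeries.subst a G) =
      MvPowerSeries.subst (fun s => MvPowerSeries.rename g (a s)) G := by
  simp only [MvPowerSeries.rename_eq_subst]
  exact MvPowerSeries.subst_comp_subst_apply ha (MvPowerSeries.HasSubst.X_comp g) G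

theorem rename_changeVars {j : ℕ} (f : Fin j → Fin m) (s : Option (Fin j)) :
    MvPowerSeries.rename (Option.map f) (changeVars s) = changeVars (Option.map f s) := by
  have hw : ∀ i : Fin j, MvPowerSeries.rename (Option.map f) (w i) = w (f i) := fun i =>
    MvPowerSeries.rename_X _ _
  have hu : MvPowerSeries.rename (Option.map f) (u : Ser j) = u := MvPowerSeries.rename_X _ _
  have hps : ∀ {b : Ser j}, PowerSeries.HasSubst b → ∀ F : PowerSeries Coeffs,
      MvPowerSeries.rename (Option.map f) (F.subst b) =
        F.subst (MvPowerSeries.rename (Option.map f) b) := fun hb F =>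
    rename_subst (Option.map f) hb.const F
  rcases s with _ | i
  · exact hu
  · change MvPowerSeries.rename (Option.map f) (x i) = x (f i)
    rw [x, map_mul, hw, hps (hasSubst_exp i), map_neg, map_mul, hu, Qw, hps (hasSubst_w i), hw,
      x, Qw]

/-- Renaming of variables commutes with the change of variables, so the series `hAt 0 J` is obtained
from `hurwitzSeries J` by the full change of variables. -/
theorem hAt_zero (J : Finset (Fin m)) : hAt 0 J = changeHom (hurwitzSeries J) := by
  rw [hAt, h, rename_subst _ hasSubst_changeVars]
  simp only [rename_changeVars]
  rw [changeHom_apply, ← rename_bigH, MvPowerSeries.rename_eq_subst,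
    MvPowerSeries.subst_comp_subst_apply (MvPowerSeries.HasSubst.X_comp _) hasSubst_changeVars]
  congr 1
  funext s
  exact (MvPowerSeries.subst_X hasSubst_changeVars _).symm

theorem h_zero : h 0 m = changeHom (hurwitzSeries Finset.univ) := by
  rw [h, bigH_zero, changeHom_apply]

theorem changeHom_euler_hurwitzSeries (J : Finset (Fin m)) (i : Fin m) :
    changeHom (euler (some i) (hurwitzSeries J)) = mu i * hDer 0 J i := by
  rw [changeHom_euler_some, hDer, hAt_zero]
  rfl

/-- The contribution to the join-cut equation of the cycles that are cut into a cycle with label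
`k` and a cycle with label `l`. -/
def cutSeries (J : Finset (Fin m)) (k l : Fin m) : Ser m := fun e =>
  if labels e = J then ((e (some k) + e (some l) : ℕ) : Coeffs) * hurwitzCoeff (mergeLabels e k l)
  else 0

theorem coeff_cutSeries (J : Finset (Fin m)) (k l : Fin m) (e : Option (Fin m) →₀ ℕ) :
    MvPowerSeries.coeff e (cutSeries J k l) = if labels e = J then
      ((e (some k) + e (some l) : ℕ) : Coeffs) * hurwitzCoeff (mergeLabels e k l) else 0 := rfl

/-- The pairs of sets of labels with union `J` that have only the label `i` in common. -/
def joinPairs (J : Finset (Fin m)) (i : Fin m) : Finset (Finset (Fin m) × Finset (Fin m)) :=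
  Finset.univ.filter fun p => p.1 ∪ p.2 = J ∧ p.1 ∩ p.2 = {i}

/-- The genus zero join-cut equation. -/
theorem join_cut {J : Finset (Fin m)} (hJ : J.Nonempty) :
    2 * (euler none (hurwitzSeries J) + ((J.card : Ser m) - 2) * hurwitzSeries J) =
      (∑ k ∈ J, ∑ l ∈ J, if k ≠ l then cutSeries J k l else 0) +
      ∑ i, ∑ p ∈ joinPairs J i,
        euler (some i) (hurwitzSeries p.1) * euler (some i) (hurwitzSeries p.2) := by
  ext1 e
  have hconst : 2 * (euler none (hurwitzSeries J) + ((J.card : Ser m) - 2) * hurwitzSeries J) =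
      MvPowerSeries.C (2 : Coeffs) * (euler none (hurwitzSeries J) +
        MvPowerSeries.C ((J.card : Coeffs) - 2) * hurwitzSeries J) := by
    rw [map_sub, map_natCast, map_ofNat]
  have hprod : ∀ i, ∀ p : Finset (Fin m) × Finset (Fin m), MvPowerSeries.coeff e
      (euler (some i) (hurwitzSeries p.1) * euler (some i) (hurwitzSeries p.2)) =
      ∑ d ∈ antidiagonal e, if p = (labels d.1, labels d.2) then
        ((d.1 (some i) * d.2 (some i) : ℕ) : Coeffs) * (hurwitzCoeff d.1 * hurwitzCoeff d.2)
        else 0 := by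
    intro i p
    rw [MvPowerSeries.coeff_mul]
    refine Finset.sum_congr rfl fun d _ => ?_
    rw [coeff_euler, coeff_euler, coeff_hurwitzSeries, coeff_hurwitzSeries]
    by_cases h1 : labels d.1 = p.1
    · by_cases h2 : labels d.2 = p.2
      · rw [if_pos h1, if_pos h2, if_pos (Prod.ext h1.symm h2.symm)]
        push_cast
        ring
      · rw [if_neg h2, if_neg fun h => h2 (congrArg Prod.snd h).symm, mul_zero, mul_zero]
    · rw [if_neg h1, if_neg fun h => h1 (congrArg Prod.fst h).symm, mul_zero, zero_mul]
  have hjoin : MvPowerSeries.coeff e (∑ i, ∑ p ∈ joinPairs J i,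
      euler (some i) (hurwitzSeries p.1) * euler (some i) (hurwitzSeries p.2)) =
      ∑ d ∈ antidiagonal e, if labels e = J then
        (joinWeight d.1 d.2 : Coeffs) * (hurwitzCoeff d.1 * hurwitzCoeff d.2) else 0 := by
    simp only [map_sum, hprod]
    rw [Finset.sum_congr rfl fun i _ => Finset.sum_comm, Finset.sum_comm]
    refine Finset.sum_congr rfl fun d hd => ?_
    rw [← mem_antidiagonal.1 hd, labels_add]
    simp only [Finset.sum_ite_eq', joinPairs, Finset.mem_filter, Finset.mem_univ, true_and]
    split_ifs with hl
    · rw [joinWeight, Nat.cast_sum, Finset.sum_mul]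
      refine Finset.sum_congr rfl fun i _ => ?_
      have hiff : (∀ j, d.1 (some j) ≠ 0 ∧ d.2 (some j) ≠ 0 ↔ j = i) ↔
          labels d.1 ∩ labels d.2 = {i} := by
        rw [Finset.ext_iff]
        simp only [Finset.mem_inter, mem_labels, Finset.mem_singleton]
      by_cases hi : labels d.1 ∩ labels d.2 = {i}
      · rw [if_pos ⟨hl, hi⟩, if_pos (hiff.2 hi)]
      · rw [if_neg fun h => hi h.2, if_neg fun h => hi (hiff.1 h), Nat.cast_zero, zero_mul]
    · exact Finset.sum_eq_zero fun i _ => if_neg fun h => hl h.1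
  have hcut : MvPowerSeries.coeff e (∑ k ∈ J, ∑ l ∈ J, if k ≠ l then cutSeries J k l else 0) =
      if labels e = J then ∑ k, ∑ l, if k ≠ l ∧ e (some k) ≠ 0 ∧ e (some l) ≠ 0 then
        ((e (some k) + e (some l) : ℕ) : Coeffs) * hurwitzCoeff (mergeLabels e k l) else 0
      else 0 := by
    simp only [map_sum]
    split_ifs with hl
    · simp only [← hl, labels, Finset.sum_filter]
      refine Finset.sum_congr rfl fun k _ => ?_
      by_cases hk : e (some k) = 0
      · simp [hk]
      · rw [if_pos hk]
        refine Finset.sum_congr rfl fun l _ => ?_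
        by_cases hkl : k ≠ l ∧ e (some l) ≠ 0
        · rw [if_pos hkl.2, if_pos hkl.1, if_pos ⟨hkl.1, hk, hkl.2⟩, coeff_cutSeries]
          exact if_pos rfl
        · rw [if_neg (c := k ≠ l ∧ e (some k) ≠ 0 ∧ e (some l) ≠ 0) fun h => hkl ⟨h.1, h.2.2⟩]
          split_ifs with h1 h2
          · exact absurd ⟨h2, h1⟩ hkl
          · rfl
          · rfl
    · refine Finset.sum_eq_zero fun k _ => Finset.sum_eq_zero fun l _ => ?_
      split_ifs
      · rw [coeff_cutSeries, if_neg hl]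
      · rfl
  rw [map_add, hjoin, hcut, hconst, MvPowerSeries.coeff_C_mul, map_add, MvPowerSeries.coeff_C_mul,
    coeff_euler, coeff_hurwitzSeries]
  by_cases hl : labels e = J
  · simp only [if_pos hl]
    have h := hurwitzCoeff_join_cut e (hl ▸ hJ)
    rw [hl] at h
    refine Eq.trans ?_ (h.trans ?_)
    · ring
    · congr!
  · simp [hl]

theorem hurwitzCoeff_mergeLabels_comm {e : Option (Fin m) →₀ ℕ} {k l : Fin m} (hkl : k ≠ l) :
    hurwitzCoeff (mergeLabels e k l) = hurwitzCoeff (mergeLabels e l k) := by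
  rw [← hurwitzCoeff_embDomain (Equiv.swap k l).toEmbedding (mergeLabels e l k)]
  congr 1
  ext o
  rcases o with _ | i
  · rw [embDomain_none, mergeLabels_none, mergeLabels_none]
  · have hs := embDomain_some (Equiv.swap k l).toEmbedding (mergeLabels e l k) (Equiv.swap k l i)
    rw [Equiv.coe_toEmbedding, Equiv.swap_apply_self] at hs
    rw [hs]
    by_cases hik : i = k
    · rw [hik, Equiv.swap_apply_left, mergeLabels_left _ hkl, mergeLabels_left _ hkl.symm, add_comm]
    by_cases hil : i = l
    · rw [hil, Equiv.swap_apply_right, mergeLabels_right _ hkl, mergeLabels_right _ hkl.symm]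
    rw [Equiv.swap_apply_of_ne_of_ne hik hil, mergeLabels_of_ne _ hik hil,
      mergeLabels_of_ne _ hil hik]

theorem cutSeries_comm (J : Finset (Fin m)) {k l : Fin m} (hkl : k ≠ l) :
    cutSeries J k l = cutSeries J l k := by
  ext1 e
  rw [coeff_cutSeries, coeff_cutSeries, hurwitzCoeff_mergeLabels_comm hkl, add_comm]

/-- The added term supplies the missing exponent `a_k = 0` of the geometric sum in `cutSeries`, and the
result is symmetric in `k` and `l`. -/
theorem coeff_X_mul_cutSeries {J : Finset (Fin m)} {k l : Fin m} (hkl : k ≠ l) (hk : k ∈ J)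
    (e : Option (Fin m) →₀ ℕ) :
    MvPowerSeries.coeff e (MvPowerSeries.X (some k) *
      (cutSeries J k l + euler (some l) (hurwitzSeries (J.erase k)))) =
    if labels e = J then ((e (some k) + e (some l) - 1 : ℕ) : Coeffs) *
      hurwitzCoeff (mergeLabels (e - Finsupp.single (some k) 1) l k) else 0 := by
  rw [MvPowerSeries.X, MvPowerSeries.coeff_monomial_mul, one_mul]
  by_cases hek : e (some k) = 0
  · rw [if_neg, if_neg]
    · intro h
      rw [← h, mem_labels] at hk
      exact hk hek
    · intro h
      have := h (some k)
      rw [Finsupp.single_eq_same, hek] at this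
      omega
  obtain ⟨f, rfl⟩ : ∃ f, e = f + Finsupp.single (some k) 1 := by
    refine ⟨e - Finsupp.single (some k) 1, (tsub_add_cancel_of_le ?_).symm⟩
    rw [Finsupp.single_le_iff]
    omega
  have hlab : labels (f + Finsupp.single (some k) 1) = insert k (labels f) := by
    ext i
    rw [labels_add, Finset.mem_union, Finset.mem_insert, mem_labels (e := Finsupp.single _ _),
      Finsupp.single_apply, or_comm]
    simp [eq_comm]
  have hfl : (f + Finsupp.single (some k) 1 : Option (Fin m) →₀ ℕ) (some l) = f (some l) := by
    simp [hkl]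
  have hfk : (f + Finsupp.single (some k) 1 : Option (Fin m) →₀ ℕ) (some k) = f (some k) + 1 := by
    simp
  rw [if_pos le_add_self, add_tsub_cancel_right, map_add, coeff_cutSeries, coeff_euler,
    coeff_hurwitzSeries, hlab, hfl, hfk, Nat.add_right_comm, Nat.add_sub_cancel]
  by_cases h0 : f (some k) = 0
  · have hk0 : k ∉ labels f := fun h => mem_labels.1 h h0
    have hmerge : mergeLabels f l k = f := by
      rw [mergeLabels, h0, Finsupp.single_zero, add_zero, Finsupp.erase_of_notMem_support]
      simpa using h0
    rw [if_neg (c := labels f = J) (fun h => hk0 (h ▸ hk)), zero_add, hmerge, h0, zero_add,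
      mul_ite, mul_zero]
    refine if_congr ⟨fun h => ?_, fun h => ?_⟩ rfl rfl
    · rw [h, Finset.insert_erase hk]
    · rw [← h, Finset.erase_insert hk0]
  · have hk0 : k ∈ labels f := mem_labels.2 h0
    rw [Finset.insert_eq_of_mem hk0, if_neg (c := labels f = J.erase k)
      (fun h => Finset.notMem_erase k J (h ▸ hk0)), mul_zero, add_zero,
      hurwitzCoeff_mergeLabels_comm hkl]

/-- A cut of a cycle sums the geometric series
`∑_{a + b = s, a, b ≥ 1} x_k^a x_l^b = (x_k^s x_l - x_k x_l^s) / (x_k - x_l)`. -/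
theorem X_sub_X_mul_cutSeries {J : Finset (Fin m)} {k l : Fin m} (hkl : k ≠ l) (hk : k ∈ J)
    (hl : l ∈ J) :
    (MvPowerSeries.X (some k) - MvPowerSeries.X (some l)) * cutSeries J k l =
      MvPowerSeries.X (some l) * euler (some k) (hurwitzSeries (J.erase l)) -
        MvPowerSeries.X (some k) * euler (some l) (hurwitzSeries (J.erase k)) := by
  have hsymm : MvPowerSeries.X (some k) *
        (cutSeries J k l + euler (some l) (hurwitzSeries (J.erase k))) =
      MvPowerSeries.X (some l) *
        (cutSeries J l k + euler (some k) (hurwitzSeries (J.erase l))) := by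
    ext1 e
    rw [coeff_X_mul_cutSeries hkl hk, coeff_X_mul_cutSeries hkl.symm hl]
    refine if_ctx_congr Iff.rfl (fun h => ?_) fun _ => rfl
    have hek : e (some k) ≠ 0 := mem_labels.1 (h ▸ hk)
    have hel : e (some l) ≠ 0 := mem_labels.1 (h ▸ hl)
    rw [add_comm (e (some k)), hurwitzCoeff_mergeLabels_comm hkl.symm]
    congr 2
    ext o
    rcases o with _ | i
    · rw [mergeLabels_none, mergeLabels_none]
      simp
    by_cases hik : i = k
    · subst hik
      rw [mergeLabels_left _ hkl, mergeLabels_left _ hkl]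
      simp [hkl, hkl.symm]
      omega
    by_cases hil : i = l
    · subst hil
      rw [mergeLabels_right _ hkl, mergeLabels_right _ hkl]
    rw [mergeLabels_of_ne _ hik hil, mergeLabels_of_ne _ hik hil]
    simp [Ne.symm hik, Ne.symm hil]
  rw [cutSeries_comm J hkl.symm] at hsymm
  linear_combination hsymm

end Series

/-! ### The one-part series after the change of variables -/

section OnePart

variable {m : ℕ}

theorem two_ne_zero_ser : (2 : Ser m) ≠ 0 := by
  intro h
  have h2 := congrArg (MvPowerSeries.constantCoeff (σ := Option (Fin m)) (R := Coeffs)) h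
  rw [map_ofNat, map_zero] at h2
  exact two_ne_zero h2

theorem u_dvd_hurwitzSeries {J : Finset (Fin m)} (hJ : J.Nonempty) :
    (MvPowerSeries.X none : Ser m) ∣ hurwitzSeries J := by
  refine MvPowerSeries.X_dvd_iff.2 fun e he => ?_
  rw [coeff_hurwitzSeries]
  split_ifs with hl
  · exact hurwitzCoeff_eq_zero_of_none he (hl ▸ hJ)
  · rfl

theorem u_dvd_euler_some {G : Ser m} (h : (MvPowerSeries.X none : Ser m) ∣ G) (i : Fin m) :
    (MvPowerSeries.X none : Ser m) ∣ euler (some i) G := by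
  rw [MvPowerSeries.X_dvd_iff] at h ⊢
  intro e he
  rw [coeff_euler, h e he, mul_zero]

theorem u_dvd_changeHom {G : Ser m} (h : (MvPowerSeries.X none : Ser m) ∣ G) :
    (MvPowerSeries.X none : Ser m) ∣ changeHom G := by
  rw [MvPowerSeries.X_dvd_iff] at h ⊢
  intro e he
  rw [coeff_changeHom he, h e he]

/-- The only solution of order two in `u` of `u ∂ε/∂u = ε + ε P` with `P = O(u)` is zero. -/
theorem eq_zero_of_euler_eq {ε P : Ser m} (hP : (MvPowerSeries.X none : Ser m) ∣ P)
    (hε : euler none ε = ε + ε * P)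
    (h1 : ∀ e : Option (Fin m) →₀ ℕ, e none = 1 → MvPowerSeries.coeff e ε = 0) : ε = 0 := by
  have key : ∀ n, ∀ e : Option (Fin m) →₀ ℕ, e none = n → MvPowerSeries.coeff e ε = 0 := by
    intro n
    induction n using Nat.strong_induction_on with
    | _ n ih =>
      intro e he
      by_cases hn : n = 1
      · exact h1 e (he.trans hn)
      have h2 : MvPowerSeries.coeff e (ε * P) = 0 := by
        rw [MvPowerSeries.coeff_mul]
        refine Finset.sum_eq_zero fun d hd => ?_
        have hde : d.1 none + d.2 none = n := by
          rw [← he, ← mem_antidiagonal.1 hd, Finsupp.add_apply]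
        by_cases hd0 : d.2 none = 0
        · rw [MvPowerSeries.X_dvd_iff.1 hP _ hd0, mul_zero]
        · rw [ih (d.1 none) (by omega) _ rfl, zero_mul]
      have h3 := congrArg (MvPowerSeries.coeff e) hε
      rw [coeff_euler, map_add, h2, add_zero, he] at h3
      have h4 : ((n : Coeffs) - 1) * MvPowerSeries.coeff e ε = 0 := by
        linear_combination h3
      refine (mul_eq_zero.1 h4).resolve_left fun h5 => hn ?_
      rw [sub_eq_zero] at h5
      exact_mod_cast h5
  exact MvPowerSeries.ext fun e => key _ e rfl

theorem euler_hurwitzSeries_eq_zero {J : Finset (Fin m)} {j : Fin m} (hj : j ∉ J) :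
    euler (some j) (hurwitzSeries J) = 0 := by
  ext1 e
  rw [coeff_euler, coeff_hurwitzSeries, map_zero]
  split_ifs with hl
  · have : e (some j) = 0 := by
      by_contra h
      exact hj (hl ▸ mem_labels.2 h)
    rw [this, Nat.cast_zero, zero_mul]
  · rw [mul_zero]

theorem joinPairs_singleton (i j : Fin m) :
    joinPairs {i} j = if j = i then {({i}, {i})} else ∅ := by
  ext ⟨α, ζ⟩
  simp only [joinPairs, Finset.mem_filter, Finset.mem_univ, true_and]
  constructor
  · rintro ⟨h1, h2⟩
    have hj : j ∈ α ∩ ζ := by simp [h2]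
    rw [Finset.mem_inter] at hj
    have hji : j = i := Finset.mem_singleton.1 (h1 ▸ Finset.mem_union_left _ hj.1)
    subst hji
    rw [if_pos rfl, Finset.mem_singleton]
    have h3 : α ⊆ {j} := h1 ▸ Finset.subset_union_left
    have h4 : ζ ⊆ {j} := h1 ▸ Finset.subset_union_right
    rw [Finset.Subset.antisymm h3 (by simpa using hj.1),
      Finset.Subset.antisymm h4 (by simpa using hj.2)]
  · intro h
    split_ifs at h with hji
    · subst hji
      rw [Finset.mem_singleton, Prod.mk.injEq] at h
      rw [h.1, h.2, Finset.union_idempotent, Finset.inter_self]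
      exact ⟨rfl, rfl⟩
    · exact absurd h (Finset.notMem_empty _)

theorem coeff_euler_hurwitzSeries_singleton (i : Fin m) {e : Option (Fin m) →₀ ℕ}
    (he : e none = 1) :
    MvPowerSeries.coeff e (euler (some i) (hurwitzSeries {i})) =
      MvPowerSeries.coeff e (u * Qw i) := by
  obtain ⟨d, rfl⟩ : ∃ d, e = Finsupp.single none 1 + d := by
    refine ⟨e - Finsupp.single none 1, (add_tsub_cancel_of_le ?_).symm⟩
    rw [Finsupp.single_le_iff, he]
  have hd0 : d none = 0 := by simpa using he
  have hds : ∀ j, (Finsupp.single none 1 + d : Option (Fin m) →₀ ℕ) (some j) = d (some j) := by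
    simp
  rw [u, MvPowerSeries.X, MvPowerSeries.coeff_add_monomial_mul, one_mul, Qw, w,
    PowerSeries.coeff_subst_single, coeff_euler, coeff_hurwitzSeries, hds]
  have hQ : PowerSeries.coeff (d (some i)) Q = q (d (some i)) := PowerSeries.coeff_mk _ _
  by_cases hl : labels (Finsupp.single none 1 + d) = {i}
  · rw [if_pos hl, if_pos, ← hds, hurwitzCoeff_one_part he hl, hds, hQ]
    ext o
    rcases o with _ | j
    · simp [hd0]
    · by_cases hj : j = i
      · subst hj
        simp
      · have : d (some j) = 0 := by
          rw [← hds]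
          by_contra h
          exact hj (Finset.mem_singleton.1 (hl ▸ mem_labels.2 h))
        rw [this, Finsupp.single_apply, if_neg]
        simpa using Ne.symm hj
  · rw [if_neg hl, mul_zero]
    split_ifs with hd
    · rw [hQ]
      by_cases h0 : d (some i) = 0
      · rw [h0, q, dif_neg (lt_irrefl 0)]
      · refine absurd ?_ hl
        ext j
        rw [mem_labels, hds, hd, Finsupp.single_apply, Finset.mem_singleton]
        by_cases hj : j = i
        · subst hj
          simpa using h0
        · simp [hj, Ne.symm hj]
    · rfl

/-- The one-part series becomes `u Q_i`: after the change of variables, the join-cut equation with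
one part is a linear equation for `x_i ∂/∂x_i` of the one-part series, minus `u Q_i`. -/
theorem changeHom_euler_singleton (i : Fin m) :
    changeHom (euler (some i) (hurwitzSeries {i})) = u * Qw i := by
  set H : Ser m := hurwitzSeries {i} with hH
  set G : Ser m := euler (some i) H with hG
  have hdvd : (MvPowerSeries.X none : Ser m) ∣ G :=
    u_dvd_euler_some (u_dvd_hurwitzSeries (Finset.singleton_nonempty i)) i
  have hjc : 2 * (euler none H - H) = G * G := by
    have h := join_cut (Finset.singleton_nonempty i)
    rw [Finset.sum_singleton, Finset.sum_singleton, if_neg (fun h' => h' rfl), zero_add,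
      Finset.sum_eq_single i, joinPairs_singleton, if_pos rfl, Finset.sum_singleton,
      Finset.card_singleton] at h
    · rw [← h]
      push_cast
      ring
    · intro j _ hj
      rw [joinPairs_singleton, if_neg hj, Finset.sum_empty]
    · intro h'
      exact absurd (Finset.mem_univ i) h'
  have hcomm : euler (some i) (euler none H) = euler none G := by
    ext1 e
    rw [coeff_euler, coeff_euler, hG, coeff_euler, coeff_euler]
    ring
  have hG1 : euler none G = G + G * euler (some i) G := by
    have h := congrArg (euler (some i)) hjc
    have h2 : euler (some i) (2 * (euler none H - H)) = 2 * (euler none G - G) := by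
      rw [two_mul, map_add, map_sub, hcomm, ← hG, two_mul]
    rw [h2, Derivation.leibniz, smul_eq_mul] at h
    refine mul_left_cancel₀ two_ne_zero_ser ?_
    linear_combination h
  have hsum : ∑ j, u * Qw j * changeHom (euler (some j) G) =
      u * Qw i * changeHom (euler (some i) G) := by
    refine Finset.sum_eq_single i (fun j _ hj => ?_) fun h => absurd (Finset.mem_univ i) h
    have : euler (some j) G = 0 := by
      ext1 e
      have h0 := congrArg (MvPowerSeries.coeff e) (euler_hurwitzSeries_eq_zero (J := {i})
        (fun h => hj (Finset.mem_singleton.1 h)))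
      rw [coeff_euler, map_zero] at h0
      rw [coeff_euler, hG, coeff_euler, map_zero]
      linear_combination (e (some i) : Coeffs) * h0
    rw [this, map_zero, mul_zero]
  have huQ : euler none (u * Qw i) = u * Qw i := by
    rw [euler_apply, Derivation.leibniz, pderiv_Qw, if_neg (by simp), u,
      MvPowerSeries.pderiv_X_self]
    simp
  rw [← sub_eq_zero]
  refine eq_zero_of_euler_eq (P := changeHom (euler (some i) G))
    (u_dvd_changeHom (u_dvd_euler_some hdvd i)) ?_ ?_
  · rw [map_sub, euler_none_changeHom, hsum, huQ, hG1, map_add, map_mul]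
    ring
  · intro e he
    rw [map_sub, sub_eq_zero, ← coeff_euler_hurwitzSeries_singleton i he]
    obtain ⟨d, rfl⟩ : ∃ d, e = Finsupp.single none 1 + d := by
      refine ⟨e - Finsupp.single none 1, (add_tsub_cancel_of_le ?_).symm⟩
      rw [Finsupp.single_le_iff, he]
    have hd0 : d none = 0 := by simpa using he
    rw [← hH, ← hG]
    obtain ⟨G', hG'⟩ := hdvd
    rw [hG', map_mul, changeHom_X]
    change MvPowerSeries.coeff _ (MvPowerSeries.X none * _) = _
    rw [MvPowerSeries.X, MvPowerSeries.coeff_add_monomial_mul,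
      MvPowerSeries.coeff_add_monomial_mul, coeff_changeHom hd0]

end OnePart

/-! ### The recursion -/

section Recursion

variable {m : ℕ}

/-- The pairs in `joinPairs` whose members both have at least two elements. -/
def joinPairsTwo (i : Fin m) : Finset (Finset (Fin m) × Finset (Fin m)) :=
  (joinPairs Finset.univ i).filter fun p => 2 ≤ p.1.card ∧ 2 ≤ p.2.card

theorem mem_joinPairs_univ {i : Fin m} {p : Finset (Fin m) × Finset (Fin m)} :
    p ∈ joinPairs Finset.univ i ↔ p.1 ∪ p.2 = Finset.univ ∧ p.1 ∩ p.2 = {i} := by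
  rw [joinPairs, Finset.mem_filter, and_iff_right (Finset.mem_univ _)]

theorem mem_of_mem_joinPairs {J : Finset (Fin m)} {i : Fin m}
    {p : Finset (Fin m) × Finset (Fin m)} (h : p ∈ joinPairs J i) : i ∈ p.1 ∧ i ∈ p.2 := by
  rw [← Finset.mem_inter, (Finset.mem_filter.1 h).2.2, Finset.mem_singleton]

theorem joinPairs_univ (i : Fin m) :
    joinPairs Finset.univ i =
      insert ({i}, Finset.univ) (insert (Finset.univ, {i}) (joinPairsTwo i)) := by
  ext ⟨α, ζ⟩
  simp only [Finset.mem_insert, joinPairsTwo, Finset.mem_filter, Prod.mk.injEq]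
  constructor
  · intro h
    have hi := mem_of_mem_joinPairs h
    have hu := (mem_joinPairs_univ.1 h).1
    dsimp only at hi hu
    by_cases h1 : α.card = 1
    · obtain ⟨j, rfl⟩ := Finset.card_eq_one.1 h1
      obtain rfl := Finset.mem_singleton.1 hi.1
      refine Or.inl ⟨rfl, ?_⟩
      rwa [Finset.union_eq_right.2 (Finset.singleton_subset_iff.2 hi.2)] at hu
    by_cases h2 : ζ.card = 1
    · obtain ⟨j, rfl⟩ := Finset.card_eq_one.1 h2
      obtain rfl := Finset.mem_singleton.1 hi.2
      refine Or.inr (Or.inl ⟨?_, rfl⟩)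
      rwa [Finset.union_eq_left.2 (Finset.singleton_subset_iff.2 hi.1)] at hu
    have h3 := Finset.card_pos.2 ⟨i, hi.1⟩
    have h4 := Finset.card_pos.2 ⟨i, hi.2⟩
    exact Or.inr (Or.inr ⟨h, by omega, by omega⟩)
  · rintro (⟨rfl, rfl⟩ | ⟨rfl, rfl⟩ | h)
    · exact mem_joinPairs_univ.2 ⟨by simp, by simp⟩
    · exact mem_joinPairs_univ.2 ⟨by simp, by simp⟩
    · exact h.1

/-- The two ordered pairs with a member `{i}` are `({i}, {1, …, m})` and its reverse; they differ
because `m ≥ 2`. -/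
theorem sum_joinPairs_univ (hm : 2 ≤ m) (i : Fin m)
    (f : Finset (Fin m) × Finset (Fin m) → Ser m) :
    ∑ p ∈ joinPairs Finset.univ i, f p =
      f ({i}, Finset.univ) + (f (Finset.univ, {i}) + ∑ p ∈ joinPairsTwo i, f p) := by
  have hcard : (Finset.univ : Finset (Fin m)).card = m := by simp
  rw [joinPairs_univ, Finset.sum_insert, Finset.sum_insert]
  · simp [joinPairsTwo]
  · rw [Finset.mem_insert, not_or]
    refine ⟨fun h => ?_, by simp [joinPairsTwo]⟩
    have h1 := congrArg (fun p => p.1.card) h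
    dsimp only at h1
    rw [hcard, Finset.card_singleton] at h1
    omega

/-- Each unordered pair comes from two ordered pairs. -/
theorem sum_joinPairsTwo (i : Fin m) (f : Finset (Fin m) → Ser m) :
    ∑ p ∈ joinPairsTwo i, f p.1 * f p.2 = 2 * ∑ p ∈ OmegaTwo i, (p.map f).mul := by
  have hmem : ∀ p : Finset (Fin m) × Finset (Fin m),
      s(p.1, p.2) ∈ OmegaTwo i ↔ p ∈ joinPairsTwo i := by
    rintro ⟨α, ζ⟩
    rw [OmegaTwo, Finset.mem_filter, joinPairsTwo, Finset.mem_filter, Omega, Finset.mem_image,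
      mem_joinPairs_univ]
    refine and_congr ⟨?_, fun h => ⟨(α, ζ), Finset.mem_filter.2 ⟨Finset.mem_univ _, h⟩, rfl⟩⟩ ?_
    · rintro ⟨⟨α', ζ'⟩, h, hs⟩
      rw [Finset.mem_filter] at h
      rcases Sym2.eq_iff.1 hs with ⟨h1, h2⟩ | ⟨h1, h2⟩
      · dsimp only at h h1 h2 ⊢
        subst h1 h2
        exact h.2
      · dsimp only at h h1 h2 ⊢
        subst h1 h2
        rw [Finset.union_comm, Finset.inter_comm]
        exact h.2
    · simp
  rw [← Finset.sum_fiberwise_of_maps_to (g := fun p => s(p.1, p.2)) (t := OmegaTwo i)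
    fun p hp => (hmem p).2 hp, Finset.mul_sum]
  refine Finset.sum_congr rfl fun z hz => ?_
  induction z using Sym2.ind with | _ α ζ
  have hp := (hmem (α, ζ)).1 hz
  have hne : α ≠ ζ := by
    rintro rfl
    obtain ⟨h1, h2⟩ := Finset.mem_filter.1 hp
    have h3 := (mem_joinPairs_univ.1 h1).2
    rw [Finset.inter_self] at h3
    rw [h3, Finset.card_singleton] at h2
    omega
  have hfib : (joinPairsTwo i).filter (fun p => s(p.1, p.2) = s(α, ζ)) = {(α, ζ), (ζ, α)} := by
    ext ⟨α', ζ'⟩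
    rw [Finset.mem_filter, Finset.mem_insert, Finset.mem_singleton, Prod.mk.injEq, Prod.mk.injEq,
      Sym2.eq_iff]
    refine ⟨fun h => h.2, fun h => ⟨?_, h⟩⟩
    rw [← hmem]
    dsimp only
    rwa [Sym2.eq_iff.2 h]
  rw [hfib, Finset.sum_pair (fun h => hne (congrArg Prod.fst h))]
  change _ = 2 * (f α * f ζ)
  ring

theorem quadraticPart_eq : 2 * quadraticPart m = ∑ i : Fin m, ∑ p ∈ joinPairsTwo i,
    changeHom (euler (some i) (hurwitzSeries p.1)) *
      changeHom (euler (some i) (hurwitzSeries p.2)) := by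
  rw [quadraticPart, Finset.mul_sum]
  refine Finset.sum_congr rfl fun i _ => ?_
  simp only [changeHom_euler_hurwitzSeries]
  rw [← Finset.mul_sum, mul_left_comm, ← sum_joinPairsTwo, Finset.mul_sum]
  exact Finset.sum_congr rfl fun p _ => by ring

theorem frac_changeHom_cutSeries {k l : Fin m} (hkl : k ≠ l) :
    frac (changeHom (cutSeries Finset.univ k l)) =
      frac (x l * mu k * hDer 0 ({l}ᶜ : Finset (Fin m)) k) / frac (x k - x l) +
      frac (x k * mu l * hDer 0 ({k}ᶜ : Finset (Fin m)) l) / frac (x l - x k) := by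
  have hc : ∀ j : Fin m, (Finset.univ : Finset (Fin m)).erase j = {j}ᶜ := fun j => by
    ext
    simp
  have h1 := congrArg (changeHom (m := m)) (X_sub_X_mul_cutSeries hkl (Finset.mem_univ k)
    (Finset.mem_univ l))
  simp only [map_mul, map_sub, changeHom_X, changeHom_euler_hurwitzSeries, hc] at h1
  change (x k - x l) * _ = x l * _ - x k * _ at h1
  have h0 : frac (x k - x l) ≠ 0 := by
    rw [frac, Ne, FaithfulSMul.algebraMap_eq_zero_iff]
    exact x_sub_x_ne_zero hkl
  have h2 : frac (x l - x k) = -frac (x k - x l) := by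
    rw [← map_neg, neg_sub]
  rw [h2, div_neg, ← sub_eq_add_neg, ← sub_div, eq_div_iff h0, ← map_mul, ← map_sub]
  congr 1
  linear_combination h1

theorem joinPart_eq : 2 * joinPart m =
    frac (changeHom (∑ k, ∑ l, if k ≠ l then cutSeries Finset.univ k l else 0)) := by
  have h1 : ∀ k l : Fin m, frac (changeHom (if k ≠ l then cutSeries Finset.univ k l else 0)) =
      (if l ≠ k then frac (x l * mu k * hDer 0 ({l}ᶜ : Finset (Fin m)) k) / frac (x k - x l)
        else 0) +
      if k ≠ l then frac (x k * mu l * hDer 0 ({k}ᶜ : Finset (Fin m)) l) / frac (x l - x k)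
        else 0 := by
    intro k l
    by_cases hkl : k = l
    · simp [hkl]
    · rw [if_pos hkl, if_pos hkl, if_pos (Ne.symm hkl), frac_changeHom_cutSeries hkl]
  have h2 : joinPart m = ∑ k : Fin m, ∑ l : Fin m, if l ≠ k then
      frac (x l * mu k * hDer 0 ({l}ᶜ : Finset (Fin m)) k) / frac (x k - x l) else 0 := by
    rw [joinPart]
    refine Finset.sum_congr rfl fun k _ => ?_
    rw [← Finset.sum_filter]
    congr 1
    ext l
    simp
  simp only [map_sum, h1, Finset.sum_add_distrib]
  rw [two_mul]
  congr 1
  rw [h2, Finset.sum_comm]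

/-- The join-cut equation in the variables `w_i`, before the integration over `u`. -/
theorem frac_euler_h (hm : 2 ≤ m) :
    frac (euler none (h 0 m) + ((m : Ser m) - 2) * h 0 m) =
      frac (quadraticPart m) + joinPart m := by
  set H : Ser m := hurwitzSeries Finset.univ with hH
  set A : Ser m := ∑ k, ∑ l, if k ≠ l then cutSeries Finset.univ k l else 0 with hA
  set S : Ser m := ∑ i, ∑ p ∈ joinPairs Finset.univ i,
    euler (some i) (hurwitzSeries p.1) * euler (some i) (hurwitzSeries p.2) with hS
  have hne : (Finset.univ : Finset (Fin m)).Nonempty := ⟨⟨0, by omega⟩, Finset.mem_univ _⟩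
  have hjc : 2 * (euler none H + ((m : Ser m) - 2) * H) = A + S := by
    have := join_cut hne
    rwa [Finset.card_univ, Fintype.card_fin] at this
  have hL : changeHom (2 * (euler none H + ((m : Ser m) - 2) * H)) =
      2 * (changeHom (euler none H) + ((m : Ser m) - 2) * h 0 m) := by
    rw [map_mul, map_add, map_mul, map_sub, map_natCast, map_ofNat, h_zero]
  have he : euler none (h 0 m) = changeHom (euler none H) -
      ∑ i, u * Qw i * changeHom (euler (some i) H) := by
    rw [h_zero, euler_none_changeHom]
  -- The terms with `α = {i}` or `ζ = {i}` come from the dependence of `x_i` on `u`.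
  have hS' : changeHom S = 2 * (∑ i, u * Qw i * changeHom (euler (some i) H)) +
      2 * quadraticPart m := by
    rw [hS, quadraticPart_eq, map_sum, Finset.mul_sum, ← Finset.sum_add_distrib]
    refine Finset.sum_congr rfl fun i _ => ?_
    rw [sum_joinPairs_univ hm, map_add, map_add, map_mul, map_mul, map_sum,
      changeHom_euler_singleton]
    simp only [map_mul]
    ring
  have hT : 2 * (euler none (h 0 m) + ((m : Ser m) - 2) * h 0 m) =
      changeHom A + 2 * quadraticPart m := by
    have := congrArg (changeHom (m := m)) hjc
    rw [hL, map_add, hS'] at this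
    rw [he]
    linear_combination this
  have h2 : frac (2 : Ser m) ≠ 0 := by
    rw [frac, Ne, FaithfulSMul.algebraMap_eq_zero_iff]
    exact two_ne_zero_ser
  have hF := congrArg (frac (m := m)) hT
  rw [map_mul, map_add frac (changeHom A), hA, ← joinPart_eq, map_mul,
    ← map_ofNat (frac (m := m)) 2] at hF
  refine mul_left_cancel₀ h2 ?_
  linear_combination hF

/-- The series must vanish at `u = 0`, as the integral does. -/
theorem integral_pderiv {Y : Ser m} (hY : (MvPowerSeries.X none : Ser m) ∣ Y) :
    integral (MvPowerSeries.pderiv Coeffs none Y) = Y := by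
  ext1 e
  change (if e none = 0 then 0 else _) = _
  split_ifs with he
  · exact (MvPowerSeries.X_dvd_iff.1 hY e he).symm
  · have hle : Finsupp.single none 1 ≤ e := by
      rw [Finsupp.single_le_iff]
      omega
    rw [MvPowerSeries.coeff_pderiv, tsub_add_cancel_of_le hle, Finsupp.tsub_apply,
      Finsupp.single_eq_same, Nat.cast_sub (by omega), Nat.cast_one, sub_add_cancel,
      mul_left_comm, ← map_natCast (MvPolynomial.C : ℚ →+* Coeffs), ← map_mul,
      one_div_mul_cancel (Nat.cast_ne_zero.2 he), map_one, mul_one]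

end Recursion

end DoubleHurwitz

end

open DoubleHurwitz in
theorem theorem5p4 (m : ℕ) (hm : 2 ≤ m) :
    ∃ F : Ser m,
      frac F = (frac (quadraticPart m) + joinPart m) * frac u ^ ((m : ℤ) - 3) ∧
      frac (h 0 m) = frac u ^ (2 - (m : ℤ)) * frac (integral F) := by
  obtain ⟨n, rfl⟩ : ∃ n, m = n + 2 := ⟨m - 2, by omega⟩
  have hu : frac (u : Ser (n + 2)) ≠ 0 := by
    rw [frac, Ne, FaithfulSMul.algebraMap_eq_zero_iff, u]
    intro h0
    have h1 := congrArg (MvPowerSeries.coeff (Finsupp.single none 1)) h0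
    rw [MvPowerSeries.coeff_index_single_self_X, map_zero] at h1
    exact one_ne_zero h1
  have hdvd : (MvPowerSeries.X none : Ser (n + 2)) ∣ h 0 (n + 2) := by
    rw [h_zero]
    exact u_dvd_changeHom (u_dvd_hurwitzSeries ⟨0, Finset.mem_univ _⟩)
  -- With `n = m - 2`, the integrand is `u ^ (n - 1) (u ∂/∂u + n) h`, the derivative of `u ^ n h`.
  refine ⟨MvPowerSeries.pderiv Coeffs none (u ^ n * h 0 (n + 2)), ?_, ?_⟩
  · rw [← frac_euler_h hm]
    have h1 : u * MvPowerSeries.pderiv Coeffs none (u ^ n * h 0 (n + 2)) =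
        u ^ n * (euler none (h 0 (n + 2)) + (((n + 2 : ℕ) : Ser (n + 2)) - 2) * h 0 (n + 2)) := by
      have hpu : MvPowerSeries.pderiv Coeffs none (u : Ser (n + 2)) = 1 :=
        MvPowerSeries.pderiv_X_self
      rw [Derivation.leibniz, MvPowerSeries.pderiv_pow, hpu, euler_apply]
      change u * (_ * _ + _ * _) = u ^ n * (u * _ + _)
      rcases n with _ | n
      · push_cast
        ring
      · rw [Nat.add_sub_cancel]
        push_cast
        ring
    generalize MvPowerSeries.pderiv Coeffs none (u ^ n * h 0 (n + 2)) = F at h1 ⊢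
    have h2 := congrArg (frac (m := n + 2)) h1
    rw [map_mul, map_mul, map_pow] at h2
    have h3 : (((n + 2 : ℕ) : ℤ) - 3) = (n : ℤ) - 1 := by
      push_cast
      ring
    rw [h3, zpow_sub_one₀ hu, zpow_natCast]
    field_simp
    linear_combination h2
  · rw [integral_pderiv (hdvd.mul_left _), map_mul, map_pow, ← mul_assoc, ← zpow_natCast,
      ← zpow_add₀ hu]
    have h3 : (2 - ((n + 2 : ℕ) : ℤ)) + (n : ℤ) = 0 := by
      push_cast
      ring
    rw [h3, zpow_zero, one_mul]
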